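/- Let $M$ be a smooth manifold without boundary, of finite dimension $n$, with a smooth bivector field $\beta$ (not assumed to be Poisson) and a smooth three-form $H$. Let $\beta^\sharp:T^*M\to TM$ be given by $\eta(\beta^\sharp\xi)=\beta(\xi,\eta)$. Repeated indices are summed, and $[\,\cdots]$ around indices denotes antisymmetrization with weight $1/k!$ over the $k$ underlined indices. **Fluxes.** Let $\{e_a\}$ be a smooth local frame of $TM$ with dual coframe $\{e^a\}$, $[e_a,e_b]_L=f^c{}_{ab}e_c$, $\partial_a g=e_a(g)$, $\beta^{ab}=\beta(e^a,e^b)$, $H_{abc}=H(e_a,e_b,e_c)$. Put $$Q_a{}^{bc}=\partial_a\beta^{bc}+f^b{}_{am}\beta^{mc}-f^c{}_{am}\beta^{mb},\qquad R^{abc}=3\bigl(\beta^{[\underline a m}\partial_m\beta^{\underline{bc}]}+f^{[\underline a}{}_{mn}\beta^{\underline b m}\beta^{\underline c]n}\bigr),$$ $$\mathcal H_{abc}=H_{abc},\quad \mathcal F^c{}_{ab}=f^c{}_{ab}-H_{abm}\beta^{mc},\quad \mathcal Q_a{}^{bc}=Q_a{}^{bc}+H_{amn}\beta^{mb}\beta^{nc},\quad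 \mathcal R^{abc}=R^{abc}-H_{mnp}\beta^{ma}\beta^{nb}\beta^{pc}.$$ **Flux Bianchi identities** (for all values of the free indices): $$\mathrm{I}:\ 0=\partial_{[\underline a}\mathcal H_{\underline{bcd}]}-\tfrac32\mathcal F^m{}_{[\underline{ab}}\mathcal H_{m\underline{cd}]};$$ $$\mathrm{II}:\ 0=\bigl(\partial_{[\underline c}\mathcal F^d{}_{\underline{ab}]}+\mathcal F^m{}_{[\underline{ab}}\mathcal F^d{}_{\underline c]m}+\mathcal H_{[\underline{ab}m}\mathcal Q_{\underline c]}{}^{md}\bigr)+\bigl(\partial_{[\underline c}\mathcal H_{\underline{ab}]n}-2\mathcal F^m{}_{[\underline{ab}}\mathcal H_{\underline{cn}]m}\bigr)\beta^{nd};$$ $$\mathrm{III}:\ 0=\bigl(\beta^{cm}\partial_m\mathcal F^d{}_{ab}+2\partial_{[\underline a}\mathcal Q_{\underline b]}{}^{cd}-\mathcal H_{mab}\mathcal R^{mcd}-\mathcal F^m{}_{ab}\mathcal Q_m{}^{cd}+4\mathcal Q_{[\underline a}{}^{[\underline c m}\mathcal F^{\underline d]}{}_{m\underline b]}\bigr)+\bigl(\beta^{cm}\partial_m\mathcal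 H_{abn}-2\partial_{[\underline a}\mathcal F^c{}_{\underline b]n}-3\mathcal H_{m[\underline{ab}}\mathcal Q_{\underline n]}{}^{mc}+3\mathcal F^m{}_{[\underline{ab}}\mathcal F^c{}_{m\underline n]}\bigr)\beta^{nd};$$ $$\mathrm{IV}:\ 0=\bigl(-\partial_a\mathcal R^{bcd}-2\beta^{[\underline c m}\partial_m\mathcal Q_a{}^{\underline b]d}+3\mathcal Q_a{}^{[\underline b m}\mathcal Q_m{}^{\underline{cd}]}-3\mathcal F^{[\underline b}{}_{am}\mathcal R^{\underline{cd}]m}\bigr)+\bigl(2\beta^{[\underline c m}\partial_m\mathcal F^{\underline b]}{}_{an}-\partial_a\mathcal Q_n{}^{bc}+\mathcal Q_m{}^{bc}\mathcal F^m{}_{an}+\mathcal R^{bcm}\mathcal H_{man}-4\mathcal Q_{[\underline a}{}^{[\underline b m}\mathcal F^{\underline c]}{}_{m\underline n]}\bigr)\beta^{nd};$$ $$\mathrm{V}:\ 0=\bigl(\beta^{[\underline c m}\partial_m\mathcal R^{\underline{ab}]d}-2\mathcal R^{[\underline{ab}m}\mathcal Q_m{}^{\underline{cd}]}\bigr)+\bigl(\beta^{[\underline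 c m}\partial_m\mathcal Q_n{}^{\underline{ab}]}+\mathcal R^{[\underline{ab}m}\mathcal F^{\underline c]}{}_{mn}+\mathcal Q_m{}^{[\underline{ab}}\mathcal Q_n{}^{\underline c]m}\bigr)\beta^{nd}.$$ **The Roytenberg bracket.** Let $$[X,Y]_L^H=[X,Y]_L-\beta^\sharp(\iota_Y\iota_XH),\qquad [\xi,\eta]_{KS}^H=L_{\beta^\sharp\xi}\eta-\iota_{\beta^\sharp\eta}d\xi+\iota_{\beta^\sharp\eta}\iota_{\beta^\sharp\xi}H$$ be the $H$-twisted Lie bracket on $TM$ (with anchor $\mathrm{id}$) and the $H$-twisted Koszul–Schouten bracket on $T^*M$ (with anchor $\beta^\sharp$). Let $d^H$ and $d^H_\beta$ be the corresponding differentials, given for a bracket $[\cdot,\cdot]$ with anchor $\rho$ by $(df)(s)=\rho(s)(f)$ on functions and by $(d\omega)(s_0,s_1)=\rho(s_0)(\omega(s_1))-\rho(s_1)(\omega(s_0))-\omega([s_0,s_1])$ on sections of the dual bundle (vector fields being sections of the dual of $T^*M$). Write $\langle X+\xi,Y+\eta\rangle_\pm=\xi(Y)\pm\eta(X)$, let $[\cdot,\cdot]_+$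 be the anticommutator of operators, let $\mathcal R$ be the trivector with components $\mathcal R^{abc}$, and define a bracket on sections of $TM\oplus T^*M$ by additivity in both arguments and $$[\![X,Y]\!]=[X,Y]_L^H+\iota_Y\iota_XH,\qquad [\![\xi,\eta]\!]=[\xi,\eta]^H_{KS}+\iota_\eta\iota_\xi\mathcal R,$$ $$[\![X,\xi]\!]=[\iota_X,d^H]_+\xi-[\iota_\xi,d^H_\beta]_+X+\tfrac12(d^H-d^H_\beta)\langle X,\xi\rangle_-,$$ $$[\![\xi,X]\!]=[\iota_\xi,d^H_\beta]_+X-[\iota_X,d^H]_+\xi+\tfrac12(d^H-d^H_\beta)\langle\xi,X\rangle_-.$$ Let $\alpha:TM\oplus T^*M\to TM$, $\alpha(X+\xi)=X+\beta^\sharp\xi$. **Courant algebroid.** A Courant algebroid over $M$ is a smooth vector bundle with a smooth non-degenerate symmetric bilinear form $\langle\cdot,\cdot\rangle$, a skew-symmetric $\mathbb R$-bilinear bracket on its smooth sections and a smooth bundle map $\alpha$ to $TM$ such that, with $\mathcal D$ defined by $\langle\mathcal Df,s\rangle=\alpha(s)(f)$, for all smooth sections and functions: (1) $\alpha([s_1,s_2])=[\alpha(s_1),\alpha(s_2)]_L$;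 (2) $[s_1,fs_2]=f[s_1,s_2]+\alpha(s_1)(f)\,s_2-\tfrac12\langle s_1,s_2\rangle\mathcal Df$; (3) $\alpha\circ\mathcal D=0$, i.e. $\langle\mathcal Df,\mathcal Dg\rangle=0$; (4) $\alpha(e)\langle s_1,s_2\rangle=\langle[e,s_1]+\tfrac12\mathcal D\langle e,s_1\rangle,s_2\rangle+\langle s_1,[e,s_2]+\tfrac12\mathcal D\langle e,s_2\rangle\rangle$; (5) $[[s_1,s_2],s_3]+[[s_2,s_3],s_1]+[[s_3,s_1],s_2]=\mathcal D\,T(s_1,s_2,s_3)$, where $T(s_1,s_2,s_3)=\tfrac16\langle[s_1,s_2],s_3\rangle+\text{cyclic}$. **Proposition.** Suppose that every point of $M$ has an open neighbourhood with a smooth local frame in which the flux Bianchi identities I–V hold. Then $(TM\oplus T^*M,[\![\cdot,\cdot]\!],\langle\cdot,\cdot\rangle_+,\alpha)$ is a Courant algebroid. Moreover, for every smooth local frame $\{e_a\}$ of $TM$ on an open set, with dual coframe $\{e^a\}$, the bracket satisfies on that set $$[\![e_a,e_b]\!]=\mathcal F^c{}_{ab}e_c+\mathcal H_{abc}e^c,\qquad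 [\![e_a,e^b]\!]=\mathcal Q_a{}^{bc}e_c-\mathcal F^b{}_{ac}e^c,\qquad [\![e^a,e^b]\!]=\mathcal Q_c{}^{ab}e^c+\mathcal R^{abc}e_c.$$ -/

import Mathlib

open Bundle Manifold ContDiff VectorField

noncomputable section

namespace FluxCourant

variable {E : Type*} [NormedAddCommGroup E] [NormedSpace ℝ E] [FiniteDimensional ℝ E]
  {B : Type*} [TopologicalSpace B] (I : ModelWithCorners ℝ E B)
  {M : Type*} [TopologicalSpace M] [ChartedSpace B M]

/-! ### Tangent, cotangent and generalized tangent spaces -/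

instance instFiniteDimensionalTangentSpace (x : M) : FiniteDimensional ℝ (TangentSpace I x) :=
  inferInstanceAs (FiniteDimensional ℝ E)

instance instT2SpaceTangentSpace (x : M) : T2Space (TangentSpace I x) :=
  inferInstanceAs (T2Space E)

/-- The cotangent space `T*ₓM`. -/
abbrev Cotangent (x : M) : Type _ := TangentSpace I x →L[ℝ] ℝ

/-- The fibre of the generalized tangent bundle `TM ⊕ T*M`; `(X, ξ)` stands for `X + ξ`. -/
abbrev GenTangent (x : M) : Type _ := TangentSpace I x × Cotangent I x

variable {I}

/-- A basis of the tangent space `TₓM`, used only to write down the two canonical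
identifications `vecOf` and `covOf`. -/
def fibreBasis (x : M) :
    Module.Basis (Fin (Module.finrank ℝ (TangentSpace I x))) ℝ (TangentSpace I x) :=
  Module.finBasis ℝ (TangentSpace I x)

/-- The basis dual to `fibreBasis`. -/
def fibreCobasis (x : M) (i : Fin (Module.finrank ℝ (TangentSpace I x))) : Cotangent I x :=
  LinearMap.toContinuousLinearMap ((fibreBasis x).coord i)

/-- The identification `(T*ₓM)* = TₓM`: for a linear function `φ` on covectors, `vecOf φ` is the
vector `v` with `η v = φ η` for all `η` (see `apply_vecOf`). -/
def vecOf {x : M} (φ : Cotangent I x → ℝ) : TangentSpace I x :=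
  ∑ i, φ (fibreCobasis x i) • fibreBasis x i

/-- For a linear function `ψ` on tangent vectors, `covOf ψ` is `ψ` as a covector
(see `covOf_apply`). -/
def covOf {x : M} (ψ : TangentSpace I x → ℝ) : Cotangent I x :=
  ∑ i, ψ (fibreBasis x i) • fibreCobasis x i

theorem sum_cobasis_smul_basis (x : M) (v : TangentSpace I x) :
    ∑ i, fibreCobasis x i v • fibreBasis x i = v := by
  simp [fibreCobasis]

theorem apply_vecOf {x : M} (φ : Cotangent I x →ₗ[ℝ] ℝ) (η : Cotangent I x) :
    η (vecOf φ) = φ η := by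
  have h : η = ∑ i, η (fibreBasis x i) • fibreCobasis x i := by
    ext v
    conv_lhs => rw [← sum_cobasis_smul_basis x v]
    simp [mul_comm]
  conv_rhs => rw [h]
  simp [vecOf, mul_comm]

theorem covOf_apply {x : M} (ψ : TangentSpace I x →ₗ[ℝ] ℝ) (v : TangentSpace I x) :
    covOf ψ v = ψ v := by
  conv_rhs => rw [← sum_cobasis_smul_basis x v]
  simp [covOf, mul_comm]

/-! ### Smooth sections, bivectors and three-forms -/

section Bundles

variable (I)
variable (F : Type*) [NormedAddCommGroup F] [NormedSpace ℝ F]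
  {V : M → Type*} [TopologicalSpace (TotalSpace F V)] [∀ x, TopologicalSpace (V x)]
  [∀ x, AddCommGroup (V x)] [∀ x, Module ℝ (V x)] [FiberBundle F V]

/-- The section `s` of the bundle `V` is smooth at `x`. -/
def SmoothSectionAt (s : ∀ x, V x) (x : M) : Prop :=
  ContMDiffAt I (I.prod 𝓘(ℝ, F)) ∞ (fun y => TotalSpace.mk' F y (s y)) x

/-- `s` is a smooth section of the bundle `V`, that is `s ∈ Γ(V)`. -/
def SmoothSection (s : ∀ x, V x) : Prop :=
  ContMDiff I (I.prod 𝓘(ℝ, F)) ∞ (fun y => TotalSpace.mk' F y (s y))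

/-- A field of alternating `k`-forms on the fibres of `V` is smooth if its value on sections
smooth at a point is smooth at that point; in terms of components: they are smooth in every smooth
local frame. -/
def SmoothAlternating {k : ℕ} (θ : ∀ x, V x [⋀^Fin k]→ₗ[ℝ] ℝ) : Prop :=
  ∀ (s : Fin k → ∀ x, V x) (x : M), (∀ i, SmoothSectionAt I F (s i) x) →
    ContMDiffAt I 𝓘(ℝ, ℝ) ∞ (fun y => θ y (fun i => s i y)) x

end Bundles

variable (I M) in
/-- A (smooth) bivector field `β`: an alternating bilinear form on each `T*ₓM`. -/
structure Bivector [IsManifold I ∞ M] where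
  form : ∀ x : M, Cotangent I x [⋀^Fin 2]→ₗ[ℝ] ℝ
  smooth : SmoothAlternating I (E →L[ℝ] ℝ) form

variable (I M) in
/-- A (smooth) differential three-form `H`. -/
structure ThreeForm [IsManifold I ∞ M] where
  form : ∀ x : M, TangentSpace I x [⋀^Fin 3]→ₗ[ℝ] ℝ
  smooth : SmoothAlternating I E form

section Contractions

variable [IsManifold I ∞ M]

/-- `β♯ : T*M → TM`, `η (β♯ ξ) = β (ξ, η)`. -/
def sharp (β : Bivector I M) (x : M) : Cotangent I x →ₗ[ℝ] TangentSpace I x where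
  toFun ξ := vecOf fun η => β.form x ![ξ, η]
  map_add' ξ ξ' := by
    have h (η : Cotangent I x) : β.form x ![ξ + ξ', η] = β.form x ![ξ, η] + β.form x ![ξ', η] :=
      (β.form x).map_vecCons_add ![η] ξ ξ'
    simp only [vecOf, h, add_smul, Finset.sum_add_distrib]
  map_smul' c ξ := by
    have h (η : Cotangent I x) : β.form x ![c • ξ, η] = c • β.form x ![ξ, η] :=
      (β.form x).map_vecCons_smul ![η] c ξ
    simp only [vecOf, h, smul_assoc, Finset.smul_sum, RingHom.id_apply]

/-- `ι_Y ι_X H = H (X, Y, ·)`. -/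
def contract (H : ThreeForm I M) (x : M) (X Y : TangentSpace I x) : Cotangent I x :=
  covOf fun Z => H.form x ![X, Y, Z]

end Contractions

/-! ### Courant algebroids -/

section Courant

variable (I)
variable (F : Type*) [NormedAddCommGroup F] [NormedSpace ℝ F]
  {V : M → Type*} [TopologicalSpace (TotalSpace F V)] [∀ x, TopologicalSpace (V x)]
  [∀ x, AddCommGroup (V x)] [∀ x, Module ℝ (V x)] [FiberBundle F V]
  [IsManifold I ∞ M] [FiniteDimensional ℝ F] [VectorBundle ℝ F V] [ContMDiffVectorBundle ∞ F V I]

/-- The map `𝓓 : C^∞(M) → Γ(V)`, `⟨𝓓f, s⟩ = α(s)(f)`; `𝓓f (x)` is uniquely determined because the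
form is non-degenerate on the finite-dimensional fibre. -/
def gradient (pair : ∀ x, LinearMap.BilinForm ℝ (V x))
    (anchor : ∀ x : M, V x →ₗ[ℝ] TangentSpace I x) (f : M → ℝ) (x : M) : V x :=
  Classical.epsilon fun e : V x => ∀ v : V x, pair x e v = mvfderiv I f x (anchor x v)

/-- The Jacobiator of a bracket. -/
def jacobiator (br : (∀ x, V x) → (∀ x, V x) → ∀ x, V x) (s₁ s₂ s₃ : ∀ x, V x) : ∀ x, V x :=
  br (br s₁ s₂) s₃ + br (br s₂ s₃) s₁ + br (br s₃ s₁) s₂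

/-- `T(s₁, s₂, s₃) = (1/6) ⟨[s₁, s₂], s₃⟩ + cyclic`. -/
def courantT (pair : ∀ x, LinearMap.BilinForm ℝ (V x))
    (br : (∀ x, V x) → (∀ x, V x) → ∀ x, V x) (s₁ s₂ s₃ : ∀ x, V x) (x : M) : ℝ :=
  1 / 6 * pair x (br s₁ s₂ x) (s₃ x) + 1 / 6 * pair x (br s₂ s₃ x) (s₁ x)
    + 1 / 6 * pair x (br s₃ s₁ x) (s₂ x)

/-- `(V, [·,·], ⟨·,·⟩, α)` is a Courant algebroid over `M`. The bracket is given by a formula on all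
sections of `V`; the axioms concern smooth sections, which the bracket has to preserve. -/
structure IsCourantAlgebroid (br : (∀ x, V x) → (∀ x, V x) → ∀ x, V x)
    (pair : ∀ x, LinearMap.BilinForm ℝ (V x))
    (anchor : ∀ x : M, V x →ₗ[ℝ] TangentSpace I x) : Prop where
  /-- The bilinear form is smooth, symmetric and non-degenerate. -/
  pair_smooth : ∀ (s t : ∀ x, V x) (x : M), SmoothSectionAt I F s x → SmoothSectionAt I F t x →
    ContMDiffAt I 𝓘(ℝ, ℝ) ∞ (fun y => pair y (s y) (t y)) x
  pair_symm : ∀ (x : M) (u v : V x), pair x u v = pair x v u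
  pair_nondegenerate : ∀ (x : M) (u : V x), (∀ v, pair x u v = 0) → u = 0
  /-- The anchor is a smooth bundle map. -/
  anchor_smooth : ∀ (s : ∀ x, V x) (x : M), SmoothSectionAt I F s x →
    SmoothSectionAt I E (fun y => anchor y (s y)) x
  /-- The bracket is a skew-symmetric `ℝ`-bilinear operation on smooth sections. -/
  bracket_smooth : ∀ s t : ∀ x, V x, SmoothSection I F s → SmoothSection I F t →
    SmoothSection I F (br s t)
  bracket_skew : ∀ s t : ∀ x, V x, SmoothSection I F s → SmoothSection I F t →
    br s t = - br t s
  bracket_add : ∀ s t u : ∀ x, V x, SmoothSection I F s → SmoothSection I F t →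
    SmoothSection I F u → br s (t + u) = br s t + br s u
  bracket_smul : ∀ (c : ℝ) (s t : ∀ x, V x), SmoothSection I F s → SmoothSection I F t →
    br s (c • t) = c • br s t
  /-- `α([s₁, s₂]) = [α(s₁), α(s₂)]_L`. -/
  anchor_bracket : ∀ s t : ∀ x, V x, SmoothSection I F s → SmoothSection I F t → ∀ x,
    anchor x (br s t x) = mlieBracket I (fun y => anchor y (s y)) (fun y => anchor y (t y)) x
  /-- `[s₁, f s₂] = f [s₁, s₂] + α(s₁)(f) s₂ - (1/2) ⟨s₁, s₂⟩ 𝓓f`. -/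
  leibniz : ∀ (f : M → ℝ) (s t : ∀ x, V x), ContMDiff I 𝓘(ℝ, ℝ) ∞ f → SmoothSection I F s →
    SmoothSection I F t → ∀ x,
    br s (fun y => f y • t y) x = f x • br s t x + mvfderiv I f x (anchor x (s x)) • t x
      - (1 / 2 * pair x (s x) (t x)) • gradient I pair anchor f x
  /-- `α ∘ 𝓓 = 0`, i.e. `⟨𝓓f, 𝓓g⟩ = 0`. -/
  anchor_gradient : ∀ f : M → ℝ, ContMDiff I 𝓘(ℝ, ℝ) ∞ f → ∀ x,
    anchor x (gradient I pair anchor f x) = 0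
  pair_gradient : ∀ f g : M → ℝ, ContMDiff I 𝓘(ℝ, ℝ) ∞ f → ContMDiff I 𝓘(ℝ, ℝ) ∞ g → ∀ x,
    pair x (gradient I pair anchor f x) (gradient I pair anchor g x) = 0
  /-- `α(e)⟨s₁, s₂⟩ = ⟨[e, s₁] + (1/2) 𝓓⟨e, s₁⟩, s₂⟩ + ⟨s₁, [e, s₂] + (1/2) 𝓓⟨e, s₂⟩⟩`. -/
  invariance : ∀ e s t : ∀ x, V x, SmoothSection I F e → SmoothSection I F s →
    SmoothSection I F t → ∀ x,
    mvfderiv I (fun y => pair y (s y) (t y)) x (anchor x (e x))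
      = pair x (br e s x
            + (1 / 2 : ℝ) • gradient I pair anchor (fun y => pair y (e y) (s y)) x) (t x)
        + pair x (s x) (br e t x
            + (1 / 2 : ℝ) • gradient I pair anchor (fun y => pair y (e y) (t y)) x)
  /-- `𝔍(s₁, s₂, s₃) = 𝓓 T(s₁, s₂, s₃)`. -/
  jacobi : ∀ s t u : ∀ x, V x, SmoothSection I F s → SmoothSection I F t → SmoothSection I F u →
    ∀ x, jacobiator br s t u x = gradient I pair anchor (courantT pair br s t u) x

end Courant

/-! ### The differential of a (quasi-)Lie algebroid -/

section Differential

variable (F : Type*) [NormedAddCommGroup F] [NormedSpace ℝ F]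
  {V : M → Type*} [TopologicalSpace (TotalSpace F V)] [∀ x, TopologicalSpace (V x)]
  [∀ x, AddCommGroup (V x)] [∀ x, Module ℝ (V x)] [FiberBundle F V]

/-- The differential of a function, `(d_V f)(s) = ρ(s)(f)`, as a function on the fibre at `x`. -/
def diffZero (ρ : ∀ x : M, V x →ₗ[ℝ] TangentSpace I x) (f : M → ℝ) (x : M) : V x → ℝ :=
  fun v => mvfderiv I f x (ρ x v)

/-- The differential of a section `θ` of `V*`,
`(d_V θ)(s₀, s₁) = ρ(s₀)(θ(s₁)) - ρ(s₁)(θ(s₀)) - θ([s₀, s₁])`. -/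
def diffOne (br : (∀ x, V x) → (∀ x, V x) → ∀ x, V x) (ρ : ∀ x : M, V x →ₗ[ℝ] TangentSpace I x)
    (θ : ∀ x, V x → ℝ) (s₀ s₁ : ∀ x, V x) (x : M) : ℝ :=
  mvfderiv I (fun y => θ y (s₁ y)) x (ρ x (s₀ x)) - mvfderiv I (fun y => θ y (s₀ y)) x (ρ x (s₁ x))
    - θ x (br s₀ s₁ x)

/-- `ι_s (d_V θ)` at `x`, as a function on the fibre at `x`. A vector of the fibre is extended to
a local section in order to evaluate `d_V θ` on it; when `[s, f t] = f [s, t] + ρ(s)(f) t`, the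
result does not depend on the extension. -/
def intDiffOne (br : (∀ x, V x) → (∀ x, V x) → ∀ x, V x)
    (ρ : ∀ x : M, V x →ₗ[ℝ] TangentSpace I x) (θ : ∀ x, V x → ℝ) (s : ∀ x, V x) (x : M) :
    V x → ℝ :=
  fun v => diffOne br ρ θ s (FiberBundle.extend F v) x

/-- The Lie derivative `[ι_s, d_V]₊ θ = ι_s d_V θ + d_V ι_s θ` of a section `θ` of `V*`. -/
def lieDual (br : (∀ x, V x) → (∀ x, V x) → ∀ x, V x)
    (ρ : ∀ x : M, V x →ₗ[ℝ] TangentSpace I x) (s : ∀ x, V x) (θ : ∀ x, V x → ℝ) (x : M) :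
    V x → ℝ :=
  fun v => intDiffOne F br ρ θ s x v + diffZero ρ (fun y => θ y (s y)) x v

end Differential

/-! ### The twisted brackets -/

section Brackets

variable [IsManifold I ∞ M]

variable (I) in
/-- The identity map of `TM`, as an anchor. -/
def idAnchor (x : M) : TangentSpace I x →ₗ[ℝ] TangentSpace I x := LinearMap.id

/-- The `H`-twisted Lie bracket `[X, Y]_L - β♯ (ι_Y ι_X H)`. -/
def twistedLie (β : Bivector I M) (H : ThreeForm I M) (X Y : ∀ x : M, TangentSpace I x) (x : M) :
    TangentSpace I x :=
  mlieBracket I X Y x - sharp β x (contract H x (X x) (Y x))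

/-- The Koszul bracket `[ξ, η]_KS = L_{β♯ξ} η - ι_{β♯η} dξ`. -/
def koszul (β : Bivector I M) (ξ η : ∀ x : M, Cotangent I x) (x : M) : Cotangent I x :=
  covOf (lieDual E (mlieBracket I) (idAnchor I) (fun y => sharp β y (ξ y)) (fun y v => η y v) x)
    - covOf (intDiffOne E (mlieBracket I) (idAnchor I) (fun y v => ξ y v)
        (fun y => sharp β y (η y)) x)

/-- The `H`-twisted Koszul–Schouten bracket `[ξ, η]_KS + ι_{β♯η} ι_{β♯ξ} H`. -/
def twistedKoszul (β : Bivector I M) (H : ThreeForm I M) (ξ η : ∀ x : M, Cotangent I x) (x : M) :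
    Cotangent I x :=
  koszul β ξ η x + contract H x (sharp β x (ξ x)) (sharp β x (η x))

/-- `d^H f`, the differential of a function for the `H`-twisted Lie bracket. -/
def dH (f : M → ℝ) (x : M) : Cotangent I x := covOf (diffZero (idAnchor I) f x)

/-- `d_β^H f`, the differential of a function for the `H`-twisted Koszul–Schouten bracket: the
vector field with `η (d_β^H f) = β♯(η)(f)`. -/
def dβ (β : Bivector I M) (f : M → ℝ) (x : M) : TangentSpace I x := vecOf (diffZero (sharp β) f x)

/-- `[ι_X, d^H]₊ ξ`. -/
def lieH (β : Bivector I M) (H : ThreeForm I M) (X : ∀ x : M, TangentSpace I x)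
    (ξ : ∀ x : M, Cotangent I x) (x : M) : Cotangent I x :=
  covOf (lieDual E (twistedLie β H) (idAnchor I) X (fun y v => ξ y v) x)

/-- `[ι_ξ, d_β^H]₊ X`, where the vector field `X` is a section of the dual of `T*M`. -/
def lieβ (β : Bivector I M) (H : ThreeForm I M) (ξ : ∀ x : M, Cotangent I x)
    (X : ∀ x : M, TangentSpace I x) (x : M) : TangentSpace I x :=
  vecOf (lieDual (E →L[ℝ] ℝ) (twistedKoszul β H) (sharp β) ξ (fun y η => η (X y)) x)

end Brackets

/-! ### Fluxes in a local frame

Throughout, a local frame on `U` is a smooth family `{e_a}` of vector fields which is a basis of the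
tangent space at each point of `U`. The arguments `a b c` of the components are always listed in the
order in which the indices are named in the doc strings, lower indices first. -/

section Fluxes

/-- Antisymmetrization with weight `1 / k!`: `asym T ![a₁, …, a_k]` is `T_{[a₁ … a_k]}`. -/
def asym {ι : Type*} {k : ℕ} (T : (Fin k → ι) → ℝ) (v : Fin k → ι) : ℝ :=
  (k.factorial : ℝ)⁻¹ * ∑ σ : Equiv.Perm (Fin k), ((Equiv.Perm.sign σ : ℤ) : ℝ) * T (v ∘ σ)

variable [IsManifold I ∞ M] {U : Set M}
  {e : Fin (Module.finrank ℝ E) → ∀ x : M, TangentSpace I x}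

/-- The coframe `{eᵃ}` dual to a local frame `{e_a}` on `U`. -/
def coframe (he : IsLocalFrameOn I E ∞ e U) (a : Fin (Module.finrank ℝ E)) (x : M) :
    Cotangent I x :=
  LinearMap.toContinuousLinearMap (he.coeff a x)

variable (e) in
/-- `∂_a g = e_a(g)`. -/
def frameDeriv (a : Fin (Module.finrank ℝ E)) (g : M → ℝ) (x : M) : ℝ :=
  mvfderiv I g x (e a x)

/-- `f^c_{ab}`, where `[e_a, e_b]_L = f^c_{ab} e_c`. -/
def geomF (he : IsLocalFrameOn I E ∞ e U) (a b c : Fin (Module.finrank ℝ E)) (x : M) : ℝ :=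
  coframe he c x (mlieBracket I (e a) (e b) x)

/-- `β^{ab}`. -/
def betaComp (he : IsLocalFrameOn I E ∞ e U) (β : Bivector I M)
    (a b : Fin (Module.finrank ℝ E)) (x : M) : ℝ :=
  β.form x ![coframe he a x, coframe he b x]

variable (e) in
/-- `H_{abc}`. -/
def hComp (H : ThreeForm I M) (a b c : Fin (Module.finrank ℝ E)) (x : M) : ℝ :=
  H.form x ![e a x, e b x, e c x]

/-- `Q_a^{bc} = ∂_a β^{bc} + f^b_{am} β^{mc} - f^c_{am} β^{mb}`. -/
def geomQ (he : IsLocalFrameOn I E ∞ e U) (β : Bivector I M)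
    (a b c : Fin (Module.finrank ℝ E)) (x : M) : ℝ :=
  frameDeriv e a (betaComp he β b c) x
    + ∑ m, geomF he a m b x * betaComp he β m c x - ∑ m, geomF he a m c x * betaComp he β m b x

/-- `R^{abc} = 3 (β^{[a m} ∂_m β^{bc]} + f^{[a}_{mn} β^{b m} β^{c] n})`, the antisymmetrization
being over `a, b, c`. -/
def geomR (he : IsLocalFrameOn I E ∞ e U) (β : Bivector I M)
    (a b c : Fin (Module.finrank ℝ E)) (x : M) : ℝ :=
  3 * asym (fun v =>
    ∑ m, betaComp he β (v 0) m x * frameDeriv e m (betaComp he β (v 1) (v 2)) x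
      + ∑ m, ∑ n, geomF he m n (v 0) x * betaComp he β (v 1) m x * betaComp he β (v 2) n x)
    ![a, b, c]

variable (e) in
/-- `𝓗_{abc} = H_{abc}`. -/
def fluxH (H : ThreeForm I M) (a b c : Fin (Module.finrank ℝ E)) (x : M) : ℝ := hComp e H a b c x

/-- `𝓕^c_{ab} = f^c_{ab} - H_{abm} β^{mc}`. -/
def fluxF (he : IsLocalFrameOn I E ∞ e U) (β : Bivector I M) (H : ThreeForm I M)
    (a b c : Fin (Module.finrank ℝ E)) (x : M) : ℝ :=
  geomF he a b c x - ∑ m, hComp e H a b m x * betaComp he β m c x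

/-- `𝓠_a^{bc} = Q_a^{bc} + H_{amn} β^{mb} β^{nc}`. -/
def fluxQ (he : IsLocalFrameOn I E ∞ e U) (β : Bivector I M) (H : ThreeForm I M)
    (a b c : Fin (Module.finrank ℝ E)) (x : M) : ℝ :=
  geomQ he β a b c x
    + ∑ m, ∑ n, hComp e H a m n x * betaComp he β m b x * betaComp he β n c x

/-- `𝓡^{abc} = R^{abc} - H_{mnp} β^{ma} β^{nb} β^{pc}`. -/
def fluxR (he : IsLocalFrameOn I E ∞ e U) (β : Bivector I M) (H : ThreeForm I M)
    (a b c : Fin (Module.finrank ℝ E)) (x : M) : ℝ :=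
  geomR he β a b c x
    - ∑ m, ∑ n, ∑ p, hComp e H m n p x * betaComp he β m a x * betaComp he β n b x
        * betaComp he β p c x

/-- The flux Bianchi identities I–V at the point `x`, in the local frame `{e_a}`. -/
structure FluxBianchi (he : IsLocalFrameOn I E ∞ e U) (β : Bivector I M) (H : ThreeForm I M)
    (x : M) : Prop where
  /-- `0 = ∂_{[a} 𝓗_{bcd]} - (3/2) 𝓕^m_{[ab} 𝓗_{m cd]}`. -/
  bianchi_I : ∀ a b c d : Fin (Module.finrank ℝ E),
    0 = asym (fun v => frameDeriv e (v 0) (fluxH e H (v 1) (v 2) (v 3)) x) ![a, b, c, d]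
      - 3 / 2 * asym (fun v =>
          ∑ m, fluxF he β H (v 0) (v 1) m x * fluxH e H m (v 2) (v 3) x) ![a, b, c, d]
  /-- `0 = (∂_{[c} 𝓕^d_{ab]} + 𝓕^m_{[ab} 𝓕^d_{c]m} + 𝓗_{[ab m} 𝓠_{c]}^{md})
    + (∂_{[c} 𝓗_{ab]n} - 2 𝓕^m_{[ab} 𝓗_{cn]m}) β^{nd}`. -/
  bianchi_II : ∀ a b c d : Fin (Module.finrank ℝ E),
    0 = (asym (fun v => frameDeriv e (v 0) (fluxF he β H (v 1) (v 2) d) x) ![c, a, b]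
        + asym (fun v =>
            ∑ m, fluxF he β H (v 0) (v 1) m x * fluxF he β H (v 2) m d x) ![a, b, c]
        + asym (fun v =>
            ∑ m, fluxH e H (v 0) (v 1) m x * fluxQ he β H (v 2) m d x) ![a, b, c])
      + ∑ n, (asym (fun v => frameDeriv e (v 0) (fluxH e H (v 1) (v 2) n) x) ![c, a, b]
          - 2 * asym (fun v =>
              ∑ m, fluxF he β H (v 0) (v 1) m x * fluxH e H (v 2) (v 3) m x) ![a, b, c, n])
        * betaComp he β n d x
  /-- `0 = (β^{cm} ∂_m 𝓕^d_{ab} + 2 ∂_{[a} 𝓠_{b]}^{cd} - 𝓗_{mab} 𝓡^{mcd} - 𝓕^m_{ab} 𝓠_m^{cd}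
      + 4 𝓠_{[a}^{[c m} 𝓕^{d]}_{m b]})
    + (β^{cm} ∂_m 𝓗_{abn} - 2 ∂_{[a} 𝓕^c_{b]n} - 3 𝓗_{m[ab} 𝓠_{n]}^{mc}
      + 3 𝓕^m_{[ab} 𝓕^c_{mn]}) β^{nd}`; the last antisymmetrization is over `a, b, n`. -/
  bianchi_III : ∀ a b c d : Fin (Module.finrank ℝ E),
    0 = (∑ m, betaComp he β c m x * frameDeriv e m (fluxF he β H a b d) x
        + 2 * asym (fun v => frameDeriv e (v 0) (fluxQ he β H (v 1) c d) x) ![a, b]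
        - ∑ m, fluxH e H m a b x * fluxR he β H m c d x
        - ∑ m, fluxF he β H a b m x * fluxQ he β H m c d x
        + 4 * asym (fun v => asym (fun w =>
            ∑ m, fluxQ he β H (v 0) (w 0) m x * fluxF he β H m (v 1) (w 1) x) ![c, d]) ![a, b])
      + ∑ n, (∑ m, betaComp he β c m x * frameDeriv e m (fluxH e H a b n) x
          - 2 * asym (fun v => frameDeriv e (v 0) (fluxF he β H (v 1) n c) x) ![a, b]
          - 3 * asym (fun v =>
              ∑ m, fluxH e H m (v 0) (v 1) x * fluxQ he β H (v 2) m c x) ![a, b, n]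
          + 3 * asym (fun v =>
              ∑ m, fluxF he β H (v 0) (v 1) m x * fluxF he β H m (v 2) c x) ![a, b, n])
        * betaComp he β n d x
  /-- `0 = (- ∂_a 𝓡^{bcd} - 2 β^{[c m} ∂_m 𝓠_a^{b]d} + 3 𝓠_a^{[b m} 𝓠_m^{cd]}
      - 3 𝓕^{[b}_{am} 𝓡^{cd]m})
    + (2 β^{[c m} ∂_m 𝓕^{b]}_{an} - ∂_a 𝓠_n^{bc} + 𝓠_m^{bc} 𝓕^m_{an} + 𝓡^{bcm} 𝓗_{man}
      - 4 𝓠_{[a}^{[b m} 𝓕^{c]}_{m n]}) β^{nd}`. -/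
  bianchi_IV : ∀ a b c d : Fin (Module.finrank ℝ E),
    0 = (- frameDeriv e a (fluxR he β H b c d) x
        - 2 * asym (fun v =>
            ∑ m, betaComp he β (v 0) m x * frameDeriv e m (fluxQ he β H a (v 1) d) x) ![c, b]
        + 3 * asym (fun v =>
            ∑ m, fluxQ he β H a (v 0) m x * fluxQ he β H m (v 1) (v 2) x) ![b, c, d]
        - 3 * asym (fun v =>
            ∑ m, fluxF he β H a m (v 0) x * fluxR he β H (v 1) (v 2) m x) ![b, c, d])
      + ∑ n, (2 * asym (fun v =>
            ∑ m, betaComp he β (v 0) m x * frameDeriv e m (fluxF he β H a n (v 1)) x) ![c, b]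
          - frameDeriv e a (fluxQ he β H n b c) x
          + ∑ m, fluxQ he β H m b c x * fluxF he β H a n m x
          + ∑ m, fluxR he β H b c m x * fluxH e H m a n x
          - 4 * asym (fun v => asym (fun w =>
              ∑ m, fluxQ he β H (v 0) (w 0) m x * fluxF he β H m (v 1) (w 1) x) ![b, c]) ![a, n])
        * betaComp he β n d x
  /-- `0 = (β^{[c m} ∂_m 𝓡^{ab]d} - 2 𝓡^{[ab m} 𝓠_m^{cd]})
    + (β^{[c m} ∂_m 𝓠_n^{ab]} + 𝓡^{[ab m} 𝓕^{c]}_{mn} + 𝓠_m^{[ab} 𝓠_n^{c]m}) β^{nd}`. -/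
  bianchi_V : ∀ a b c d : Fin (Module.finrank ℝ E),
    0 = (asym (fun v =>
            ∑ m, betaComp he β (v 0) m x * frameDeriv e m (fluxR he β H (v 1) (v 2) d) x) ![c, a, b]
        - 2 * asym (fun v =>
            ∑ m, fluxR he β H (v 0) (v 1) m x * fluxQ he β H m (v 2) (v 3) x) ![a, b, c, d])
      + ∑ n, (asym (fun v =>
            ∑ m, betaComp he β (v 0) m x * frameDeriv e m (fluxQ he β H n (v 1) (v 2)) x) ![c, a, b]
          + asym (fun v =>
              ∑ m, fluxR he β H (v 0) (v 1) m x * fluxF he β H m n (v 2) x) ![a, b, c]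
          + asym (fun v =>
              ∑ m, fluxQ he β H m (v 0) (v 1) x * fluxQ he β H n (v 2) m x) ![a, b, c])
        * betaComp he β n d x

end Fluxes

/-! ### The Roytenberg bracket on `TM ⊕ T*M` -/

section Roytenberg

variable [IsManifold I ∞ M]

/-- The frame of `TM` near `p` given by the preferred local trivialization at `p`. -/
def chartFrame (p : M) : Fin (Module.finrank ℝ E) → ∀ x : M, TangentSpace I x :=
  (trivializationAt E (TangentSpace I) p).localFrame (Module.finBasis ℝ E)

theorem isLocalFrameOn_chartFrame (p : M) :
    IsLocalFrameOn I E ∞ (chartFrame (I := I) p)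
      (trivializationAt E (TangentSpace I) p).baseSet :=
  Trivialization.isLocalFrameOn_localFrame_baseSet I ∞ (trivializationAt E (TangentSpace I) p)
    (Module.finBasis ℝ E)

/-- `ι_η ι_ξ 𝓡`, where `𝓡` is the trivector with components `𝓡^{abc}`; the components at `x` are
taken in the frame given by the preferred trivialization at `x`. -/
def contractR (β : Bivector I M) (H : ThreeForm I M) (x : M) (ξ η : Cotangent I x) :
    TangentSpace I x :=
  ∑ a, ∑ b, ∑ c, (fluxR (isLocalFrameOn_chartFrame x) β H a b c x
    * ξ (chartFrame x a x) * η (chartFrame x b x)) • chartFrame (I := I) x c x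

variable (I) in
/-- `⟨X + ξ, Y + η⟩₊ = ξ(Y) + η(X)`. -/
def pairPlus (x : M) : LinearMap.BilinForm ℝ (GenTangent I x) :=
  LinearMap.mk₂ ℝ (fun u v => u.2 v.1 + v.2 u.1)
    (fun u u' v => by simp; ring) (fun c u v => by simp; ring)
    (fun u v v' => by simp; ring) (fun c u v => by simp; ring)

/-- `⟨X + ξ, Y + η⟩₋ = ξ(Y) - η(X)`, as a function on `M`. -/
def pairMinus (s t : ∀ x : M, GenTangent I x) (x : M) : ℝ := (s x).2 (t x).1 - (t x).2 (s x).1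

/-- The anchor `X + ξ ↦ X + β♯ ξ`. -/
def genAnchor (β : Bivector I M) (x : M) : GenTangent I x →ₗ[ℝ] TangentSpace I x :=
  LinearMap.coprod LinearMap.id (sharp β x)

/-- A vector field as a section of `TM ⊕ T*M`. -/
def ofVec (X : ∀ x : M, TangentSpace I x) (x : M) : GenTangent I x := (X x, 0)

/-- A one-form as a section of `TM ⊕ T*M`. -/
def ofForm (ξ : ∀ x : M, Cotangent I x) (x : M) : GenTangent I x := (0, ξ x)

/-- `⟦X, Y⟧ = [X, Y]_L^H + ι_Y ι_X H`. -/
def bracketVV (β : Bivector I M) (H : ThreeForm I M) (X Y : ∀ x : M, TangentSpace I x) :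
    ∀ x : M, GenTangent I x :=
  ofVec (twistedLie β H X Y) + ofForm (fun x => contract H x (X x) (Y x))

/-- `⟦X, ξ⟧ = [ι_X, d^H]₊ ξ - [ι_ξ, d_β^H]₊ X + (1/2) (d^H - d_β^H) ⟨X, ξ⟩₋`. -/
def bracketVF (β : Bivector I M) (H : ThreeForm I M) (X : ∀ x : M, TangentSpace I x)
    (ξ : ∀ x : M, Cotangent I x) : ∀ x : M, GenTangent I x :=
  ofForm (lieH β H X ξ) - ofVec (lieβ β H ξ X)
    + (1 / 2 : ℝ) • (ofForm (dH (pairMinus (ofVec X) (ofForm ξ)))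
        - ofVec (dβ β (pairMinus (ofVec X) (ofForm ξ))))

/-- `⟦ξ, X⟧ = [ι_ξ, d_β^H]₊ X - [ι_X, d^H]₊ ξ + (1/2) (d^H - d_β^H) ⟨ξ, X⟩₋`. -/
def bracketFV (β : Bivector I M) (H : ThreeForm I M) (ξ : ∀ x : M, Cotangent I x)
    (X : ∀ x : M, TangentSpace I x) : ∀ x : M, GenTangent I x :=
  ofVec (lieβ β H ξ X) - ofForm (lieH β H X ξ)
    + (1 / 2 : ℝ) • (ofForm (dH (pairMinus (ofForm ξ) (ofVec X)))
        - ofVec (dβ β (pairMinus (ofForm ξ) (ofVec X))))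

/-- `⟦ξ, η⟧ = [ξ, η]_KS^H + ι_η ι_ξ 𝓡`. -/
def bracketFF (β : Bivector I M) (H : ThreeForm I M) (ξ η : ∀ x : M, Cotangent I x) :
    ∀ x : M, GenTangent I x :=
  ofForm (twistedKoszul β H ξ η) + ofVec (fun x => contractR β H x (ξ x) (η x))

/-- The Roytenberg bracket on sections of `TM ⊕ T*M`,
`⟦X + ξ, Y + η⟧ = ⟦X, Y⟧ + ⟦X, η⟧ + ⟦ξ, Y⟧ + ⟦ξ, η⟧`. -/
def roytenbergBracket (β : Bivector I M) (H : ThreeForm I M) (s t : ∀ x : M, GenTangent I x) :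
    ∀ x : M, GenTangent I x :=
  bracketVV β H (fun x => (s x).1) (fun x => (t x).1)
    + bracketVF β H (fun x => (s x).1) (fun x => (t x).2)
    + bracketFV β H (fun x => (s x).2) (fun x => (t x).1)
    + bracketFF β H (fun x => (s x).2) (fun x => (t x).2)

end Roytenberg

end FluxCourant

end

/-!
The map `e^β : X + ξ ↦ X + β♯ξ + ξ` is an orthogonal automorphism of `TM ⊕ T*M`, and composing it
with the projection to `TM` gives the anchor `α`. It carries the Roytenberg bracket to the
`H`-twisted Courant bracket
`[X, Y] + L_X η - L_Y ξ - (1/2) d(η(X) - ξ(Y)) + ι_Y ι_X H`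
(`expMap_roytenbergBracket`), and the gradient `𝓓f` to `df`. Nothing is assumed on `β` or `H` for
this; the one point that is not a direct comparison of terms is that the defect
`[β♯ξ, β♯η] - β♯[ξ, η]^H_KS` is tensorial and has the components `𝓡^{abc}`
(`tensorial_anchorDefect`, `coframe_anchorDefect`), so that it is `ι_η ι_ξ 𝓡`. Every axiom of a
Courant algebroid is therefore the corresponding axiom for the `H`-twisted Courant bracket. All of
these are Cartan calculus, and only the Jacobi identity (`courantBracket_jacobi`) involves
a condition, namely `dH = 0`.

The Bianchi identity I in a local frame is that condition (`extH_frame_eq_zero`): in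
`𝓕^m_{[ab} 𝓗_{m cd]}` the part `H_{abp} β^{pm} H_{mcd}` of `𝓕` is skew under the exchange of the
pairs `ab` and `cd` and drops out, and what is left is the Cartan formula for `dH` on the frame.
As `dH` is a tensor, it vanishes as soon as its components in one frame near each point do.

The formulas for the bracket of frame sections come from writing out the components of the four
parts of the Roytenberg bracket (`bracket_frame_frame`, `bracket_frame_coframe`,
`bracket_coframe_coframe`).
-/

noncomputable section

open Filter Topology

set_option linter.unusedSectionVars false

namespace FluxCourant

/-! ### Smooth vector fields, covector fields and coframes -/

section DiffSection

variable {E : Type*} [NormedAddCommGroup E] [NormedSpace ℝ E]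
  {B : Type*} [TopologicalSpace B] (I : ModelWithCorners ℝ E B)
  {M : Type*} [TopologicalSpace M] [ChartedSpace B M]
  (F : Type*) [NormedAddCommGroup F] [NormedSpace ℝ F]
  {V : M → Type*} [TopologicalSpace (TotalSpace F V)] [∀ x, TopologicalSpace (V x)]
  [∀ x, AddCommGroup (V x)] [∀ x, Module ℝ (V x)] [FiberBundle F V]

/-- The section `s` of the bundle `V` is differentiable at `x`. -/
abbrev DiffSectionAt (s : ∀ x, V x) (x : M) : Prop :=
  MDifferentiableAt I (I.prod 𝓘(ℝ, F)) (fun y => TotalSpace.mk' F y (s y)) x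

variable {I F} in
theorem SmoothSectionAt.diff {s : ∀ x, V x} {x : M} (h : SmoothSectionAt I F s x) :
    DiffSectionAt I F s x :=
  ContMDiffAt.mdifferentiableAt h (by simp)

end DiffSection

variable {E : Type*} [NormedAddCommGroup E] [NormedSpace ℝ E] [FiniteDimensional ℝ E]
  {B : Type*} [TopologicalSpace B] {I : ModelWithCorners ℝ E B}
  {M : Type*} [TopologicalSpace M] [ChartedSpace B M]

/-- The derivative `X(f)` of a function along a vector field. -/
def der (X : ∀ x : M, TangentSpace I x) (f : M → ℝ) (x : M) : ℝ := mvfderiv I f x (X x)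

/-- The function `ξ(X)`. -/
def ev (ξ : ∀ x : M, Cotangent I x) (X : ∀ x : M, TangentSpace I x) (x : M) : ℝ := ξ x (X x)

section Derivations

variable {X Y : ∀ x : M, TangentSpace I x} {f g : M → ℝ} {x : M}

theorem der_congr (h : f =ᶠ[𝓝 x] g) : der X f x = der X g x := by
  have : mfderiv I 𝓘(ℝ, ℝ) f x = mfderiv I 𝓘(ℝ, ℝ) g x := h.mfderiv_eq
  unfold der mvfderiv
  simp only [this]
  rfl

theorem der_add (hf : MDifferentiableAt I 𝓘(ℝ, ℝ) f x) (hg : MDifferentiableAt I 𝓘(ℝ, ℝ) g x) :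
    der X (fun y => f y + g y) x = der X f x + der X g x := by
  simp [der, mvfderiv_fun_add hf hg]

theorem der_sub (hf : MDifferentiableAt I 𝓘(ℝ, ℝ) f x) (hg : MDifferentiableAt I 𝓘(ℝ, ℝ) g x) :
    der X (fun y => f y - g y) x = der X f x - der X g x := by
  simp [der, mvfderiv_fun_sub hf hg]

theorem der_neg : der X (fun y => - f y) x = - der X f x := by
  simp [der, mvfderiv_fun_neg]

theorem der_const (c : ℝ) : der X (fun _ => c) x = 0 := by
  simp [der, mvfderiv_const]

theorem der_mul (hf : MDifferentiableAt I 𝓘(ℝ, ℝ) f x) (hg : MDifferentiableAt I 𝓘(ℝ, ℝ) g x) :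
    der X (fun y => f y * g y) x = der X f x * g x + f x * der X g x := by
  simp [der, mvfderiv_fun_mul hf hg]; ring

theorem der_const_mul (c : ℝ) (hf : MDifferentiableAt I 𝓘(ℝ, ℝ) f x) :
    der X (fun y => c * f y) x = c * der X f x := by
  rw [der_mul mdifferentiableAt_const hf, der_const]; ring

end Derivations

variable [IsManifold I ∞ M]

section Smoothness

variable {ξ : ∀ x : M, Cotangent I x} {X Y : ∀ x : M, TangentSpace I x} {f : M → ℝ} {x : M}

theorem smooth_ev (hξ : SmoothSectionAt I (E →L[ℝ] ℝ) ξ x) (hX : SmoothSectionAt I E X x) :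
    ContMDiffAt I 𝓘(ℝ, ℝ) ∞ (ev ξ X) x := by
  have := ContMDiffAt.clm_bundle_apply (E₂ := fun x : M => Bundle.Trivial M ℝ x) (F₂ := ℝ) hξ hX
  simpa [contMDiffAt_section] using! this

theorem mdiff_ev (hξ : DiffSectionAt I (E →L[ℝ] ℝ) ξ x) (hX : DiffSectionAt I E X x) :
    MDifferentiableAt I 𝓘(ℝ, ℝ) (ev ξ X) x := by
  have := MDifferentiableAt.clm_bundle_apply (E₂ := fun x : M => Bundle.Trivial M ℝ x)
    (F₂ := ℝ) hξ hX
  simpa [mdifferentiableAt_section] using! this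

theorem smooth_der (hX : SmoothSectionAt I E X x) (hf : ContMDiffAt I 𝓘(ℝ, ℝ) ∞ f x) :
    ContMDiffAt I 𝓘(ℝ, ℝ) ∞ (der X f) x := by
  have h1 := hf.mfderiv_const (m := ∞) (by simp)
  have := ContMDiffAt.clm_apply_of_inCoordinates (E₁ := fun x : M => TangentSpace I x)
    (E₂ := fun y : ℝ => TangentSpace 𝓘(ℝ, ℝ) y) (b₁ := id) (b₂ := f) h1 hX hf
  rw [contMDiffAt_totalSpace] at this
  simpa using! this.2

theorem smooth_mlieBracket (hX : SmoothSectionAt I E X x)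
    (hY : SmoothSectionAt I E Y x) :
    SmoothSectionAt I E (mlieBracket I X Y) x := by
  have : CompleteSpace E := FiniteDimensional.complete ℝ E
  have : IsManifold I (minSmoothness ℝ 2) M := by simpa using inferInstanceAs (IsManifold I 2 M)
  have : IsManifold I (((⊤ : ℕ∞) : WithTop ℕ∞) + 1) M := by
    simpa using inferInstanceAs (IsManifold I ∞ M)
  exact ContMDiffAt.mlieBracket_vectorField (m := ⊤) (n := ⊤) hX hY (by simp)

/-- A covector field is smooth if its values on the vectors of a frame are: in the trivialization
these values are its coordinates. -/
theorem smooth_covector_of_chartFrame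
    (h : ∀ a, ContMDiffAt I 𝓘(ℝ, ℝ) ∞ (ev ξ (chartFrame (I := I) x a)) x) :
    SmoothSectionAt I (E →L[ℝ] ℝ) ξ x := by
  unfold SmoothSectionAt
  rw [contMDiffAt_hom_bundle (E₁ := fun x : M => TangentSpace I x)
    (E₂ := fun x : M => Bundle.Trivial M ℝ x)]
  refine ⟨contMDiffAt_id, ?_⟩
  let b := Module.finBasis ℝ E
  have key : ContMDiffAt I 𝓘(ℝ, E →L[ℝ] ℝ) ∞ (fun y => ∑ a, (ev ξ (chartFrame (I := I) x a) y) •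
      (LinearMap.toContinuousLinearMap (b.coord a) : E →L[ℝ] ℝ)) x := by
    refine ContMDiffAt.sum fun a _ => ?_
    exact (h a).smul contMDiffAt_const
  refine key.congr_of_eventuallyEq ?_
  filter_upwards [(trivializationAt E (TangentSpace I) x).open_baseSet.mem_nhds
    (FiberBundle.mem_baseSet_trivializationAt' x)] with y hy
  ext v
  simp only [ContinuousLinearMap.inCoordinates, Trivial.continuousLinearMapAt_trivialization,
    Trivial.fiberBundle_trivializationAt', ContinuousLinearMap.id_comp,
    ContinuousLinearMap.comp_apply, sum_apply, smul_apply]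
  conv_lhs => rw [← b.sum_repr v]
  simp only [map_sum, map_smul, smul_eq_mul]
  refine Finset.sum_congr rfl fun a _ => ?_
  rw [mul_comm]
  congr 1
  simp [ev, chartFrame, Trivialization.localFrame_apply_of_mem_baseSet _ _ hy,
    Trivialization.basisAt, b]
  rw [Trivialization.symmL_apply _ hy]

end Smoothness

section Frames

variable {U : Set M} {e : Fin (Module.finrank ℝ E) → ∀ x : M, TangentSpace I x}
  (he : IsLocalFrameOn I E ∞ e U) {X : ∀ x : M, TangentSpace I x} {x : M}

theorem smooth_frame (he : IsLocalFrameOn I E ∞ e U) (hU : IsOpen U) (hx : x ∈ U)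
    (a : Fin (Module.finrank ℝ E)) :
    SmoothSectionAt I E (e a) x :=
  he.contMDiffAt hU hx a

theorem sum_coframe_smul (hx : x ∈ U) (v : TangentSpace I x) :
    ∑ a, coframe he a x v • e a x = v := by
  have := he.coeff_sum_eq (FiberBundle.extend E v) hx
  simpa [coframe] using this.symm

theorem coframe_frame (hx : x ∈ U) (a b : Fin (Module.finrank ℝ E)) :
    coframe he a x (e b x) = if a = b then 1 else 0 := by
  simp only [coframe, LinearMap.coe_toContinuousLinearMap']
  rw [he.coeff_apply_of_mem hx (e b) a, ← he.toBasisAt_coe hx b, Module.Basis.repr_self]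
  simp [Finsupp.single_apply, eq_comm]

/-- The components of a smooth vector field in a smooth local frame are smooth: in the
trivialization they are obtained by applying the inverse of the matrix of the frame, and matrix
inversion is smooth. -/
theorem smooth_coframe_apply (hU : IsOpen U) (hx : x ∈ U) (hX : SmoothSectionAt I E X x)
    (a : Fin (Module.finrank ℝ E)) :
    ContMDiffAt I 𝓘(ℝ, ℝ) ∞ (ev (coframe he a) X) x := by
  let t := trivializationAt E (TangentSpace I) x
  have hxt : x ∈ t.baseSet := FiberBundle.mem_baseSet_trivializationAt' x
  let v (a : Fin (Module.finrank ℝ E)) (y : M) : E := (t ⟨y, e a y⟩).2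
  have hv (a) : ContMDiffAt I 𝓘(ℝ, E) ∞ (v a) x :=
    (contMDiffAt_section x).1 (smooth_frame he hU hx a)
  let L (y : M) : (Fin (Module.finrank ℝ E) → ℝ) →L[ℝ] E :=
    ∑ a, (ContinuousLinearMap.proj (R := ℝ) (φ := fun _ => ℝ) a).smulRight (v a y)
  have hL : ContMDiffAt I 𝓘(ℝ, (Fin (Module.finrank ℝ E) → ℝ) →L[ℝ] E) ∞ L x := by
    refine ContMDiffAt.sum fun a _ => ?_
    exact ((ContinuousLinearMap.smulRightL ℝ (Fin (Module.finrank ℝ E) → ℝ) E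
      (ContinuousLinearMap.proj (R := ℝ) (φ := fun _ => ℝ) a)).contDiff.contMDiff.contMDiffAt).comp
        x (hv a)
  have hLe (y : M) (hy : y ∈ U) (hyt : y ∈ t.baseSet) :
      L y = (((he.toBasisAt hy).equivFun.symm.trans
        (t.linearEquivAt ℝ y hyt)).toContinuousLinearEquiv : _ →L[ℝ] E) := by
    ext c
    simp [L, v, Module.Basis.equivFun_symm_apply]
  have hinv : ContMDiffAt I 𝓘(ℝ, E →L[ℝ] (Fin (Module.finrank ℝ E) → ℝ)) ∞
      (fun y => (L y).inverse) x := by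
    have := contDiffAt_map_inverse (𝕜 := ℝ) (n := ∞) (((he.toBasisAt hx).equivFun.symm.trans
        (t.linearEquivAt ℝ x hxt)).toContinuousLinearEquiv)
    rw [← hLe x hx hxt] at this
    exact this.contMDiffAt.comp x hL
  have hfin : ContMDiffAt I 𝓘(ℝ, ℝ) ∞ (fun y => (L y).inverse (t ⟨y, X y⟩).2 a) x := by
    have := hinv.clm_apply ((contMDiffAt_section x).1 hX)
    exact contMDiffAt_pi_space.1 this a
  refine hfin.congr_of_eventuallyEq ?_
  filter_upwards [hU.mem_nhds hx, t.open_baseSet.mem_nhds hxt] with y hy hyt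
  rw [hLe y hy hyt, ContinuousLinearMap.inverse_equiv]
  simp [ev, coframe, IsLocalFrameOn.coeff, hy]
  rw [Trivialization.symm_apply_apply_mk t hyt]

theorem smooth_coframe (hU : IsOpen U) (hx : x ∈ U) (a : Fin (Module.finrank ℝ E)) :
    SmoothSectionAt I (E →L[ℝ] ℝ) (coframe he a) x :=
  smooth_covector_of_chartFrame fun b => smooth_coframe_apply he hU hx
    (smooth_frame (isLocalFrameOn_chartFrame x)
      (trivializationAt E (TangentSpace I) x).open_baseSet
      (FiberBundle.mem_baseSet_trivializationAt' x) b) a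

theorem smooth_vector_of_coframe (hU : IsOpen U) (hx : x ∈ U)
    (h : ∀ a, ContMDiffAt I 𝓘(ℝ, ℝ) ∞ (ev (coframe he a) X) x) : SmoothSectionAt I E X x :=
  he.contMDiffAt_of_coeff h (hU.mem_nhds hx)

theorem diff_vector_of_coframe (hU : IsOpen U) (hx : x ∈ U)
    (h : ∀ a, MDifferentiableAt I 𝓘(ℝ, ℝ) (ev (coframe he a) X) x) : DiffSectionAt I E X x := by
  have he' : IsLocalFrameOn I E 1 e U :=
    ⟨he.linearIndependent, he.generating, fun i => (he.contMDiffOn i).of_le (by simp)⟩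
  exact he'.mdifferentiableAt_of_coeff h (hU.mem_nhds hx)

end Frames

section Bivectors

variable (β : Bivector I M) {ξ η : ∀ x : M, Cotangent I x} {x : M}

theorem apply_sharp (x : M) (ξ η : Cotangent I x) : η (sharp β x ξ) = β.form x ![ξ, η] := by
  have hup (η : Cotangent I x) : ![ξ, η] = Function.update ![ξ, 0] 1 η := by
    ext i; fin_cases i <;> rfl
  let φ : Cotangent I x →ₗ[ℝ] ℝ :=
    { toFun := fun η => β.form x ![ξ, η]
      map_add' := fun η η' => by
        rw [hup (η + η'), (β.form x).map_update_add, ← hup, ← hup]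
      map_smul' := fun c η => by
        rw [hup (c • η), (β.form x).map_update_smul, ← hup, RingHom.id_apply] }
  exact apply_vecOf φ η

theorem apply_sharp_swap (x : M) (ξ η : Cotangent I x) : η (sharp β x ξ) = - ξ (sharp β x η) := by
  rw [apply_sharp, apply_sharp]
  have := (β.form x).map_swap ![η, ξ] (i := 0) (j := 1) (by decide)
  rw [← this]
  congr 1
  ext i
  fin_cases i <;> simp

/-- The vector field `β♯ ξ`. -/
def sharpF (ξ : ∀ x : M, Cotangent I x) (x : M) : TangentSpace I x := sharp β x (ξ x)

theorem ev_sharpF_swap (ξ η : ∀ x : M, Cotangent I x) :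
    ev η (sharpF β ξ) = fun y => - ev ξ (sharpF β η) y := by
  ext y
  exact apply_sharp_swap β y (ξ y) (η y)

theorem smooth_sharpF (hξ : SmoothSectionAt I (E →L[ℝ] ℝ) ξ x) :
    SmoothSectionAt I E (sharpF β ξ) x := by
  have hU := (trivializationAt E (TangentSpace I) x).open_baseSet
  have hx := FiberBundle.mem_baseSet_trivializationAt' (F := E) (E := TangentSpace I) x
  refine smooth_vector_of_coframe (isLocalFrameOn_chartFrame x) hU hx fun a => ?_
  have := β.smooth ![ξ, coframe (isLocalFrameOn_chartFrame x) a] x (by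
    intro i
    fin_cases i
    · exact hξ
    · exact smooth_coframe _ hU hx a)
  refine this.congr_of_eventuallyEq (Eventually.of_forall fun y => ?_)
  simp only [ev, sharpF, apply_sharp]
  congr 1
  ext i
  fin_cases i <;> rfl

/-- `β♯ξ` is differentiable for `ξ` merely differentiable, although the smoothness of `β` is
only given on smooth sections: its components are `- ξ(β♯eᵃ)`, where `β♯eᵃ` is smooth. -/
theorem diff_sharpF (hξ : DiffSectionAt I (E →L[ℝ] ℝ) ξ x) :
    DiffSectionAt I E (sharpF β ξ) x := by
  have hU := (trivializationAt E (TangentSpace I) x).open_baseSet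
  have hx := FiberBundle.mem_baseSet_trivializationAt' (F := E) (E := TangentSpace I) x
  refine diff_vector_of_coframe (isLocalFrameOn_chartFrame x) hU hx fun a => ?_
  rw [ev_sharpF_swap]
  exact (mdiff_ev hξ (smooth_sharpF β (smooth_coframe _ hU hx a)).diff).neg

end Bivectors

section ThreeForms

variable (H : ThreeForm I M) {X Y Z : ∀ x : M, TangentSpace I x} {x : M}

/-- The function `H(X, Y, Z)`. -/
def evH (X Y Z : ∀ x : M, TangentSpace I x) (x : M) : ℝ := H.form x ![X x, Y x, Z x]

theorem smooth_evH (hX : SmoothSectionAt I E X x) (hY : SmoothSectionAt I E Y x)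
    (hZ : SmoothSectionAt I E Z x) : ContMDiffAt I 𝓘(ℝ, ℝ) ∞ (evH H X Y Z) x := by
  have := H.smooth ![X, Y, Z] x (by
    intro i
    fin_cases i
    · exact hX
    · exact hY
    · exact hZ)
  refine this.congr_of_eventuallyEq (Eventually.of_forall fun y => ?_)
  simp only [evH]
  congr 1
  ext i
  fin_cases i <;> rfl

theorem form_swap01 (x : M) (u v w : TangentSpace I x) :
    H.form x ![v, u, w] = - H.form x ![u, v, w] := by
  rw [← (H.form x).map_swap ![u, v, w] (i := 0) (j := 1) (by decide)]
  congr 1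
  ext i
  fin_cases i <;> rfl

theorem form_swap12 (x : M) (u v w : TangentSpace I x) :
    H.form x ![u, w, v] = - H.form x ![u, v, w] := by
  rw [← (H.form x).map_swap ![u, v, w] (i := 1) (j := 2) (by decide)]
  congr 1
  ext i
  fin_cases i <;> rfl

theorem form_rotate (x : M) (u v w : TangentSpace I x) :
    H.form x ![v, w, u] = H.form x ![u, v, w] := by
  rw [form_swap12, form_swap01, neg_neg]

theorem evH_swap01 : evH H Y X Z = fun y => - evH H X Y Z y := by
  ext y; exact form_swap01 H y _ _ _

theorem evH_swap12 : evH H X Z Y = fun y => - evH H X Y Z y := by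
  ext y; exact form_swap12 H y _ _ _

theorem evH_rotate : evH H Y Z X = evH H X Y Z := by
  ext y; exact form_rotate H y _ _ _

/-- `H` as a linear function of its first argument. -/
def formFirst (x : M) (v w : TangentSpace I x) : TangentSpace I x →ₗ[ℝ] ℝ where
  toFun u := H.form x ![u, v, w]
  map_add' u u' := (H.form x).map_vecCons_add ![v, w] u u'
  map_smul' c u := (H.form x).map_vecCons_smul ![v, w] c u

/-- `contract` is defined by `covOf` of a bare function; that function is linear because, by cyclic
symmetry, the last argument of `H` can be moved to the first place. -/
theorem contract_apply (x : M) (u v w : TangentSpace I x) :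
    contract H x u v w = H.form x ![u, v, w] := by
  have h : (fun w => H.form x ![u, v, w]) = formFirst H x u v := by
    ext w
    exact (form_rotate H x w u v).symm ▸ rfl
  rw [contract, h, covOf_apply]
  exact (form_rotate H x w u v).symm

end ThreeForms

/-! ### Lie brackets, Lie derivatives and exterior derivatives -/

section Lie

variable {X Y Z : ∀ x : M, TangentSpace I x} {f g : M → ℝ} {x : M}
  {ξ η ζ : ∀ x : M, Cotangent I x}

theorem bracket_smul_right (hf : MDifferentiableAt I 𝓘(ℝ, ℝ) f x) (hY : DiffSectionAt I E Y x) :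
    mlieBracket I X (fun y => f y • Y y) x = der X f x • Y x + f x • mlieBracket I X Y x := by
  have : CompleteSpace E := FiniteDimensional.complete ℝ E
  exact mlieBracket_smul_right hf hY

theorem bracket_smul_left (hf : MDifferentiableAt I 𝓘(ℝ, ℝ) f x) (hX : DiffSectionAt I E X x) :
    mlieBracket I (fun y => f y • X y) Y x = - der Y f x • X x + f x • mlieBracket I X Y x := by
  have : CompleteSpace E := FiniteDimensional.complete ℝ E
  exact mlieBracket_smul_left hf hX

theorem bracket_add_right (hY : DiffSectionAt I E Y x) (hZ : DiffSectionAt I E Z x) :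
    mlieBracket I X (fun y => Y y + Z y) x = mlieBracket I X Y x + mlieBracket I X Z x := by
  have : CompleteSpace E := FiniteDimensional.complete ℝ E
  exact mlieBracket_add_right hY hZ

theorem bracket_add_left (hX : DiffSectionAt I E X x) (hZ : DiffSectionAt I E Z x) :
    mlieBracket I (fun y => X y + Z y) Y x = mlieBracket I X Y x + mlieBracket I Z Y x := by
  have : CompleteSpace E := FiniteDimensional.complete ℝ E
  exact mlieBracket_add_left hX hZ

theorem bracket_jacobi (hX : SmoothSectionAt I E X x) (hY : SmoothSectionAt I E Y x)
    (hZ : SmoothSectionAt I E Z x) :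
    mlieBracket I X (mlieBracket I Y Z) x
      = mlieBracket I (mlieBracket I X Y) Z x + mlieBracket I Y (mlieBracket I X Z) x := by
  have : CompleteSpace E := FiniteDimensional.complete ℝ E
  have : IsManifold I (minSmoothness ℝ 3) M := by
    simpa using IsManifold.of_le (n := ∞) (m := 3) (I := I) (M := M) (ENat.LEInfty.out)
  have h2 : minSmoothness ℝ 2 ≤ ∞ := by simpa using ENat.LEInfty.out
  exact leibniz_identity_mlieBracket_apply (hX.of_le h2) (hY.of_le h2) (hZ.of_le h2)

theorem eventually_diff {F : Type*} [NormedAddCommGroup F] [NormedSpace ℝ F]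
    {V : M → Type*} [TopologicalSpace (TotalSpace F V)] [∀ x, TopologicalSpace (V x)]
    [∀ x, AddCommGroup (V x)] [∀ x, Module ℝ (V x)] [FiberBundle F V] [VectorBundle ℝ F V]
    [ContMDiffVectorBundle 1 F V I] {s : ∀ x, V x} (hs : SmoothSectionAt I F s x) :
    ∀ᶠ y in 𝓝 x, DiffSectionAt I F s y := by
  have h1 : ContMDiffAt I (I.prod 𝓘(ℝ, F)) 1 (fun y => TotalSpace.mk' F y (s y)) x :=
    ContMDiffAt.of_le hs (by simp)
  have := (contMDiffAt_iff_contMDiffAt_nhds (by simp)).1 h1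
  exact this.mono fun y hy => hy.mdifferentiableAt (by simp)

theorem eventually_mdiff (hf : ContMDiffAt I 𝓘(ℝ, ℝ) ∞ f x) :
    ∀ᶠ y in 𝓝 x, MDifferentiableAt I 𝓘(ℝ, ℝ) f y := by
  have := (contMDiffAt_iff_contMDiffAt_nhds (n := 1) (by simp)).1 (hf.of_le (by simp))
  exact this.mono fun y hy => hy.mdifferentiableAt (by simp)

theorem smul_smooth (hf : ContMDiffAt I 𝓘(ℝ, ℝ) ∞ f x) (hX : SmoothSectionAt I E X x) :
    SmoothSectionAt I E (fun y => f y • X y) x :=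
  ContMDiffAt.smul_section hf hX

/-- The Lie bracket acts on functions as the commutator of derivations. By the Leibniz rule, the
defect times a vector field `Z` is the difference of the two sides of the Jacobi identity for
`X`, `Y`, `f Z`, up to a multiple of the one for `X`, `Y`, `Z`. -/
theorem der_mlieBracket (hX : SmoothSectionAt I E X x) (hY : SmoothSectionAt I E Y x)
    (hf : ContMDiffAt I 𝓘(ℝ, ℝ) ∞ f x) :
    der (mlieBracket I X Y) f x = der X (der Y f) x - der Y (der X f) x := by
  have hU := (trivializationAt E (TangentSpace I) x).open_baseSet
  have hx := FiberBundle.mem_baseSet_trivializationAt' (F := E) (E := TangentSpace I) x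
  -- a tangent space of dimension zero has no nonzero vector to test with
  rcases subsingleton_or_nontrivial E with hE | hE
  · have h0 (X : ∀ x : M, TangentSpace I x) (f : M → ℝ) (y : M) : der X f y = 0 := by
      have : X y = 0 := Subsingleton.elim (α := E) _ _
      simp [der, this]
    simp [h0]
  have a : Fin (Module.finrank ℝ E) := ⟨0, Module.finrank_pos⟩
  set Z := chartFrame (I := I) x a
  have hZ : SmoothSectionAt I E Z x := smooth_frame (isLocalFrameOn_chartFrame x) hU hx a
  have hZ0 : Z x ≠ 0 := ((isLocalFrameOn_chartFrame x).linearIndependent hx).ne_zero a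
  have step {X Y : ∀ x : M, TangentSpace I x} (hX : SmoothSectionAt I E X x)
      (hY : SmoothSectionAt I E Y x) :
      mlieBracket I X (mlieBracket I Y (fun y => f y • Z y)) x
        = der X (der Y f) x • Z x + der Y f x • mlieBracket I X Z x
          + der X f x • mlieBracket I Y Z x + f x • mlieBracket I X (mlieBracket I Y Z) x := by
    have h1 : mlieBracket I Y (fun y => f y • Z y)
        =ᶠ[𝓝 x] fun y => der Y f y • Z y + f y • mlieBracket I Y Z y := by
      filter_upwards [eventually_mdiff hf, eventually_diff hZ] with y h1 h2
      exact bracket_smul_right h1 h2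
    rw [(EventuallyEq.refl _ X).mlieBracket_vectorField_eq h1,
      bracket_add_right (smul_smooth (smooth_der hY hf) hZ).diff
        (smul_smooth hf (smooth_mlieBracket hY hZ)).diff,
      bracket_smul_right ((smooth_der hY hf).mdifferentiableAt (by simp)) hZ.diff,
      bracket_smul_right (hf.mdifferentiableAt (by simp)) (smooth_mlieBracket hY hZ).diff]
    abel
  have hJ := bracket_jacobi hX hY (smul_smooth hf hZ)
  rw [step hX hY, step hY hX, bracket_smul_right (hf.mdifferentiableAt (by simp)) hZ.diff,
    bracket_jacobi hX hY hZ] at hJ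
  have : (der (mlieBracket I X Y) f x - (der X (der Y f) x - der Y (der X f) x)) • Z x = 0 := by
    simp only [sub_smul, smul_add] at hJ ⊢
    rw [← sub_eq_zero] at hJ
    rw [← neg_eq_zero, ← hJ]
    abel
  rcases smul_eq_zero.1 this with h | h
  · linarith
  · exact absurd h hZ0

end Lie

section Tensorial

variable {X Y Z : ∀ x : M, TangentSpace I x} {x : M} {ξ η : ∀ x : M, Cotangent I x}

/-- A differential operator that is tensorial does not depend on the extension of a vector to a
field, so the covector it defines through `FiberBundle.extend` computes it on every field. -/
theorem covOf_extend {Φ : (∀ x : M, TangentSpace I x) → ℝ} (hΦ : TensorialAt I E Φ x)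
    (hZ : DiffSectionAt I E Z x) :
    covOf (fun v : TangentSpace I x => Φ (FiberBundle.extend E v)) (Z x) = Φ Z := by
  rw [← hΦ.mkHom_apply hZ]
  exact covOf_apply (hΦ.mkHom Φ x).toLinearMap (Z x)

/-- The counterpart of `covOf_extend` for operators on covector fields. -/
theorem vecOf_extend {Φ : (∀ x : M, Cotangent I x) → ℝ} (hΦ : TensorialAt I (E →L[ℝ] ℝ) Φ x)
    (hξ : DiffSectionAt I (E →L[ℝ] ℝ) ξ x) :
    ξ x (vecOf (fun v : Cotangent I x => Φ (FiberBundle.extend (E →L[ℝ] ℝ) v))) = Φ ξ := by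
  rw [← hΦ.mkHom_apply hξ]
  exact apply_vecOf (hΦ.mkHom Φ x).toLinearMap (ξ x)

/-- `L_X η`. -/
def lieCov (X : ∀ x : M, TangentSpace I x) (η : ∀ x : M, Cotangent I x) (x : M) : Cotangent I x :=
  covOf (lieDual E (mlieBracket I) (idAnchor I) X (fun y v => η y v) x)

/-- `ι_Y dξ`. -/
def intD (Y : ∀ x : M, TangentSpace I x) (ξ : ∀ x : M, Cotangent I x) (x : M) : Cotangent I x :=
  covOf (intDiffOne E (mlieBracket I) (idAnchor I) (fun y v => ξ y v) Y x)

/-- `dξ(Y, Z)`. -/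
def extD (ξ : ∀ x : M, Cotangent I x) (x : M) (Y Z : ∀ x : M, TangentSpace I x) : ℝ :=
  der Y (ev ξ Z) x - der Z (ev ξ Y) x - ξ x (mlieBracket I Y Z x)

theorem extD_swap : extD ξ x Z Y = - extD ξ x Y Z := by
  simp only [extD]
  rw [mlieBracket_swap_apply]
  simp; ring

theorem tensorial_extD (hξ : DiffSectionAt I (E →L[ℝ] ℝ) ξ x) :
    TensorialAt I E (extD ξ x Y) x where
  smul {f Z} hf hZ := by
    have h1 : ev ξ (f • Z) = fun y => f y * ev ξ Z y := by ext y; simp [ev]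
    have h2 : der (f • Z) (ev ξ Y) x = f x * der Z (ev ξ Y) x := by simp [der]
    have h3 : mlieBracket I Y (f • Z) x = _ := bracket_smul_right hf hZ
    rw [extD, h1, h2, h3, der_mul hf (mdiff_ev hξ hZ)]
    simp [extD, ev]; ring
  add {Z Z'} hZ hZ' := by
    have h1 : ev ξ (Z + Z') = fun y => ev ξ Z y + ev ξ Z' y := by ext y; simp [ev]
    have h2 : der (Z + Z') (ev ξ Y) x = der Z (ev ξ Y) x + der Z' (ev ξ Y) x := by simp [der]
    have h3 : mlieBracket I Y (Z + Z') x = _ := bracket_add_right hZ hZ'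
    rw [extD, h1, h2, h3, der_add (mdiff_ev hξ hZ) (mdiff_ev hξ hZ')]
    simp [extD]; ring

theorem intD_apply (hξ : DiffSectionAt I (E →L[ℝ] ℝ) ξ x)
    (hZ : DiffSectionAt I E Z x) : intD Y ξ x (Z x) = extD ξ x Y Z :=
  covOf_extend (tensorial_extD hξ) hZ

theorem tensorial_der (f : M → ℝ) (x : M) :
    TensorialAt I E (fun Z : ∀ x : M, TangentSpace I x => der Z f x) x where
  smul _ _ := by simp [der]
  add _ _ := by simp [der]

theorem tensorial_add {Φ Ψ : (∀ x : M, TangentSpace I x) → ℝ} (hΦ : TensorialAt I E Φ x)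
    (hΨ : TensorialAt I E Ψ x) : TensorialAt I E (fun Z => Φ Z + Ψ Z) x where
  smul hf hZ := by rw [hΦ.smul hf hZ, hΨ.smul hf hZ, smul_add]
  add hZ hZ' := by rw [hΦ.add hZ hZ', hΨ.add hZ hZ']; ring

theorem lieCov_apply (hη : DiffSectionAt I (E →L[ℝ] ℝ) η x) (hZ : DiffSectionAt I E Z x) :
    lieCov X η x (Z x) = der X (ev η Z) x - η x (mlieBracket I X Z x) := by
  have h := covOf_extend
    (tensorial_add (tensorial_extD (Y := X) hη) (tensorial_der (ev η X) x)) hZ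
  have h2 : lieCov X η x = covOf (fun v : TangentSpace I x => extD η x X (FiberBundle.extend E v)
      + der (FiberBundle.extend E v) (ev η X) x) := by
    unfold lieCov
    congr 1
    ext v
    simp only [lieDual, der, FiberBundle.extend_apply_self]
    rfl
  rw [h2, h, extD]
  ring

theorem vector_ext {u v : TangentSpace I x} (h : ∀ η : Cotangent I x, η u = η v) : u = v := by
  rw [← sum_cobasis_smul_basis x u, ← sum_cobasis_smul_basis x v]
  simp only [h]

theorem covector_ext {θ θ' : Cotangent I x}
    (h : ∀ Z : ∀ x : M, TangentSpace I x, DiffSectionAt I E Z x → θ (Z x) = θ' (Z x)) :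
    θ = θ' := by
  ext v
  simpa using h (FiberBundle.extend E v) (FiberBundle.mdifferentiableAt_extend ..)

theorem dH_apply (f : M → ℝ) (x : M) (v : TangentSpace I x) : dH f x v = mvfderiv I f x v :=
  covOf_apply (mvfderiv I f x).toLinearMap v

/-- The sign comes from `η(β♯ξ) = β(ξ, η)`: `η(d_β f) = df(β♯η) = - η(β♯df)`. -/
theorem dβ_eq (β : Bivector I M) (f : M → ℝ) (x : M) : dβ β f x = - sharp β x (dH f x) := by
  refine vector_ext fun η => ?_
  have : η (dβ β f x) = mvfderiv I f x (sharp β x η) :=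
    apply_vecOf ((mvfderiv I f x).toLinearMap ∘ₗ sharp β x) η
  rw [this, map_neg, ← apply_sharp_swap, show dH f x = mvfderiv I f x from
    ContinuousLinearMap.ext (dH_apply f x)]

end Tensorial

/-! ### The twisted brackets in terms of Lie derivatives -/

section TwistedBrackets

variable {X Y Z : ∀ x : M, TangentSpace I x} {x : M} {ξ η : ∀ x : M, Cotangent I x}
  {f g : M → ℝ} (β : Bivector I M) (H : ThreeForm I M)

theorem ev_def (ξ : ∀ x : M, Cotangent I x) (X : ∀ x : M, TangentSpace I x) :
    ev ξ X = fun y => ξ y (X y) := rfl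

theorem dH_add (hf : MDifferentiableAt I 𝓘(ℝ, ℝ) f x) (hg : MDifferentiableAt I 𝓘(ℝ, ℝ) g x) :
    dH (I := I) (fun y => f y + g y) x = dH f x + dH g x := by
  ext v; simp [dH_apply, mvfderiv_fun_add hf hg]

theorem dH_neg : dH (I := I) (fun y => - f y) x = - dH f x := by
  ext v; simp [dH_apply, mvfderiv_fun_neg]

theorem dH_sub (hf : MDifferentiableAt I 𝓘(ℝ, ℝ) f x) (hg : MDifferentiableAt I 𝓘(ℝ, ℝ) g x) :
    dH (I := I) (fun y => f y - g y) x = dH f x - dH g x := by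
  ext v; simp [dH_apply, mvfderiv_fun_sub hf hg]

theorem contract_add_left (x : M) (u u' v : TangentSpace I x) :
    contract H x (u + u') v = contract H x u v + contract H x u' v := by
  ext w
  simp only [contract_apply, _root_.add_apply]
  exact (H.form x).map_vecCons_add ![v, w] u u'

theorem contract_swap (x : M) (u v : TangentSpace I x) :
    contract H x v u = - contract H x u v := by
  ext w
  simp only [contract_apply, _root_.neg_apply]
  exact form_swap01 H x u v w

theorem contract_add_right (x : M) (u v v' : TangentSpace I x) :
    contract H x u (v + v') = contract H x u v + contract H x u v' := by
  rw [contract_swap, contract_add_left, contract_swap H x v, contract_swap H x v']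
  abel

/-- `L_Y ξ = ι_Y dξ + d(ξ(Y))`. -/
theorem lieCov_eq (hξ : DiffSectionAt I (E →L[ℝ] ℝ) ξ x) :
    lieCov Y ξ x = intD Y ξ x + dH (ev ξ Y) x := by
  refine covector_ext fun Z hZ => ?_
  rw [_root_.add_apply, lieCov_apply hξ hZ, intD_apply hξ hZ, dH_apply, extD]
  simp only [der]
  ring

theorem lieCov_add_left (hη : DiffSectionAt I (E →L[ℝ] ℝ) η x) (hX : DiffSectionAt I E X x)
    (hY : DiffSectionAt I E Y x) :
    lieCov (fun y => X y + Y y) η x = lieCov X η x + lieCov Y η x := by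
  refine covector_ext fun Z hZ => ?_
  rw [_root_.add_apply, lieCov_apply hη hZ, lieCov_apply hη hZ, lieCov_apply hη hZ,
    bracket_add_left hX hY]
  simp [der]
  ring

theorem tensorial_linear {F : Type*} [NormedAddCommGroup F] [NormedSpace ℝ F]
    {V : M → Type*} [TopologicalSpace (TotalSpace F V)] [∀ x, TopologicalSpace (V x)]
    [∀ x, AddCommGroup (V x)] [∀ x, Module ℝ (V x)] [FiberBundle F V]
    (L : V x →ₗ[ℝ] ℝ) : TensorialAt I F (fun s : ∀ x, V x => L (s x)) x where
  smul _ _ := by simp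
  add _ _ := by simp

/-- `[ι_X, d^H]₊ ξ = L_X ξ + ι_{β♯ξ} ι_X H`. -/
theorem lieH_eq (hξ : DiffSectionAt I (E →L[ℝ] ℝ) ξ x) :
    lieH β H X ξ x = lieCov X ξ x + contract H x (X x) (sharpF β ξ x) := by
  refine covector_ext fun Z hZ => ?_
  have h := covOf_extend (tensorial_add (tensorial_add (tensorial_extD (Y := X) hξ)
    (tensorial_linear (contract H x (X x) (sharpF β ξ x)).toLinearMap))
    (tensorial_der (ev ξ X) x)) hZ
  have h2 : lieH β H X ξ x = covOf (fun v : TangentSpace I x =>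
      extD ξ x X (FiberBundle.extend E v)
      + contract H x (X x) (sharpF β ξ x) (FiberBundle.extend E v x)
      + der (FiberBundle.extend E v) (ev ξ X) x) := by
    unfold lieH
    congr 1
    ext v
    simp only [lieDual, der, FiberBundle.extend_apply_self, intDiffOne, diffOne, twistedLie,
      map_sub, extD]
    rw [apply_sharp_swap β x _ (ξ x), contract_apply, contract_apply, form_swap12 H x (X x)]
    simp only [idAnchor, LinearMap.id_apply, sharpF, diffZero, ev_def]
    ring
  rw [h2, _root_.add_apply]
  refine h.trans ?_
  rw [lieCov_apply hξ hZ, extD]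
  simp
  ring

theorem koszul_eq : koszul β ξ η x = lieCov (sharpF β ξ) η x - intD (sharpF β η) ξ x := rfl

theorem twistedKoszul_apply (hξ : DiffSectionAt I (E →L[ℝ] ℝ) ξ x)
    (hη : DiffSectionAt I (E →L[ℝ] ℝ) η x) (hZ : DiffSectionAt I E Z x) :
    twistedKoszul β H ξ η x (Z x) = der (sharpF β ξ) (ev η Z) x
      - η x (mlieBracket I (sharpF β ξ) Z x) - extD ξ x (sharpF β η) Z
      + contract H x (sharpF β ξ x) (sharpF β η x) (Z x) := by
  rw [twistedKoszul, koszul_eq, _root_.add_apply, _root_.sub_apply, lieCov_apply hη hZ,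
    intD_apply hξ hZ]
  rfl

/-- `[ι_ξ, d_β^H]₊ X = [β♯ξ, X] + β♯(ι_X dξ + ι_{β♯ξ} ι_X H)`. -/
theorem lieβ_eq (hξ : DiffSectionAt I (E →L[ℝ] ℝ) ξ x) (hX : DiffSectionAt I E X x) :
    lieβ β H ξ X x = mlieBracket I (sharpF β ξ) X x
      + sharp β x (intD X ξ x + contract H x (X x) (sharpF β ξ x)) := by
  -- `Φ` is tensorial because on differentiable sections it agrees with the linear form `L`
  let Φ (η : ∀ x : M, Cotangent I x) : ℝ :=
    diffOne (twistedKoszul β H) (sharp β) (fun y η => η (X y)) ξ η x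
      + der (sharpF β η) (ev ξ X) x
  let L : Cotangent I x →ₗ[ℝ] ℝ :=
    { toFun := fun ζ => ζ (mlieBracket I (sharpF β ξ) X x
        + sharp β x (intD X ξ x + contract H x (X x) (sharpF β ξ x)))
      map_add' := fun _ _ => rfl
      map_smul' := fun _ _ => rfl }
  have hΦ {η : ∀ x : M, Cotangent I x} (hη : DiffSectionAt I (E →L[ℝ] ℝ) η x) :
      Φ η = L (η x) := by
    simp only [Φ, diffOne, L, LinearMap.coe_mk, AddHom.coe_mk, map_add]
    rw [twistedKoszul_apply β H hξ hη hX, apply_sharp_swap β x _ (η x),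
      apply_sharp_swap β x _ (η x), extD_swap]
    have := intD_apply (Y := X) hξ (diff_sharpF β hη)
    rw [show sharp β x (η x) = sharpF β η x from rfl, this, contract_apply, contract_apply,
      form_rotate H x (X x)]
    simp only [der, ev_def, sharpF]
    ring
  have hT : TensorialAt I (E →L[ℝ] ℝ) Φ x :=
    { smul := fun {f η} hf hη => by
        rw [hΦ hη, hΦ (η := f • η) (MDifferentiableAt.smul_section hf hη)]
        exact (tensorial_linear L).smul hf hη
      add := fun {η η'} hη hη' => by
        rw [hΦ hη, hΦ hη', hΦ (η := η + η') (mdifferentiableAt_add_section hη hη')]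
        exact (tensorial_linear L).add hη hη' }
  have h2 : lieβ β H ξ X x
      = vecOf (fun ζ : Cotangent I x => Φ (FiberBundle.extend (E →L[ℝ] ℝ) ζ)) := by
    unfold lieβ
    congr 1
    ext ζ
    simp only [lieDual, Φ, der, diffZero, sharpF, FiberBundle.extend_apply_self]
    rfl
  refine vector_ext fun ζ => ?_
  have hζ : DiffSectionAt I (E →L[ℝ] ℝ) (FiberBundle.extend (E →L[ℝ] ℝ) ζ) x :=
    FiberBundle.mdifferentiableAt_extend ..
  have h3 := vecOf_extend hT hζ
  rw [← h2, hΦ hζ] at h3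
  simpa [L] using h3

end TwistedBrackets

/-! ### Components in a local frame -/

section FrameComponents

variable {U : Set M} {e : Fin (Module.finrank ℝ E) → ∀ x : M, TangentSpace I x}
  (he : IsLocalFrameOn I E ∞ e U) (hU : IsOpen U) {x : M} (hx : x ∈ U)
  (β : Bivector I M) (H : ThreeForm I M) {X Y Z : ∀ x : M, TangentSpace I x}
  {ξ η ζ : ∀ x : M, Cotangent I x} {f g : M → ℝ}

include hU hx

theorem tensorial_frame_sum {Φ : (∀ x : M, TangentSpace I x) → ℝ} (hΦ : TensorialAt I E Φ x)
    (hX : DiffSectionAt I E X x) : Φ X = ∑ a, coframe he a x (X x) * Φ (e a) := by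
  rw [← hΦ.mkHom_apply hX, ← sum_coframe_smul he hx (X x), map_sum]
  refine Finset.sum_congr rfl fun a _ => ?_
  rw [map_smul, hΦ.mkHom_apply (smooth_frame he hU hx a).diff, smul_eq_mul,
    sum_coframe_smul he hx (X x)]

omit hU in
theorem covector_eq_sum (θ : Cotangent I x) : θ = ∑ a, θ (e a x) • coframe he a x := by
  ext v
  conv_lhs => rw [← sum_coframe_smul he hx v]
  simp [mul_comm]

theorem tensorial_coframe_sum {Φ : (∀ x : M, Cotangent I x) → ℝ}
    (hΦ : TensorialAt I (E →L[ℝ] ℝ) Φ x) (hξ : DiffSectionAt I (E →L[ℝ] ℝ) ξ x) :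
    Φ ξ = ∑ a, ξ x (e a x) * Φ (coframe he a) := by
  have h : ξ x = _ := covector_eq_sum he hx (ξ x)
  rw [← hΦ.mkHom_apply hξ, h, map_sum]
  refine Finset.sum_congr rfl fun a _ => ?_
  rw [map_smul, hΦ.mkHom_apply (smooth_coframe he hU hx a).diff, smul_eq_mul, ← h]

omit hU in
theorem der_frame_sum (X : ∀ x : M, TangentSpace I x) (f : M → ℝ) :
    der X f x = ∑ a, coframe he a x (X x) * frameDeriv e a f x := by
  unfold der frameDeriv
  conv_lhs => rw [← sum_coframe_smul he hx (X x)]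
  simp

omit hU in
theorem form_frame_sum (u v w : TangentSpace I x) :
    H.form x ![u, v, w] = ∑ m, coframe he m x u * H.form x ![e m x, v, w] := by
  have (u : TangentSpace I x) : H.form x ![u, v, w] = formFirst H x v w u := rfl
  simp only [this]
  conv_lhs => rw [← sum_coframe_smul he hx u]
  simp

theorem der_ev_coframe_frame (X : ∀ x : M, TangentSpace I x) (c k : Fin (Module.finrank ℝ E)) :
    der X (ev (coframe he c) (e k)) x = 0 := by
  rw [der_congr (g := fun _ => if c = k then 1 else 0), der_const]
  filter_upwards [hU.mem_nhds hx] with y hy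
  exact coframe_frame he hy c k

theorem extD_frame (c m n : Fin (Module.finrank ℝ E)) :
    extD (coframe he c) x (e m) (e n) = - geomF he m n c x := by
  rw [extD, der_ev_coframe_frame he hU hx, der_ev_coframe_frame he hU hx, geomF]
  ring

theorem extD_coframe (c : Fin (Module.finrank ℝ E)) (hX : DiffSectionAt I E X x)
    (hY : DiffSectionAt I E Y x) :
    extD (coframe he c) x X Y
      = - ∑ m, ∑ n, geomF he m n c x * coframe he m x (X x) * coframe he n x (Y x) := by
  have hc := (smooth_coframe he hU hx c).diff
  rw [extD_swap, tensorial_frame_sum he hU hx (tensorial_extD hc) hX, neg_inj]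
  refine Finset.sum_congr rfl fun m _ => ?_
  rw [extD_swap, tensorial_frame_sum he hU hx (tensorial_extD hc) hY, mul_neg,
    Finset.mul_sum, ← Finset.sum_neg_distrib]
  refine Finset.sum_congr rfl fun n _ => ?_
  rw [extD_frame he hU hx]
  ring

/-- The components of the Lie bracket in a frame. -/
theorem coframe_mlieBracket (c : Fin (Module.finrank ℝ E)) (hX : DiffSectionAt I E X x)
    (hY : DiffSectionAt I E Y x) :
    coframe he c x (mlieBracket I X Y x)
      = der X (ev (coframe he c) Y) x - der Y (ev (coframe he c) X) x
        + ∑ m, ∑ n, geomF he m n c x * coframe he m x (X x) * coframe he n x (Y x) := by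
  have := extD_coframe he hU hx c hX hY
  rw [extD] at this
  linarith

omit hU hx in
theorem ev_coframe_sharpF (a b : Fin (Module.finrank ℝ E)) :
    ev (coframe he b) (sharpF β (coframe he a)) = betaComp he β a b := by
  ext y
  exact apply_sharp β y _ _

omit hU hx in
theorem coframe_sharpF (a b : Fin (Module.finrank ℝ E)) :
    coframe he b x (sharpF β (coframe he a) x) = betaComp he β a b x :=
  apply_sharp β x _ _

omit hU hx in
theorem betaComp_swap (a b : Fin (Module.finrank ℝ E)) (x : M) :
    betaComp he β a b x = - betaComp he β b a x := by
  rw [betaComp, betaComp, ← apply_sharp, ← apply_sharp, apply_sharp_swap]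

omit hU hx in
theorem geomF_swap (a b c : Fin (Module.finrank ℝ E)) (x : M) :
    geomF he a b c x = - geomF he b a c x := by
  rw [geomF, geomF, mlieBracket_swap_apply, map_neg]

omit hU hx in
theorem betaComp_swap_fun (a b : Fin (Module.finrank ℝ E)) :
    betaComp he β a b = fun y => - betaComp he β b a y := by
  ext y; exact betaComp_swap he β a b y

/-- The difference `[β♯ξ, β♯η] - β♯[ξ, η]^H_KS`, which turns out to be `ι_η ι_ξ 𝓡`. -/
def anchorDefect (ξ η : ∀ x : M, Cotangent I x) (x : M) : TangentSpace I x :=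
  mlieBracket I (sharpF β ξ) (sharpF β η) x - sharp β x (twistedKoszul β H ξ η x)

omit hU hx in
/-- Paired with a third one-form the defect becomes invariant under cyclic permutations, which
makes its antisymmetry and tensoriality visible. -/
theorem apply_anchorDefect (hξ : DiffSectionAt I (E →L[ℝ] ℝ) ξ x)
    (hη : DiffSectionAt I (E →L[ℝ] ℝ) η x) (hζ : DiffSectionAt I (E →L[ℝ] ℝ) ζ x) :
    ζ x (anchorDefect β H ξ η x)
      = ζ x (mlieBracket I (sharpF β ξ) (sharpF β η) x)
        + ξ x (mlieBracket I (sharpF β η) (sharpF β ζ) x)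
        + η x (mlieBracket I (sharpF β ζ) (sharpF β ξ) x)
        + der (sharpF β ξ) (ev η (sharpF β ζ)) x + der (sharpF β η) (ev ζ (sharpF β ξ)) x
        + der (sharpF β ζ) (ev ξ (sharpF β η)) x
        + H.form x ![sharpF β ξ x, sharpF β η x, sharpF β ζ x] := by
  rw [anchorDefect, map_sub, apply_sharp_swap, show sharp β x (ζ x) = sharpF β ζ x from rfl,
    twistedKoszul_apply β H hξ hη (diff_sharpF β hζ), contract_apply, extD,
    ev_sharpF_swap β ξ ζ, der_neg, mlieBracket_swap_apply (V := sharpF β ζ), map_neg]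
  ring

omit hU hx in
theorem anchorDefect_swap (hξ : DiffSectionAt I (E →L[ℝ] ℝ) ξ x)
    (hη : DiffSectionAt I (E →L[ℝ] ℝ) η x) :
    anchorDefect β H η ξ x = - anchorDefect β H ξ η x := by
  refine vector_ext fun ζ => ?_
  have hζ : DiffSectionAt I (E →L[ℝ] ℝ) (FiberBundle.extend (E →L[ℝ] ℝ) ζ) x :=
    FiberBundle.mdifferentiableAt_extend ..
  have h1 := apply_anchorDefect β H hξ hη hζ
  have h2 := apply_anchorDefect β H hη hξ hζ
  simp only [FiberBundle.extend_apply_self] at h1 h2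
  rw [map_neg, h1, h2]
  set ζ' : ∀ x : M, Cotangent I x := FiberBundle.extend (E →L[ℝ] ℝ) ζ
  rw [ev_sharpF_swap β ξ ζ', ev_sharpF_swap β ξ η, ev_sharpF_swap β ζ' η, form_swap01,
    mlieBracket_swap_apply (V := sharpF β η) (W := sharpF β ξ),
    mlieBracket_swap_apply (V := sharpF β η) (W := sharpF β ζ'),
    mlieBracket_swap_apply (V := sharpF β ξ) (W := sharpF β ζ')]
  simp only [der_neg, map_neg]
  ring

omit hU hx in
/-- The defect is `C^∞(M)`-linear in `ξ`: in `apply_anchorDefect` with `fξ` for `ξ`, the derivatives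
of `f` that come from the two Lie brackets with `β♯fξ` cancel those that come from differentiating
`ζ(β♯fξ)` and `fξ(β♯η)`, because `β♯` is skew. -/
theorem tensorial_anchorDefect (hη : DiffSectionAt I (E →L[ℝ] ℝ) η x) (θ : Cotangent I x) :
    TensorialAt I (E →L[ℝ] ℝ)
      (fun ξ : ∀ x : M, Cotangent I x => θ (anchorDefect β H ξ η x)) x := by
  have hζ : DiffSectionAt I (E →L[ℝ] ℝ) (FiberBundle.extend (E →L[ℝ] ℝ) θ) x :=
    FiberBundle.mdifferentiableAt_extend ..
  have hθ : θ = FiberBundle.extend (E →L[ℝ] ℝ) θ x := by simp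
  set ζ : ∀ x : M, Cotangent I x := FiberBundle.extend (E →L[ℝ] ℝ) θ
  rw [hθ]
  constructor
  · intro f ξ hf hξ
    have hs : sharpF β (f • ξ) = fun y => f y • sharpF β ξ y := by ext y; simp [sharpF]
    have he1 (X : ∀ x : M, TangentSpace I x) : ev (f • ξ) X = fun y => f y * ev ξ X y := rfl
    have he2 (ζ : ∀ x : M, Cotangent I x) :
        ev ζ (fun y => f y • sharpF β ξ y) = fun y => f y * ev ζ (sharpF β ξ) y := by
      ext y; simp [ev]
    have hd (g : M → ℝ) : der (fun y => f y • sharpF β ξ y) g x = f x * der (sharpF β ξ) g x := by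
      simp [der]
    rw [apply_anchorDefect β H (MDifferentiableAt.smul_section hf hξ) hη hζ,
      apply_anchorDefect β H hξ hη hζ, hs, he1, he2, hd,
      bracket_smul_left hf (diff_sharpF β hξ), bracket_smul_right hf (diff_sharpF β hξ),
      der_mul hf (mdiff_ev hζ (diff_sharpF β hξ)), der_mul hf (mdiff_ev hξ (diff_sharpF β hη))]
    have h1 : ζ x (sharpF β ξ x) = - ξ x (sharpF β ζ x) := apply_sharp_swap ..
    have h2 : η x (sharpF β ξ x) = - ξ x (sharpF β η x) := apply_sharp_swap ..
    have h3 : H.form x ![f x • sharpF β ξ x, sharpF β η x, sharpF β ζ x]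
      = f x * H.form x ![sharpF β ξ x, sharpF β η x, sharpF β ζ x] :=
      (H.form x).map_vecCons_smul ![sharpF β η x, sharpF β ζ x] _ _
    simp only [map_add, map_smul, smul_eq_mul, h1, h2, h3, ev, Pi.smul_apply', _root_.smul_apply]
    ring
  · intro ξ ξ' hξ hξ'
    have hs : sharpF β (ξ + ξ') = fun y => sharpF β ξ y + sharpF β ξ' y := by
      ext y; simp [sharpF]
    have he1 (X : ∀ x : M, TangentSpace I x) :
        ev (ξ + ξ') X = fun y => ev ξ X y + ev ξ' X y := rfl
    have he2 (ζ : ∀ x : M, Cotangent I x) : ev ζ (fun y => sharpF β ξ y + sharpF β ξ' y)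
        = fun y => ev ζ (sharpF β ξ) y + ev ζ (sharpF β ξ') y := by
      ext y; simp [ev]
    have hd (g : M → ℝ) : der (fun y => sharpF β ξ y + sharpF β ξ' y) g x
        = der (sharpF β ξ) g x + der (sharpF β ξ') g x := by
      simp [der]
    have h3 : H.form x ![sharpF β ξ x + sharpF β ξ' x, sharpF β η x, sharpF β ζ x]
      = H.form x ![sharpF β ξ x, sharpF β η x, sharpF β ζ x]
        + H.form x ![sharpF β ξ' x, sharpF β η x, sharpF β ζ x] :=
      (H.form x).map_vecCons_add ![sharpF β η x, sharpF β ζ x] _ _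
    rw [apply_anchorDefect β H (mdifferentiableAt_add_section hξ hξ') hη hζ,
      apply_anchorDefect β H hξ hη hζ, apply_anchorDefect β H hξ' hη hζ, hs, he1, he2, hd, h3,
      bracket_add_left (diff_sharpF β hξ) (diff_sharpF β hξ'),
      bracket_add_right (diff_sharpF β hξ) (diff_sharpF β hξ'),
      der_add (mdiff_ev hζ (diff_sharpF β hξ)) (mdiff_ev hζ (diff_sharpF β hξ')),
      der_add (mdiff_ev hξ (diff_sharpF β hη)) (mdiff_ev hξ' (diff_sharpF β hη))]
    simp only [map_add, Pi.add_apply, _root_.add_apply]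
    ring

end FrameComponents

/-! ### Antisymmetrization and the components of the trivector -/

section Antisymmetrization

variable {ι : Type*}

/-- An alternating sum over permutations, expanded along the entry that is moved to the first
place. -/
theorem sum_perm_succ {n : ℕ} (T : (Fin (n + 1) → ι) → ℝ) (v : Fin (n + 1) → ι) :
    ∑ σ : Equiv.Perm (Fin (n + 1)), ((Equiv.Perm.sign σ : ℤ) : ℝ) * T (v ∘ σ)
      = ∑ p : Fin (n + 1), (if p = 0 then 1 else -1) * ∑ σ : Equiv.Perm (Fin n),
          ((Equiv.Perm.sign σ : ℤ) : ℝ)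
            * T (Matrix.vecCons (v p) ((fun i : Fin n => v (Equiv.swap 0 p i.succ)) ∘ σ)) := by
  rw [← Equiv.sum_comp Equiv.Perm.decomposeFin.symm, Fintype.sum_prod_type]
  refine Finset.sum_congr rfl fun p _ => ?_
  rw [Finset.mul_sum]
  refine Finset.sum_congr rfl fun σ _ => ?_
  rw [← mul_assoc, Equiv.Perm.decomposeFin.symm_sign]
  congr 1
  · split_ifs <;> simp
  · congr 1
    ext i
    refine Fin.cases ?_ (fun j => ?_) i
    · simp
    · simp

theorem asym_three (T : (Fin 3 → ι) → ℝ) (a b c : ι) :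
    asym T ![a, b, c] = 1 / 6 * (T ![a, b, c] + T ![b, c, a] + T ![c, a, b]
      - T ![b, a, c] - T ![a, c, b] - T ![c, b, a]) := by
  have h : (Finset.univ : Finset (Equiv.Perm (Fin 3))) = {1, finRotate 3, (finRotate 3)⁻¹,
    Equiv.swap 0 1, Equiv.swap 1 2, Equiv.swap 0 2} := by decide
  rw [asym, h]
  rw [Finset.sum_insert (by decide), Finset.sum_insert (by decide), Finset.sum_insert (by decide),
    Finset.sum_insert (by decide), Finset.sum_insert (by decide), Finset.sum_singleton]
  have h1 : ![a, b, c] ∘ finRotate 3 = ![b, c, a] := by ext i; fin_cases i <;> rfl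
  have h2 : ![a, b, c] ∘ ⇑(finRotate 3)⁻¹ = ![c, a, b] := by ext i; fin_cases i <;> rfl
  have h3 : ![a, b, c] ∘ Equiv.swap (0 : Fin 3) 1 = ![b, a, c] := by ext i; fin_cases i <;> rfl
  have h4 : ![a, b, c] ∘ Equiv.swap (1 : Fin 3) 2 = ![a, c, b] := by ext i; fin_cases i <;> rfl
  have h5 : ![a, b, c] ∘ Equiv.swap (0 : Fin 3) 2 = ![c, b, a] := by ext i; fin_cases i <;> rfl
  have s1 : Equiv.Perm.sign (finRotate 3) = 1 := by decide
  have s2 : Equiv.Perm.sign (finRotate 3)⁻¹ = 1 := by decide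
  have s3 : Equiv.Perm.sign (Equiv.swap (0 : Fin 3) 1) = -1 := by decide
  have s4 : Equiv.Perm.sign (Equiv.swap (1 : Fin 3) 2) = -1 := by decide
  have s5 : Equiv.Perm.sign (Equiv.swap (0 : Fin 3) 2) = -1 := by decide
  rw [h1, h2, h3, h4, h5, s1, s2, s3, s4, s5]
  simp [Nat.factorial]
  ring

/-- Expansion of an antisymmetrization over four indices along its first slot. The sign of each
term is that of the transposition bringing the index to the front, and the remaining indices are
listed as this transposition leaves them. -/
theorem asym_four (T : (Fin 4 → ι) → ℝ) (a b c d : ι) :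
    asym T ![a, b, c, d] = 1 / 4 * (asym (fun w => T (Matrix.vecCons a w)) ![b, c, d]
      - asym (fun w => T (Matrix.vecCons b w)) ![a, c, d]
      - asym (fun w => T (Matrix.vecCons c w)) ![b, a, d]
      - asym (fun w => T (Matrix.vecCons d w)) ![b, c, a]) := by
  have h0 : (fun i : Fin 3 => (![a, b, c, d] : Fin 4 → ι) (Equiv.swap 0 0 i.succ))
      = ![b, c, d] := by
    ext i; fin_cases i <;> rfl
  have h1 : (fun i : Fin 3 => (![a, b, c, d] : Fin 4 → ι) (Equiv.swap 0 1 i.succ))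
      = ![a, c, d] := by
    ext i; fin_cases i <;> rfl
  have h2 : (fun i : Fin 3 => (![a, b, c, d] : Fin 4 → ι) (Equiv.swap 0 2 i.succ))
      = ![b, a, d] := by
    ext i; fin_cases i <;> rfl
  have h3 : (fun i : Fin 3 => (![a, b, c, d] : Fin 4 → ι) (Equiv.swap 0 3 i.succ))
      = ![b, c, a] := by
    ext i; fin_cases i <;> rfl
  simp only [asym]
  rw [sum_perm_succ, Fin.sum_univ_four, h0, h1, h2, h3]
  simp [Nat.factorial]
  ring

theorem asym_three_of_alternating (f : ι → ι → ι → ℝ) (h01 : ∀ a b c, f b a c = - f a b c)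
    (h12 : ∀ a b c, f a c b = - f a b c) (a b c : ι) :
    asym (fun v : Fin 3 → ι => f (v 0) (v 1) (v 2)) ![a, b, c] = f a b c := by
  rw [asym_three]
  change 1 / 6 * (f a b c + f b c a + f c a b - f b a c - f a c b - f c b a) = f a b c
  rw [h01 b c a, h12 b a c, h01 a c b, h12 a b c, h01 a b c]
  ring

theorem asym_four_of_alternating_last (f : ι → ι → ι → ι → ℝ)
    (h12 : ∀ a b c d, f a c b d = - f a b c d) (h23 : ∀ a b c d, f a b d c = - f a b c d)
    (a b c d : ι) :
    asym (fun v : Fin 4 → ι => f (v 0) (v 1) (v 2) (v 3)) ![a, b, c, d]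
      = 1 / 4 * (f a b c d - f b a c d + f c a b d - f d a b c) := by
  have h (p q r s) : asym (fun w : Fin 3 → ι => f p (w 0) (w 1) (w 2)) ![q, r, s] = f p q r s :=
    asym_three_of_alternating (f p) (h12 p) (h23 p) q r s
  rw [asym_four]
  change 1 / 4 * (asym (fun w : Fin 3 → ι => f a (w 0) (w 1) (w 2)) ![b, c, d]
    - asym (fun w : Fin 3 → ι => f b (w 0) (w 1) (w 2)) ![a, c, d]
    - asym (fun w : Fin 3 → ι => f c (w 0) (w 1) (w 2)) ![b, a, d]
    - asym (fun w : Fin 3 → ι => f d (w 0) (w 1) (w 2)) ![b, c, a]) = _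
  rw [h, h, h, h, h12 c a b d, h23 d b a c, h12 d a b c]
  ring

theorem asym_four_of_alternating_pairs (f : ι → ι → ι → ι → ℝ)
    (h01 : ∀ a b c d, f b a c d = - f a b c d) (h23 : ∀ a b c d, f a b d c = - f a b c d)
    (a b c d : ι) :
    asym (fun v : Fin 4 → ι => f (v 0) (v 1) (v 2) (v 3)) ![a, b, c, d]
      = 1 / 6 * (f a b c d - f a c b d + f a d b c + f b c a d - f b d a c + f c d a b) := by
  have h (p q r s) : asym (fun w : Fin 3 → ι => f p (w 0) (w 1) (w 2)) ![q, r, s]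
      = 1 / 3 * (f p q r s + f p r s q + f p s q r) := by
    rw [asym_three]
    change 1 / 6 * (f p q r s + f p r s q + f p s q r - f p r q s - f p q s r - f p s r q) = _
    rw [h23 p r s q, h23 p q r s, h23 p s q r]
    ring
  rw [asym_four]
  change 1 / 4 * (asym (fun w : Fin 3 → ι => f a (w 0) (w 1) (w 2)) ![b, c, d]
    - asym (fun w : Fin 3 → ι => f b (w 0) (w 1) (w 2)) ![a, c, d]
    - asym (fun w : Fin 3 → ι => f c (w 0) (w 1) (w 2)) ![b, a, d]
    - asym (fun w : Fin 3 → ι => f d (w 0) (w 1) (w 2)) ![b, c, a]) = _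
  rw [h, h, h, h, h01 a c d b, h23 a c b d, h01 a b c d, h01 b c a d, h23 b c a d, h23 c d a b,
    h01 b d c a, h23 b d a c, h01 c d a b, h01 a d b c]
  ring

end Antisymmetrization

section Fluxes

variable {U : Set M} {e : Fin (Module.finrank ℝ E) → ∀ x : M, TangentSpace I x}
  (he : IsLocalFrameOn I E ∞ e U) (hU : IsOpen U) {x : M} (hx : x ∈ U)
  (β : Bivector I M) (H : ThreeForm I M) {X Y Z : ∀ x : M, TangentSpace I x}
  {ξ η ζ : ∀ x : M, Cotangent I x} {f g : M → ℝ}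

include hU hx

/-- The frame components of the defect are the fluxes `𝓡^{abc}`. -/
theorem coframe_anchorDefect (a b c : Fin (Module.finrank ℝ E)) :
    coframe he c x (anchorDefect β H (coframe he a) (coframe he b) x) = fluxR he β H a b c x := by
  have ha := (smooth_coframe he hU hx a).diff
  have hb := (smooth_coframe he hU hx b).diff
  have hc := (smooth_coframe he hU hx c).diff
  have hder (a b c : Fin (Module.finrank ℝ E)) :
      der (sharpF β (coframe he a)) (betaComp he β b c) x
        = ∑ m, betaComp he β a m x * frameDeriv e m (betaComp he β b c) x := by
    rw [der_frame_sum he hx]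
    simp only [coframe_sharpF]
  have hform : H.form x ![sharpF β (coframe he a) x, sharpF β (coframe he b) x,
      sharpF β (coframe he c) x] = ∑ m, ∑ n, ∑ p, hComp e H m n p x * betaComp he β a m x
        * betaComp he β b n x * betaComp he β c p x := by
    rw [form_frame_sum he hx]
    refine Finset.sum_congr rfl fun m _ => ?_
    rw [← form_rotate, form_frame_sum he hx, Finset.mul_sum]
    refine Finset.sum_congr rfl fun n _ => ?_
    rw [← form_rotate, form_frame_sum he hx, Finset.mul_sum, Finset.mul_sum]
    refine Finset.sum_congr rfl fun p _ => ?_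
    rw [← form_rotate, hComp, coframe_sharpF, coframe_sharpF, coframe_sharpF]
    ring
  have hR : geomR he β a b c x
      = der (sharpF β (coframe he a)) (betaComp he β b c) x
        + der (sharpF β (coframe he b)) (betaComp he β c a) x
        + der (sharpF β (coframe he c)) (betaComp he β a b) x
        + ∑ m, ∑ n, geomF he m n a x * betaComp he β b m x * betaComp he β c n x
        + ∑ m, ∑ n, geomF he m n b x * betaComp he β c m x * betaComp he β a n x
        + ∑ m, ∑ n, geomF he m n c x * betaComp he β a m x * betaComp he β b n x := by
    rw [geomR, asym_three]
    simp only [Matrix.cons_val_zero, Matrix.cons_val_one, Matrix.cons_val, ← hder]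
    have hf (a b c : Fin (Module.finrank ℝ E)) :
        ∑ m, ∑ n, geomF he m n a x * betaComp he β b m x * betaComp he β c n x
          = - ∑ m, ∑ n, geomF he m n a x * betaComp he β c m x * betaComp he β b n x := by
      rw [Finset.sum_comm, ← Finset.sum_neg_distrib]
      refine Finset.sum_congr rfl fun m _ => ?_
      rw [← Finset.sum_neg_distrib]
      refine Finset.sum_congr rfl fun n _ => ?_
      rw [geomF_swap]
      ring
    rw [betaComp_swap_fun he β a c, betaComp_swap_fun he β b a, betaComp_swap_fun he β c b,
      hf a c b, hf b a c, hf c b a]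
    simp only [der_neg]
    ring
  have hH : ∑ m, ∑ n, ∑ p, hComp e H m n p x * betaComp he β m a x * betaComp he β n b x
        * betaComp he β p c x = - ∑ m, ∑ n, ∑ p, hComp e H m n p x * betaComp he β a m x
        * betaComp he β b n x * betaComp he β c p x := by
    simp only [← Finset.sum_neg_distrib]
    refine Finset.sum_congr rfl fun m _ => Finset.sum_congr rfl fun n _ =>
      Finset.sum_congr rfl fun p _ => ?_
    rw [betaComp_swap he β m a, betaComp_swap he β n b, betaComp_swap he β p c]
    ring
  rw [apply_anchorDefect β H ha hb hc,
    coframe_mlieBracket he hU hx c (diff_sharpF β ha) (diff_sharpF β hb),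
    coframe_mlieBracket he hU hx a (diff_sharpF β hb) (diff_sharpF β hc),
    coframe_mlieBracket he hU hx b (diff_sharpF β hc) (diff_sharpF β ha), fluxR, hR, hform, hH]
  simp only [ev_coframe_sharpF, coframe_sharpF]
  rw [betaComp_swap_fun he β a c, betaComp_swap_fun he β b a, betaComp_swap_fun he β c b]
  simp only [der_neg]
  ring

omit hU hx in
/-- The trivector `𝓡` measures the failure of `β♯` to respect the brackets. -/
theorem contractR_eq (hξ : DiffSectionAt I (E →L[ℝ] ℝ) ξ x)
    (hη : DiffSectionAt I (E →L[ℝ] ℝ) η x) :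
    contractR β H x (ξ x) (η x) = anchorDefect β H ξ η x := by
  have hU := (trivializationAt E (TangentSpace I) x).open_baseSet
  have hx := FiberBundle.mem_baseSet_trivializationAt' (F := E) (E := TangentSpace I) x
  set he := isLocalFrameOn_chartFrame (I := I) x
  refine vector_ext fun θ => ?_
  have h1 {ξ η : ∀ x : M, Cotangent I x} (hξ : DiffSectionAt I (E →L[ℝ] ℝ) ξ x)
      (hη : DiffSectionAt I (E →L[ℝ] ℝ) η x) : θ (anchorDefect β H ξ η x)
        = ∑ a, ξ x (chartFrame x a x) * θ (anchorDefect β H (coframe he a) η x) :=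
    tensorial_coframe_sum he hU hx (tensorial_anchorDefect β H hη θ) hξ
  rw [h1 hξ hη, contractR]
  simp only [map_sum, map_smul, smul_eq_mul]
  refine Finset.sum_congr rfl fun a _ => ?_
  have ha := (smooth_coframe he hU hx a).diff
  rw [anchorDefect_swap β H hη ha, map_neg, h1 hη ha, mul_neg, Finset.mul_sum,
    ← Finset.sum_neg_distrib]
  refine Finset.sum_congr rfl fun b _ => ?_
  have hb := (smooth_coframe he hU hx b).diff
  rw [anchorDefect_swap β H ha hb, map_neg, ← sum_coframe_smul he hx (anchorDefect β H _ _ x)]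
  simp only [map_sum, map_smul, smul_eq_mul, Finset.mul_sum, ← Finset.sum_neg_distrib]
  refine Finset.sum_congr rfl fun c _ => ?_
  rw [coframe_anchorDefect he hU hx]
  ring

theorem sum_mul_coframe_frame (k : Fin (Module.finrank ℝ E))
    (w : Fin (Module.finrank ℝ E) → ℝ) : ∑ n, w n * coframe he n x (e k x) = w k := by
  simp [coframe_frame he hx]

theorem coframe_bracket_frame_left (a c : Fin (Module.finrank ℝ E))
    (hY : DiffSectionAt I E Y x) :
    coframe he c x (mlieBracket I (e a) Y x) = frameDeriv e a (ev (coframe he c) Y) x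
      + ∑ n, geomF he a n c x * coframe he n x (Y x) := by
  rw [coframe_mlieBracket he hU hx c (smooth_frame he hU hx a).diff hY,
    der_ev_coframe_frame he hU hx, sub_zero, Finset.sum_comm]
  congr 1
  refine Finset.sum_congr rfl fun n _ => ?_
  rw [← sum_mul_coframe_frame he hU hx a (fun m => geomF he m n c x), Finset.sum_mul]

omit hU in
theorem form_sharpF_sharpF (k a b : Fin (Module.finrank ℝ E)) :
    H.form x ![e k x, sharpF β (coframe he a) x, sharpF β (coframe he b) x]
      = ∑ m, ∑ n, hComp e H k m n x * betaComp he β m a x * betaComp he β n b x := by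
  rw [← form_rotate, form_frame_sum he hx]
  refine Finset.sum_congr rfl fun m _ => ?_
  rw [← form_rotate, form_frame_sum he hx, Finset.mul_sum]
  refine Finset.sum_congr rfl fun n _ => ?_
  rw [← form_rotate, hComp, coframe_sharpF, coframe_sharpF, betaComp_swap he β a m,
    betaComp_swap he β b n]
  ring

omit hU in
theorem form_sharpF (a b k : Fin (Module.finrank ℝ E)) :
    H.form x ![e a x, sharpF β (coframe he b) x, e k x]
      = ∑ m, hComp e H a k m x * betaComp he β m b x := by
  rw [form_swap12, ← form_rotate, ← form_rotate, form_frame_sum he hx, ← Finset.sum_neg_distrib]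
  refine Finset.sum_congr rfl fun m _ => ?_
  rw [form_rotate, form_rotate, hComp, coframe_sharpF, betaComp_swap he β b m]
  ring

/-- The frame components of `[eᵃ, eᵇ]^H_KS` are the fluxes `𝓠_k^{ab}`. -/
theorem twistedKoszul_coframe (a b k : Fin (Module.finrank ℝ E)) :
    twistedKoszul β H (coframe he a) (coframe he b) x (e k x) = fluxQ he β H k a b x := by
  have ha := (smooth_coframe he hU hx a).diff
  have hb := (smooth_coframe he hU hx b).diff
  have hk := (smooth_frame he hU hx k).diff
  have hsum (a b : Fin (Module.finrank ℝ E)) :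
      ∑ n, geomF he k n b x * betaComp he β a n x
        = - ∑ n, geomF he k n b x * betaComp he β n a x := by
    rw [← Finset.sum_neg_distrib]
    refine Finset.sum_congr rfl fun n _ => ?_
    rw [betaComp_swap he β a n]
    ring
  rw [twistedKoszul_apply β H ha hb hk, der_ev_coframe_frame he hU hx, contract_apply,
    extD_swap, extD, der_ev_coframe_frame he hU hx, mlieBracket_swap_apply, map_neg,
    coframe_bracket_frame_left he hU hx k b (diff_sharpF β ha),
    coframe_bracket_frame_left he hU hx k a (diff_sharpF β hb), form_rotate,
    form_sharpF_sharpF he hx, fluxQ, geomQ]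
  simp only [ev_coframe_sharpF, coframe_sharpF, hsum]
  simp only [der, frameDeriv]
  ring

end Fluxes

/-! ### Conjugation by the bivector and the bracket of frame sections -/

section Conjugation

variable {X Y Z : ∀ x : M, TangentSpace I x} {x : M} {ξ η : ∀ x : M, Cotangent I x}
  {f g : M → ℝ} (β : Bivector I M) (H : ThreeForm I M)

/-- Both components of `⟦X, ξ⟧` in terms of Lie brackets, Lie derivatives and `H`. -/
theorem bracketVF_eq (hX : DiffSectionAt I E X x) (hξ : DiffSectionAt I (E →L[ℝ] ℝ) ξ x) :
    bracketVF β H X ξ x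
      = (mlieBracket I X (sharpF β ξ) x - sharp β x (intD X ξ x
            + contract H x (X x) (sharpF β ξ x)) - (1 / 2 : ℝ) • sharp β x (dH (ev ξ X) x),
          lieCov X ξ x + contract H x (X x) (sharpF β ξ x) - (1 / 2 : ℝ) • dH (ev ξ X) x) := by
  have hp : pairMinus (ofVec X) (ofForm ξ) = fun y => - ev ξ X y := by
    ext y; simp [pairMinus, ofVec, ofForm, ev]
  simp only [bracketVF, Pi.add_apply, Pi.sub_apply, Pi.smul_apply, ofForm, ofVec,
    lieH_eq β H hξ, lieβ_eq β H hξ hX, hp, dβ_eq, dH_neg, mlieBracket_swap_apply (V := X)]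
  ext : 1
  · simp only [Prod.fst_add, Prod.fst_sub, Prod.smul_fst, map_neg, map_add]
    module
  · simp only [Prod.snd_add, Prod.snd_sub, Prod.smul_snd]
    module

theorem bracketFV_eq (X : ∀ x : M, TangentSpace I x) (ξ : ∀ x : M, Cotangent I x) (x : M) :
    bracketFV β H ξ X x = - bracketVF β H X ξ x := by
  have hp : pairMinus (ofVec X) (ofForm ξ) = fun y => - pairMinus (ofForm ξ) (ofVec X) y := by
    ext y; simp [pairMinus, ofVec, ofForm]
  simp only [bracketVF, bracketFV, hp, Pi.add_apply, Pi.sub_apply, Pi.smul_apply, ofForm, ofVec,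
    dβ_eq, dH_neg]
  ext : 1
  · simp only [Prod.fst_add, Prod.fst_sub, Prod.smul_fst, Prod.fst_neg, map_neg]
    module
  · simp only [Prod.snd_add, Prod.snd_sub, Prod.smul_snd, Prod.snd_neg]
    module

theorem bracketFF_eq (hξ : DiffSectionAt I (E →L[ℝ] ℝ) ξ x)
    (hη : DiffSectionAt I (E →L[ℝ] ℝ) η x) :
    bracketFF β H ξ η x = (anchorDefect β H ξ η x, twistedKoszul β H ξ η x) := by
  simp [bracketFF, ofForm, ofVec, contractR_eq β H hξ hη]

theorem roytenbergBracket_apply (s t : ∀ x : M, GenTangent I x) (x : M) :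
    roytenbergBracket β H s t x = bracketVV β H (fun x => (s x).1) (fun x => (t x).1) x
      + bracketVF β H (fun x => (s x).1) (fun x => (t x).2) x
      - bracketVF β H (fun x => (t x).1) (fun x => (s x).2) x
      + bracketFF β H (fun x => (s x).2) (fun x => (t x).2) x := by
  simp only [roytenbergBracket, Pi.add_apply, bracketFV_eq]
  abel

/-- The `H`-twisted Courant bracket
`[X, Y] + L_X η - L_Y ξ - (1/2) d(η(X) - ξ(Y)) + ι_Y ι_X H`. -/
def courantBracket (s t : ∀ x : M, GenTangent I x) (x : M) : GenTangent I x :=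
  (mlieBracket I (fun y => (s y).1) (fun y => (t y).1) x,
    lieCov (fun y => (s y).1) (fun y => (t y).2) x - lieCov (fun y => (t y).1) (fun y => (s y).2) x
      - (1 / 2 : ℝ) • dH (fun y => (t y).2 (s y).1 - (s y).2 (t y).1) x
      + contract H x (s x).1 (t x).1)

/-- The transformation `e^β`, `X + ξ ↦ X + β♯ξ + ξ`. -/
def expMap (x : M) : GenTangent I x →ₗ[ℝ] GenTangent I x where
  toFun v := (v.1 + sharp β x v.2, v.2)
  map_add' u v := by
    ext : 1
    · simp only [Prod.fst_add, Prod.snd_add, map_add]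
      abel
    · rfl
  map_smul' c v := by
    ext : 1
    · simp
    · rfl

theorem expMap_injective (x : M) : Function.Injective (expMap (I := I) β x) := by
  intro u v h
  have h2 := congrArg (fun w : GenTangent I x => w.2) h
  have h1 := congrArg (fun w : GenTangent I x => w.1) h
  change u.2 = v.2 at h2
  change u.1 + sharp β x u.2 = v.1 + sharp β x v.2 at h1
  rw [h2] at h1
  exact Prod.ext (add_right_cancel h1) h2

/-- The map `e^β` applied to a section. -/
def expF (s : ∀ x : M, GenTangent I x) (x : M) : GenTangent I x := expMap β x (s x)

/-- The Roytenberg bracket is the `H`-twisted Courant bracket conjugated by `e^β`. In the vector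
component, the term `ι_η ι_ξ 𝓡` supplies exactly `[β♯ξ, β♯η] - β♯[ξ, η]^H_KS`, which replaces the
image under `β♯` of the Koszul bracket by `[β♯ξ, β♯η]`. -/
theorem expMap_roytenbergBracket {s t : ∀ x : M, GenTangent I x}
    (hX : DiffSectionAt I E (fun y => (s y).1) x)
    (hξ : DiffSectionAt I (E →L[ℝ] ℝ) (fun y => (s y).2) x)
    (hY : DiffSectionAt I E (fun y => (t y).1) x)
    (hη : DiffSectionAt I (E →L[ℝ] ℝ) (fun y => (t y).2) x) :
    expMap β x (roytenbergBracket β H s t x) = courantBracket H (expF β s) (expF β t) x := by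
  have key : roytenbergBracket β H s t x = _ := roytenbergBracket_apply β H s t x
  rw [bracketVF_eq β H hX hη, bracketVF_eq β H hY hξ, bracketFF_eq β H hξ hη] at key
  simp only [expF, expMap, courantBracket, LinearMap.coe_mk, AddHom.coe_mk]
  set X := fun y => (s y).1
  set Y := fun y => (t y).1
  set ξ := fun y => (s y).2
  set η := fun y => (t y).2
  have hbX := diff_sharpF β hξ
  have hbY := diff_sharpF β hη
  have h1 : mlieBracket I (fun y => (s y).1 + sharp β y (s y).2)
      (fun y => (t y).1 + sharp β y (t y).2) x
      = mlieBracket I X Y x + mlieBracket I X (sharpF β η) x - mlieBracket I Y (sharpF β ξ) x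
        + mlieBracket I (sharpF β ξ) (sharpF β η) x := by
    have a1 := bracket_add_right (X := fun y => X y + sharpF β ξ y) hY hbY
    rw [bracket_add_left (Y := Y) hX hbX, bracket_add_left (Y := sharpF β η) hX hbX,
      mlieBracket_swap_apply (V := sharpF β ξ) (W := Y)] at a1
    refine a1.trans ?_
    abel
  have h2 : lieCov (fun y => (s y).1 + sharp β y (s y).2) η x
      = lieCov X η x + lieCov (sharpF β ξ) η x := lieCov_add_left hη hX hbX
  have h3 : lieCov (fun y => (t y).1 + sharp β y (t y).2) ξ x
      = lieCov Y ξ x + lieCov (sharpF β η) ξ x := lieCov_add_left hξ hY hbY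
  have h4 : dH (I := I) (fun y => (t y).2 ((s y).1 + sharp β y (s y).2)
      - (s y).2 ((t y).1 + sharp β y (t y).2)) x
      = dH (ev η X) x - dH (ev ξ Y) x - (2 : ℝ) • dH (ev ξ (sharpF β η)) x := by
    have : (fun y => (t y).2 ((s y).1 + sharp β y (s y).2)
        - (s y).2 ((t y).1 + sharp β y (t y).2))
        = fun y => (ev η X y - ev ξ Y y) - (ev ξ (sharpF β η) y + ev ξ (sharpF β η) y) := by
      ext y
      have := apply_sharp_swap β y (ξ y) (η y)
      simp only [ev, sharpF, map_add, η, ξ, X, Y] at this ⊢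
      rw [this]
      ring
    have m1 : MDifferentiableAt I 𝓘(ℝ, ℝ) (fun y => ev η X y - ev ξ Y y) x :=
      (mdiff_ev hη hX).sub (mdiff_ev hξ hY)
    have m2 : MDifferentiableAt I 𝓘(ℝ, ℝ)
        (fun y => ev ξ (sharpF β η) y + ev ξ (sharpF β η) y) x :=
      (mdiff_ev hξ hbY).add (mdiff_ev hξ hbY)
    rw [this, dH_sub m1 m2, dH_sub (mdiff_ev hη hX) (mdiff_ev hξ hY),
      dH_add (mdiff_ev hξ hbY) (mdiff_ev hξ hbY)]
    module
  rw [h1, h2, h3, h4, key]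
  have h5 : contract H x ((s x).1 + sharp β x (s x).2) ((t x).1 + sharp β x (t x).2)
      = contract H x (X x) (Y x) + contract H x (X x) (sharpF β η x)
        - contract H x (Y x) (sharpF β ξ x) + contract H x (sharpF β ξ x) (sharpF β η x) := by
    rw [contract_add_left, contract_add_right, contract_add_right,
      contract_swap H x (t x).1 (sharp β x (s x).2)]
    simp only [X, Y, sharpF, ξ, η]
    abel
  rw [h5, bracketVV, anchorDefect, twistedKoszul, koszul_eq, lieCov_eq (Y := sharpF β η) hξ,
    lieCov_eq (Y := X) hη, lieCov_eq (Y := Y) hξ]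
  have hs (ζ : ∀ x : M, Cotangent I x) : sharpF β ζ x = sharp β x (ζ x) := rfl
  ext : 1
  · simp only [Pi.add_apply, ofVec, ofForm, twistedLie, Prod.fst_add, Prod.fst_sub, Prod.snd_add,
      Prod.snd_sub, map_add, map_sub, map_smul, zero_add, add_zero, X, Y]
    module
  · simp only [Pi.add_apply, ofVec, ofForm, Prod.snd_add, Prod.snd_sub, zero_add, X, Y, hs]
    module

end Conjugation

section FrameFormulas

variable {U : Set M} {e : Fin (Module.finrank ℝ E) → ∀ x : M, TangentSpace I x}
  (he : IsLocalFrameOn I E ∞ e U) (hU : IsOpen U) {x : M} (hx : x ∈ U)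
  (β : Bivector I M) (H : ThreeForm I M) {X Y Z : ∀ x : M, TangentSpace I x}
  {ξ η ζ : ∀ x : M, Cotangent I x} {f g : M → ℝ}

/-! In the frame formulas one component of each section vanishes; the parts of the bracket with a
zero argument are zero. -/

theorem diff_zero_vec : DiffSectionAt I E (0 : ∀ x : M, TangentSpace I x) x :=
  mdifferentiable_zeroSection ..

theorem diff_zero_cov : DiffSectionAt I (E →L[ℝ] ℝ) (0 : ∀ x : M, Cotangent I x) x :=
  mdifferentiable_zeroSection ..

theorem dH_zero : dH (I := I) (fun _ : M => (0 : ℝ)) x = 0 := by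
  ext v; simp [dH_apply, mvfderiv_const]

theorem bracketVF_zero_left (hξ : DiffSectionAt I (E →L[ℝ] ℝ) ξ x) :
    bracketVF β H 0 ξ x = 0 := by
  have h1 : intD 0 ξ x = 0 := covector_ext fun Z hZ => by
    rw [intD_apply hξ hZ]; simp [extD, der, ev_def, mvfderiv_const]
  have h2 : lieCov 0 ξ x = 0 := covector_ext fun Z hZ => by
    rw [lieCov_apply hξ hZ]; simp [der]
  have h3 : contract H x 0 (sharpF β ξ x) = 0 := by
    have := contract_add_left H x 0 0 (sharpF β ξ x)
    simpa using this
  have h4 : ev ξ 0 = fun _ => (0 : ℝ) := by ext y; simp [ev]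
  rw [bracketVF_eq β H diff_zero_vec hξ, h1, h2, h4, Pi.zero_apply, h3]
  simp [dH_zero]

theorem bracketVF_zero_right (hX : DiffSectionAt I E X x) :
    bracketVF β H X 0 x = 0 := by
  have h0 : sharpF β (0 : ∀ x : M, Cotangent I x) = 0 := by ext y; simp [sharpF]
  have h1 : intD X 0 x = 0 := covector_ext fun Z hZ => by
    rw [intD_apply diff_zero_cov hZ]; simp [extD, der, ev_def, mvfderiv_const]
  have h2 : lieCov X 0 x = 0 := covector_ext fun Z hZ => by
    rw [lieCov_apply diff_zero_cov hZ]; simp [der, ev_def, mvfderiv_const]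
  have h3 : contract H x (X x) 0 = 0 := by
    have := contract_add_right H x (X x) 0 0
    simpa using this
  have h4 : ev 0 X = fun _ => (0 : ℝ) := by ext y; simp [ev]
  rw [bracketVF_eq β H hX diff_zero_cov, h0, h1, h2, h4, Pi.zero_apply, h3]
  simp [dH_zero]

theorem bracketVV_zero_left : bracketVV β H 0 Y x = 0 := by
  have h3 : contract H x 0 (Y x) = 0 := by
    have := contract_add_left H x 0 0 (Y x)
    simpa using this
  simp [bracketVV, twistedLie, ofVec, ofForm, h3]

theorem bracketVV_zero_right : bracketVV β H X 0 x = 0 := by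
  have h3 : contract H x (X x) 0 = 0 := by
    have := contract_add_right H x (X x) 0 0
    simpa using this
  simp [bracketVV, twistedLie, ofVec, ofForm, h3]

theorem bracketFF_zero_left (hη : DiffSectionAt I (E →L[ℝ] ℝ) η x) :
    bracketFF β H 0 η x = 0 := by
  have h := bracketFF_eq β H diff_zero_cov hη
  have h0 : sharpF β (0 : ∀ x : M, Cotangent I x) = 0 := by ext y; simp [sharpF]
  have h3 : contract H x 0 (sharpF β η x) = 0 := by
    have := contract_add_left H x 0 0 (sharpF β η x)
    simpa using this
  have h4 : twistedKoszul β H 0 η x = 0 := covector_ext fun Z hZ => by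
    rw [twistedKoszul_apply β H diff_zero_cov hη hZ, h0, Pi.zero_apply, h3]
    simp [extD, der, ev_def, mvfderiv_const]
  rw [h, anchorDefect, h4, h0]
  simp

include hU hx

theorem bracket_frame_frame (a b : Fin (Module.finrank ℝ E)) :
    roytenbergBracket β H (ofVec (e a)) (ofVec (e b)) x
      = ∑ c, fluxF he β H a b c x • ofVec (e c) x
        + ∑ c, fluxH e H a b c x • ofForm (coframe he c) x := by
  have ha := (smooth_frame he hU hx a).diff
  have hb := (smooth_frame he hU hx b).diff
  have key : roytenbergBracket β H (ofVec (e a)) (ofVec (e b)) x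
      = bracketVV β H (e a) (e b) x + bracketVF β H (e a) 0 x - bracketVF β H (e b) 0 x
        + bracketFF β H 0 0 x := roytenbergBracket_apply ..
  rw [key, bracketVF_zero_right β H ha, bracketVF_zero_right β H hb,
    bracketFF_zero_left β H diff_zero_cov]
  ext : 1
  · simp only [bracketVV, Pi.add_apply, ofVec, ofForm, twistedLie, Prod.fst_add, Prod.fst_sum,
      Prod.smul_fst, smul_zero, Finset.sum_const_zero, add_zero, sub_zero]
    rw [← sum_coframe_smul he hx (mlieBracket I (e a) (e b) x - _)]
    refine Finset.sum_congr rfl fun c _ => ?_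
    rw [map_sub, apply_sharp_swap, contract_apply,
      show sharp β x (coframe he c x) = sharpF β (coframe he c) x from rfl, form_swap12, neg_neg,
      form_sharpF he hx, fluxF, geomF]
  · simp only [bracketVV, Pi.add_apply, ofVec, ofForm, Prod.snd_add, Prod.snd_sum,
      Prod.smul_snd, smul_zero, Finset.sum_const_zero, add_zero, sub_zero, zero_add]
    rw [covector_eq_sum he hx (contract H x _ _)]
    refine Finset.sum_congr rfl fun c _ => ?_
    rw [contract_apply]
    rfl

theorem bracket_frame_coframe (a b : Fin (Module.finrank ℝ E)) :
    roytenbergBracket β H (ofVec (e a)) (ofForm (coframe he b)) x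
      = ∑ c, fluxQ he β H a b c x • ofVec (e c) x
        - ∑ c, fluxF he β H a c b x • ofForm (coframe he c) x := by
  have ha := (smooth_frame he hU hx a).diff
  have hb := (smooth_coframe he hU hx b).diff
  have key : roytenbergBracket β H (ofVec (e a)) (ofForm (coframe he b)) x
      = bracketVV β H (e a) 0 x + bracketVF β H (e a) (coframe he b) x - bracketVF β H 0 0 x
        + bracketFF β H 0 (coframe he b) x := roytenbergBracket_apply ..
  have h0 : dH (I := I) (ev (coframe he b) (e a)) x = 0 := by
    refine covector_ext fun Z _ => ?_
    rw [dH_apply]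
    exact der_ev_coframe_frame he hU hx Z b a
  rw [key, bracketVF_zero_right β H diff_zero_vec, bracketVV_zero_right,
    bracketFF_zero_left β H hb, bracketVF_eq β H ha hb, h0]
  ext : 1
  · simp only [ofVec, ofForm, Prod.fst_sub, Prod.fst_sum, Prod.smul_fst,
      smul_zero, Finset.sum_const_zero, add_zero, sub_zero, zero_add, map_zero]
    rw [← sum_coframe_smul he hx (mlieBracket I (e a) _ x - _)]
    refine Finset.sum_congr rfl fun c _ => ?_
    have hc := (smooth_coframe he hU hx c).diff
    congr 1
    rw [map_sub, apply_sharp_swap, show sharp β x (coframe he c x) = sharpF β (coframe he c) x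
      from rfl, _root_.add_apply, contract_apply, intD_apply hb (diff_sharpF β hc), extD,
      der_ev_coframe_frame he hU hx, coframe_bracket_frame_left he hU hx _ _ (diff_sharpF β hb),
      coframe_bracket_frame_left he hU hx _ _ (diff_sharpF β hc), form_sharpF_sharpF he hx, fluxQ,
      geomQ]
    simp only [ev_coframe_sharpF, coframe_sharpF]
    have hs (b c : Fin (Module.finrank ℝ E)) : ∑ n, geomF he a n c x * betaComp he β b n x
        = - ∑ n, geomF he a n c x * betaComp he β n b x := by
      rw [← Finset.sum_neg_distrib]
      refine Finset.sum_congr rfl fun n _ => ?_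
      rw [betaComp_swap he β b n]
      ring
    rw [hs, hs]
    simp only [der, frameDeriv]
    ring
  · simp only [ofVec, ofForm, Prod.snd_sub, Prod.snd_sum, Prod.smul_snd,
      smul_zero, Finset.sum_const_zero, add_zero, sub_zero, zero_add, zero_sub]
    rw [covector_eq_sum he hx (lieCov _ _ x + _), ← Finset.sum_neg_distrib]
    refine Finset.sum_congr rfl fun c _ => ?_
    have hc := (smooth_frame he hU hx c).diff
    refine Eq.trans ?_ (neg_smul _ _)
    congr 1
    rw [_root_.add_apply, lieCov_apply hb hc, der_ev_coframe_frame he hU hx, contract_apply,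
      form_sharpF he hx, fluxF, geomF]
    ring

theorem bracket_coframe_coframe (a b : Fin (Module.finrank ℝ E)) :
    roytenbergBracket β H (ofForm (coframe he a)) (ofForm (coframe he b)) x
      = ∑ c, fluxQ he β H c a b x • ofForm (coframe he c) x
        + ∑ c, fluxR he β H a b c x • ofVec (e c) x := by
  have ha := (smooth_coframe he hU hx a).diff
  have hb := (smooth_coframe he hU hx b).diff
  have key : roytenbergBracket β H (ofForm (coframe he a)) (ofForm (coframe he b)) x
      = bracketVV β H 0 0 x + bracketVF β H 0 (coframe he b) x
        - bracketVF β H 0 (coframe he a) x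
        + bracketFF β H (coframe he a) (coframe he b) x := roytenbergBracket_apply ..
  rw [key, bracketVF_zero_left β H ha, bracketVF_zero_left β H hb, bracketVV_zero_left,
    bracketFF_eq β H ha hb]
  ext : 1
  · simp only [ofVec, ofForm, Prod.fst_add, Prod.fst_sum, Prod.smul_fst,
      smul_zero, Finset.sum_const_zero, add_zero, sub_zero, zero_add]
    rw [← sum_coframe_smul he hx (anchorDefect β H _ _ x)]
    simp only [coframe_anchorDefect he hU hx]
  · simp only [ofVec, ofForm, Prod.snd_add, Prod.snd_sum, Prod.smul_snd,
      smul_zero, Finset.sum_const_zero, add_zero, sub_zero, zero_add]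
    rw [covector_eq_sum he hx (twistedKoszul β H _ _ x)]
    simp only [twistedKoszul_coframe he hU hx]

end FrameFormulas

/-! ### The Jacobi identity for the twisted Courant bracket -/

section CourantBracket

variable {X Y Z W : ∀ x : M, TangentSpace I x} {x : M} {ξ η : ∀ x : M, Cotangent I x}
  {f g : M → ℝ} (H : ThreeForm I M)

/-- The value on `Z` of the one-form component of the `H`-twisted Courant bracket of `X + ξ` and
`Y + η`. -/
def courantForm (X : ∀ x : M, TangentSpace I x) (ξ : ∀ x : M, Cotangent I x)
    (Y : ∀ x : M, TangentSpace I x) (η : ∀ x : M, Cotangent I x) (Z : ∀ x : M, TangentSpace I x)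
    (x : M) : ℝ :=
  der X (ev η Z) x - ev η (mlieBracket I X Z) x - der Y (ev ξ Z) x + ev ξ (mlieBracket I Y Z) x
    - 1 / 2 * (der Z (ev η X) x - der Z (ev ξ Y) x) + evH H X Y Z x

theorem courantBracket_snd_apply {s t : ∀ x : M, GenTangent I x}
    (hX : DiffSectionAt I E (fun y => (s y).1) x)
    (hξ : DiffSectionAt I (E →L[ℝ] ℝ) (fun y => (s y).2) x)
    (hY : DiffSectionAt I E (fun y => (t y).1) x)
    (hη : DiffSectionAt I (E →L[ℝ] ℝ) (fun y => (t y).2) x) (hZ : DiffSectionAt I E Z x) :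
    (courantBracket H s t x).2 (Z x)
      = courantForm H (fun y => (s y).1) (fun y => (s y).2) (fun y => (t y).1)
          (fun y => (t y).2) Z x := by
  have h := dH_sub (mdiff_ev hη hX) (mdiff_ev hξ hY)
  have h' : (fun y => (t y).2 (s y).1 - (s y).2 (t y).1)
    = fun y => ev (fun y => (t y).2) (fun y => (s y).1) y
      - ev (fun y => (s y).2) (fun y => (t y).1) y := rfl
  simp only [courantBracket, h', h, _root_.add_apply, sub_apply, _root_.smul_apply,
    lieCov_apply hη hZ, lieCov_apply hξ hZ, dH_apply, contract_apply, courantForm, der, ev, evH,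
    smul_eq_mul]
  ring

theorem smooth_ev_bracket (hξ : SmoothSectionAt I (E →L[ℝ] ℝ) ξ x) (hX : SmoothSectionAt I E X x)
    (hY : SmoothSectionAt I E Y x) : ContMDiffAt I 𝓘(ℝ, ℝ) ∞ (ev ξ (mlieBracket I X Y)) x :=
  smooth_ev hξ (smooth_mlieBracket hX hY)

theorem smooth_der_ev (hξ : SmoothSectionAt I (E →L[ℝ] ℝ) ξ x) (hX : SmoothSectionAt I E X x)
    (hY : SmoothSectionAt I E Y x) : ContMDiffAt I 𝓘(ℝ, ℝ) ∞ (der X (ev ξ Y)) x :=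
  smooth_der hX (smooth_ev hξ hY)

variable (hX : SmoothSectionAt I E X x) (hξ : SmoothSectionAt I (E →L[ℝ] ℝ) ξ x)
  (hY : SmoothSectionAt I E Y x) (hη : SmoothSectionAt I (E →L[ℝ] ℝ) η x)
  (hZ : SmoothSectionAt I E Z x)

include hX hξ hY hη hZ

theorem smooth_courantForm :
    ContMDiffAt I 𝓘(ℝ, ℝ) ∞ (courantForm H X ξ Y η Z) x :=
  ((((((smooth_der_ev hη hX hZ).sub (smooth_ev_bracket hη hX hZ)).sub
    (smooth_der_ev hξ hY hZ)).add (smooth_ev_bracket hξ hY hZ)).sub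
    (contMDiffAt_const.mul ((smooth_der_ev hη hZ hX).sub (smooth_der_ev hξ hZ hY)))).add
    (smooth_evH H hX hY hZ))

theorem der_courantForm :
    der W (courantForm H X ξ Y η Z) x
      = der W (der X (ev η Z)) x - der W (ev η (mlieBracket I X Z)) x - der W (der Y (ev ξ Z)) x
        + der W (ev ξ (mlieBracket I Y Z)) x
        - 1 / 2 * (der W (der Z (ev η X)) x - der W (der Z (ev ξ Y)) x)
        + der W (evH H X Y Z) x := by
  have d {f : M → ℝ} (hf : ContMDiffAt I 𝓘(ℝ, ℝ) ∞ f x) : MDifferentiableAt I 𝓘(ℝ, ℝ) f x :=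
    hf.mdifferentiableAt (by simp)
  have h1 := d (smooth_der_ev hη hX hZ)
  have h2 := d (smooth_ev_bracket hη hX hZ)
  have h3 := d (smooth_der_ev hξ hY hZ)
  have h4 := d (smooth_ev_bracket hξ hY hZ)
  have h5 := d (smooth_der_ev hη hZ hX)
  have h6 := d (smooth_der_ev hξ hZ hY)
  have h7 := d (smooth_evH H hX hY hZ)
  have h8 := h5.sub h6
  have h9 := mdifferentiableAt_const (c := (1 / 2 : ℝ)) (I := I) (x := x) (I' := 𝓘(ℝ, ℝ))
  refine (der_add ((((h1.sub h2).sub h3).add h4).sub (h9.mul h8)) h7).trans (congrArg (· + _) ?_)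
  refine (der_sub (((h1.sub h2).sub h3).add h4) (h9.mul h8)).trans (congrArg₂ (· - ·) ?_ ?_)
  · refine (der_add ((h1.sub h2).sub h3) h4).trans (congrArg (· + _) ?_)
    exact (der_sub (h1.sub h2) h3).trans (congrArg (· - _) (der_sub h1 h2))
  · exact (der_const_mul _ h8).trans (congrArg (_ * ·) (der_sub h5 h6))

omit hX hξ hY hη hZ

/-- Differentiating the one-form component of a bracket takes `courantForm` on a neighbourhood, not
only at the point. -/
theorem eventually_courantBracket_snd {s t : ∀ x : M, GenTangent I x}
    (hX : SmoothSectionAt I E (fun y => (s y).1) x)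
    (hξ : SmoothSectionAt I (E →L[ℝ] ℝ) (fun y => (s y).2) x)
    (hY : SmoothSectionAt I E (fun y => (t y).1) x)
    (hη : SmoothSectionAt I (E →L[ℝ] ℝ) (fun y => (t y).2) x) (hZ : SmoothSectionAt I E Z x) :
    ev (fun y => (courantBracket H s t y).2) Z =ᶠ[𝓝 x]
      courantForm H (fun y => (s y).1) (fun y => (s y).2) (fun y => (t y).1)
          (fun y => (t y).2) Z := by
  have : IsManifold I 2 M := IsManifold.of_le (n := ∞) (ENat.LEInfty.out)
  filter_upwards [eventually_diff hX, eventually_diff hξ, eventually_diff hY, eventually_diff hη,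
    eventually_diff hZ] with y h1 h2 h3 h4 h5
  exact courantBracket_snd_apply H h1 h2 h3 h4 h5

theorem chartFrame_smooth (x : M) (a : Fin (Module.finrank ℝ E)) :
    SmoothSectionAt I E (chartFrame (I := I) x a) x :=
  smooth_frame (isLocalFrameOn_chartFrame x) (trivializationAt E (TangentSpace I) x).open_baseSet
    (FiberBundle.mem_baseSet_trivializationAt' x) a

theorem smooth_courantBracket_snd {s t : ∀ x : M, GenTangent I x}
    (hX : SmoothSectionAt I E (fun y => (s y).1) x)
    (hξ : SmoothSectionAt I (E →L[ℝ] ℝ) (fun y => (s y).2) x)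
    (hY : SmoothSectionAt I E (fun y => (t y).1) x)
    (hη : SmoothSectionAt I (E →L[ℝ] ℝ) (fun y => (t y).2) x) :
    SmoothSectionAt I (E →L[ℝ] ℝ) (fun y => (courantBracket H s t y).2) x :=
  smooth_covector_of_chartFrame fun a =>
    (smooth_courantForm H hX hξ hY hη (chartFrame_smooth x a)).congr_of_eventuallyEq
      (eventually_courantBracket_snd H hX hξ hY hη (chartFrame_smooth x a))

/-- A covector is determined by its values on the values of fields smooth at `x`. -/
theorem covector_ext_smooth {θ θ' : Cotangent I x}
    (h : ∀ Z : ∀ x : M, TangentSpace I x, SmoothSectionAt I E Z x → θ (Z x) = θ' (Z x)) :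
    θ = θ' := by
  have hx : x ∈ (trivializationAt E (TangentSpace I) x).baseSet :=
    FiberBundle.mem_baseSet_trivializationAt' (F := E) (E := TangentSpace I) x
  rw [covector_eq_sum (isLocalFrameOn_chartFrame x) hx θ,
    covector_eq_sum (isLocalFrameOn_chartFrame x) hx θ']
  simp only [fun a => h _ (chartFrame_smooth x a)]

/-- `dH(X, Y, Z, W)`, by the Cartan formula. -/
def extH (X Y Z W : ∀ x : M, TangentSpace I x) (x : M) : ℝ :=
  der X (evH H Y Z W) x - der Y (evH H X Z W) x + der Z (evH H X Y W) x - der W (evH H X Y Z) x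
    - evH H (mlieBracket I X Y) Z W x + evH H (mlieBracket I X Z) Y W x
    - evH H (mlieBracket I X W) Y Z x - evH H (mlieBracket I Y Z) X W x
    + evH H (mlieBracket I Y W) X Z x - evH H (mlieBracket I Z W) X Y x

end CourantBracket

section Jacobi

variable {X₁ X₂ X₃ Z : ∀ x : M, TangentSpace I x} {x : M} {ξ₁ ξ₂ ξ₃ c : ∀ x : M, Cotangent I x}
  (H : ThreeForm I M)

theorem ev_bracket_swap (ξ : ∀ x : M, Cotangent I x) (X Y : ∀ x : M, TangentSpace I x) :
    ev ξ (mlieBracket I X Y) = fun y => - ev ξ (mlieBracket I Y X) y := by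
  ext y
  simp only [ev]
  rw [mlieBracket_swap_apply, map_neg]

theorem evH_bracket_swap (X Y Z W : ∀ x : M, TangentSpace I x) :
    evH H (mlieBracket I X Y) Z W x = - evH H (mlieBracket I Y X) Z W x := by
  simp only [evH]
  rw [mlieBracket_swap_apply]
  exact map_neg (formFirst H x (Z x) (W x)) _

theorem ev_jacobi (ξ : ∀ x : M, Cotangent I x) (h₁ : SmoothSectionAt I E X₁ x)
    (h₂ : SmoothSectionAt I E X₂ x) (h₃ : SmoothSectionAt I E X₃ x) :
    ev ξ (mlieBracket I X₁ (mlieBracket I X₂ X₃)) x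
      = ev ξ (mlieBracket I (mlieBracket I X₁ X₂) X₃) x
        + ev ξ (mlieBracket I X₂ (mlieBracket I X₁ X₃)) x := by
  simp only [ev, bracket_jacobi h₁ h₂ h₃, map_add]

/-- One of the three summands of the Jacobiator, with `c = [X₁ + ξ₁, X₂ + ξ₂]` written out and the
Lie brackets acting on functions replaced by commutators of derivatives. -/
theorem courantForm_courantForm (h₁ : SmoothSectionAt I E X₁ x) (h₂ : SmoothSectionAt I E X₂ x)
    (h₃ : SmoothSectionAt I E X₃ x) (hZ : SmoothSectionAt I E Z x)
    (k₁ : SmoothSectionAt I (E →L[ℝ] ℝ) ξ₁ x) (k₂ : SmoothSectionAt I (E →L[ℝ] ℝ) ξ₂ x)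
    (k₃ : SmoothSectionAt I (E →L[ℝ] ℝ) ξ₃ x)
    (hc : ∀ W : ∀ x : M, TangentSpace I x, SmoothSectionAt I E W x →
      ev c W =ᶠ[𝓝 x] courantForm H X₁ ξ₁ X₂ ξ₂ W) :
    courantForm H (mlieBracket I X₁ X₂) c X₃ ξ₃ Z x
      = (der X₁ (der X₂ (ev ξ₃ Z)) x - der X₂ (der X₁ (ev ξ₃ Z)) x)
        - ev ξ₃ (mlieBracket I (mlieBracket I X₁ X₂) Z) x
        - (der X₃ (der X₁ (ev ξ₂ Z)) x - der X₃ (ev ξ₂ (mlieBracket I X₁ Z)) x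
            - der X₃ (der X₂ (ev ξ₁ Z)) x + der X₃ (ev ξ₁ (mlieBracket I X₂ Z)) x
            - 1 / 2 * (der X₃ (der Z (ev ξ₂ X₁)) x - der X₃ (der Z (ev ξ₁ X₂)) x)
            + der X₃ (evH H X₁ X₂ Z) x)
        + (der X₁ (ev ξ₂ (mlieBracket I X₃ Z)) x
            - ev ξ₂ (mlieBracket I X₁ (mlieBracket I X₃ Z)) x
            - der X₂ (ev ξ₁ (mlieBracket I X₃ Z)) x
            + ev ξ₁ (mlieBracket I X₂ (mlieBracket I X₃ Z)) x
            - 1 / 2 * ((der X₃ (der Z (ev ξ₂ X₁)) x - der Z (der X₃ (ev ξ₂ X₁)) x)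
              - (der X₃ (der Z (ev ξ₁ X₂)) x - der Z (der X₃ (ev ξ₁ X₂)) x))
            + evH H (mlieBracket I X₃ Z) X₁ X₂ x)
        - 1 / 2 * (der Z (ev ξ₃ (mlieBracket I X₁ X₂)) x
            - der Z (courantForm H X₁ ξ₁ X₂ ξ₂ X₃) x)
        + evH H (mlieBracket I X₁ X₂) X₃ Z x := by
  have hZ' := smooth_mlieBracket h₃ hZ
  rw [courantForm, der_mlieBracket h₁ h₂ (smooth_ev k₃ hZ), der_congr (hc Z hZ),
    (hc _ hZ').self_of_nhds, der_congr (hc X₃ h₃), der_courantForm H h₁ k₁ h₂ k₂ hZ]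
  rw [show courantForm H X₁ ξ₁ X₂ ξ₂ (mlieBracket I X₃ Z) x = _ from rfl, courantForm,
    der_mlieBracket h₃ hZ (smooth_ev k₂ h₁), der_mlieBracket h₃ hZ (smooth_ev k₁ h₂),
    ← evH_rotate H (X := mlieBracket I X₃ Z)]

/-- The Jacobi identity up to a gradient for the one-form component of the `H`-twisted Courant
bracket of `X₁ + ξ₁`, `X₂ + ξ₂`, `X₃ + ξ₃`; the right-hand side is `Z(T)`. In the
difference of the two sides the second derivatives cancel, the nested Lie brackets cancel by the
Jacobi identity for vector fields, and the terms with `H` add up to `- dH(X₁, X₂, X₃, Z)`. -/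
theorem courantForm_jacobi {c₁₂ c₂₃ c₃₁ : ∀ x : M, Cotangent I x}
    (h₁ : SmoothSectionAt I E X₁ x) (h₂ : SmoothSectionAt I E X₂ x)
    (h₃ : SmoothSectionAt I E X₃ x) (hZ : SmoothSectionAt I E Z x)
    (k₁ : SmoothSectionAt I (E →L[ℝ] ℝ) ξ₁ x) (k₂ : SmoothSectionAt I (E →L[ℝ] ℝ) ξ₂ x)
    (k₃ : SmoothSectionAt I (E →L[ℝ] ℝ) ξ₃ x) (hH : extH H X₁ X₂ X₃ Z x = 0)
    (hc₁₂ : ∀ W : ∀ x : M, TangentSpace I x, SmoothSectionAt I E W x →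
      ev c₁₂ W =ᶠ[𝓝 x] courantForm H X₁ ξ₁ X₂ ξ₂ W)
    (hc₂₃ : ∀ W : ∀ x : M, TangentSpace I x, SmoothSectionAt I E W x →
      ev c₂₃ W =ᶠ[𝓝 x] courantForm H X₂ ξ₂ X₃ ξ₃ W)
    (hc₃₁ : ∀ W : ∀ x : M, TangentSpace I x, SmoothSectionAt I E W x →
      ev c₃₁ W =ᶠ[𝓝 x] courantForm H X₃ ξ₃ X₁ ξ₁ W) :
    courantForm H (mlieBracket I X₁ X₂) c₁₂ X₃ ξ₃ Z x
      + courantForm H (mlieBracket I X₂ X₃) c₂₃ X₁ ξ₁ Z x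
      + courantForm H (mlieBracket I X₃ X₁) c₃₁ X₂ ξ₂ Z x
    = 1 / 6 * (der Z (ev c₁₂ X₃) x + der Z (ev ξ₃ (mlieBracket I X₁ X₂)) x)
      + 1 / 6 * (der Z (ev c₂₃ X₁) x + der Z (ev ξ₁ (mlieBracket I X₂ X₃)) x)
      + 1 / 6 * (der Z (ev c₃₁ X₂) x + der Z (ev ξ₂ (mlieBracket I X₃ X₁)) x) := by
  rw [courantForm_courantForm H h₁ h₂ h₃ hZ k₁ k₂ k₃ hc₁₂,
    courantForm_courantForm H h₂ h₃ h₁ hZ k₂ k₃ k₁ hc₂₃,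
    courantForm_courantForm H h₃ h₁ h₂ hZ k₃ k₁ k₂ hc₃₁,
    der_congr (hc₁₂ _ h₃), der_congr (hc₂₃ _ h₁), der_congr (hc₃₁ _ h₂),
    der_courantForm H h₁ k₁ h₂ k₂ h₃, der_courantForm H h₂ k₂ h₃ k₃ h₁,
    der_courantForm H h₃ k₃ h₁ k₁ h₂]
  have j₁ := ev_jacobi ξ₁ h₂ h₃ hZ
  have j₂ := ev_jacobi ξ₂ h₃ h₁ hZ
  have j₃ := ev_jacobi ξ₃ h₁ h₂ hZ
  rw [extH, evH_bracket_swap H X₁ X₃, evH_swap01 H (X := X₃) (Y := X₁) (Z := Z), der_neg,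
    evH_swap12 H (Y := X₃) (Z := X₁)] at hH
  rw [evH_rotate H (X := X₂) (Y := X₃) (Z := X₁), evH_rotate H (X := X₁) (Y := X₂) (Z := X₃)]
  simp only [ev_bracket_swap _ X₁ X₃, ev_bracket_swap _ X₂ X₁, ev_bracket_swap _ X₃ X₂, der_neg]
  -- all brackets `[Xᵢ, Xⱼ]` are now in the cyclic order `12`, `23`, `31`
  linear_combination j₁ + j₂ + j₃ - hH

end Jacobi

/-! ### The Courant algebroid axioms for the twisted Courant bracket -/

section Sections

variable {X Y Z W : ∀ x : M, TangentSpace I x} {x : M} {ξ η : ∀ x : M, Cotangent I x}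
  {f g : M → ℝ} {s t u : ∀ x : M, GenTangent I x} (β : Bivector I M) (H : ThreeForm I M)

theorem smooth_gen : SmoothSectionAt I (E × (E →L[ℝ] ℝ)) (V := fun x : M => GenTangent I x) s x ↔
    SmoothSectionAt I E (fun y => (s y).1) x ∧
      SmoothSectionAt I (E →L[ℝ] ℝ) (fun y => (s y).2) x := by
  unfold SmoothSectionAt
  rw [contMDiffAt_section, contMDiffAt_section, contMDiffAt_section]
  exact contMDiffAt_prod_module_iff _

theorem SmoothSectionAt.fst
    (hs : SmoothSectionAt I (E × (E →L[ℝ] ℝ)) (V := fun x : M => GenTangent I x) s x) :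
    SmoothSectionAt I E (fun y => (s y).1) x := (smooth_gen.1 hs).1

theorem SmoothSectionAt.snd
    (hs : SmoothSectionAt I (E × (E →L[ℝ] ℝ)) (V := fun x : M => GenTangent I x) s x) :
    SmoothSectionAt I (E →L[ℝ] ℝ) (fun y => (s y).2) x := (smooth_gen.1 hs).2

theorem pairPlus_apply (x : M) (u v : GenTangent I x) :
    pairPlus I x u v = u.2 v.1 + v.2 u.1 := rfl

theorem genAnchor_eq (x : M) (u : GenTangent I x) : genAnchor β x u = (expMap β x u).1 := by
  simp [genAnchor, expMap]

/-- `e^β` is orthogonal, because `β` is skew. -/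
theorem pairPlus_expMap (x : M) (u v : GenTangent I x) :
    pairPlus I x (expMap β x u) (expMap β x v) = pairPlus I x u v := by
  simp only [pairPlus_apply, expMap, LinearMap.coe_mk, AddHom.coe_mk, map_add,
    apply_sharp_swap β x u.2 v.2]
  ring

theorem pairPlus_nondegenerate (x : M) (u : GenTangent I x) (h : ∀ v, pairPlus I x u v = 0) :
    u = 0 := by
  have h1 : u.1 = 0 := vector_ext fun η => by
    simpa [pairPlus_apply] using h ((0, η) : GenTangent I x)
  have h2 : u.2 = 0 := ContinuousLinearMap.ext fun v => by
    simpa [pairPlus_apply] using h ((v, 0) : GenTangent I x)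
  exact Prod.ext h1 h2

/-- The gradient `𝓓f` is `df - β♯df`; since the pairing is non-degenerate, the choice in the
definition of `gradient` plays no role. -/
theorem gradient_eq (f : M → ℝ) (x : M) :
    gradient I (pairPlus I) (genAnchor β) f x
      = ((- sharp β x (dH f x), dH f x) : GenTangent I x) := by
  have h0 : ∀ v, pairPlus I x ((- sharp β x (dH f x), dH f x) : GenTangent I x) v
      = mvfderiv I f x (genAnchor β x v) := fun v => by
    simp only [pairPlus_apply, genAnchor, LinearMap.coprod_apply, LinearMap.id_coe, id_eq,
      map_add, map_neg, ← dH_apply, apply_sharp_swap β x v.2 (dH f x)]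
  have h1 := Classical.epsilon_spec (p := fun e : GenTangent I x =>
    ∀ v : GenTangent I x, pairPlus I x e v = mvfderiv I f x (genAnchor β x v)) ⟨_, h0⟩
  refine sub_eq_zero.1 (pairPlus_nondegenerate x _ fun v => ?_)
  rw [map_sub, LinearMap.sub_apply, h0 v]
  exact sub_eq_zero.2 (h1 v)

/-- Under `e^β` the gradient becomes the differential of the function. -/
theorem expMap_gradient (f : M → ℝ) (x : M) :
    expMap β x (gradient I (pairPlus I) (genAnchor β) f x) = ((0, dH f x) : GenTangent I x) := by
  rw [gradient_eq]
  simp [expMap]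

theorem smooth_expF
    (hs : SmoothSectionAt I (E × (E →L[ℝ] ℝ)) (V := fun x : M => GenTangent I x) s x) :
    SmoothSectionAt I (E × (E →L[ℝ] ℝ)) (V := fun x : M => GenTangent I x) (expF β s) x :=
  smooth_gen.2 ⟨ContMDiffAt.add_section hs.fst (smooth_sharpF β hs.snd), hs.snd⟩

theorem smooth_pairPlus
    (hs : SmoothSectionAt I (E × (E →L[ℝ] ℝ)) (V := fun x : M => GenTangent I x) s x)
    (ht : SmoothSectionAt I (E × (E →L[ℝ] ℝ)) (V := fun x : M => GenTangent I x) t x) :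
    ContMDiffAt I 𝓘(ℝ, ℝ) ∞ (fun y => pairPlus I y (s y) (t y)) x :=
  (smooth_ev hs.snd ht.fst).add (smooth_ev ht.snd hs.fst)

theorem smooth_courantBracket
    (hs : SmoothSectionAt I (E × (E →L[ℝ] ℝ)) (V := fun x : M => GenTangent I x) s x)
    (ht : SmoothSectionAt I (E × (E →L[ℝ] ℝ)) (V := fun x : M => GenTangent I x) t x) :
    SmoothSectionAt I (E × (E →L[ℝ] ℝ)) (V := fun x : M => GenTangent I x)
      (courantBracket H s t) x :=
  smooth_gen.2 ⟨smooth_mlieBracket hs.fst ht.fst,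
    smooth_courantBracket_snd H hs.fst hs.snd ht.fst ht.snd⟩

/-- An equality of sections, so that it can be used inside a further bracket. -/
theorem expF_roytenbergBracket
    (hs : SmoothSection I (E × (E →L[ℝ] ℝ)) (V := fun x : M => GenTangent I x) s)
    (ht : SmoothSection I (E × (E →L[ℝ] ℝ)) (V := fun x : M => GenTangent I x) t) :
    expF β (roytenbergBracket β H s t) = courantBracket H (expF β s) (expF β t) := by
  ext1 x
  exact expMap_roytenbergBracket β H (SmoothSectionAt.fst (hs x)).diff
    (SmoothSectionAt.snd (hs x)).diff (SmoothSectionAt.fst (ht x)).diff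
    (SmoothSectionAt.snd (ht x)).diff

theorem smooth_roytenbergBracket
    (hs : SmoothSection I (E × (E →L[ℝ] ℝ)) (V := fun x : M => GenTangent I x) s)
    (ht : SmoothSection I (E × (E →L[ℝ] ℝ)) (V := fun x : M => GenTangent I x) t) :
    SmoothSection I (E × (E →L[ℝ] ℝ)) (V := fun x : M => GenTangent I x)
      (roytenbergBracket β H s t) := by
  intro x
  have h := smooth_courantBracket H (smooth_expF β (hs x)) (smooth_expF β (ht x))
  rw [← expF_roytenbergBracket β H hs ht] at h
  have h2 : SmoothSectionAt I (E →L[ℝ] ℝ) (fun y => (roytenbergBracket β H s t y).2) x := h.snd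
  refine smooth_gen.2 ⟨?_, h2⟩
  have h3 := ContMDiffAt.sub_section h.fst (smooth_sharpF β h2)
  refine cast ?_ h3
  congr 1
  ext y
  · rfl
  · simp [expF, expMap, sharpF]

end Sections

section CourantAxioms

variable {Z : ∀ x : M, TangentSpace I x} {x : M}
  {f : M → ℝ} {s t u : ∀ x : M, GenTangent I x} (H : ThreeForm I M)

theorem gen_ext {u v : GenTangent I x} (h1 : u.1 = v.1)
    (h2 : ∀ Z : ∀ x : M, TangentSpace I x, SmoothSectionAt I E Z x → u.2 (Z x) = v.2 (Z x)) :
    u = v :=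
  Prod.ext h1 (covector_ext_smooth h2)

variable
  (hs : SmoothSectionAt I (E × (E →L[ℝ] ℝ)) (V := fun x : M => GenTangent I x) s x)
  (ht : SmoothSectionAt I (E × (E →L[ℝ] ℝ)) (V := fun x : M => GenTangent I x) t x)
  (hu : SmoothSectionAt I (E × (E →L[ℝ] ℝ)) (V := fun x : M => GenTangent I x) u x)

include hs ht

theorem courantBracket_apply (hZ : SmoothSectionAt I E Z x) :
    (courantBracket H s t x).2 (Z x)
      = courantForm H (fun y => (s y).1) (fun y => (s y).2) (fun y => (t y).1)
          (fun y => (t y).2) Z x :=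
  courantBracket_snd_apply H hs.fst.diff hs.snd.diff ht.fst.diff ht.snd.diff hZ.diff

theorem courantBracket_skew : courantBracket H s t x = - courantBracket H t s x := by
  refine gen_ext mlieBracket_swap_apply fun Z hZ => ?_
  rw [Prod.snd_neg, neg_apply, courantBracket_apply H hs ht hZ, courantBracket_apply H ht hs hZ,
    courantForm, courantForm, evH_swap01]
  ring

theorem courantBracket_add
    (hu : SmoothSectionAt I (E × (E →L[ℝ] ℝ)) (V := fun x : M => GenTangent I x) u x) :
    courantBracket H s (fun y => t y + u y) x
      = courantBracket H s t x + courantBracket H s u x := by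
  have htu : SmoothSectionAt I (E × (E →L[ℝ] ℝ)) (V := fun x : M => GenTangent I x)
      (fun y => t y + u y) x := ContMDiffAt.add_section ht hu
  refine gen_ext (bracket_add_right ht.fst.diff hu.fst.diff) fun Z hZ => ?_
  have hb : mlieBracket I (fun y => (t y).1 + (u y).1) Z x = _ :=
    bracket_add_left ht.fst.diff hu.fst.diff
  rw [Prod.snd_add, _root_.add_apply, courantBracket_apply H hs htu hZ,
    courantBracket_apply H hs ht hZ,
    courantBracket_apply H hs hu hZ, courantForm, courantForm, courantForm]
  have e1 (W : ∀ x : M, TangentSpace I x) : ev (fun y => (t y + u y).2) W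
      = fun y => ev (fun y => (t y).2) W y + ev (fun y => (u y).2) W y := rfl
  have e2 : ev (fun y => (s y).2) (fun y => (t y + u y).1)
      = fun y => ev (fun y => (s y).2) (fun y => (t y).1) y
        + ev (fun y => (s y).2) (fun y => (u y).1) y := by
    ext y; simp [ev]
  have e3 : ev (fun y => (s y).2) (mlieBracket I (fun y => (t y + u y).1) Z) x
      = ev (fun y => (s y).2) (mlieBracket I (fun y => (t y).1) Z) x
        + ev (fun y => (s y).2) (mlieBracket I (fun y => (u y).1) Z) x := by
    simp only [ev, Prod.fst_add, hb, map_add]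
  have e4 : der (fun y => (t y + u y).1) (ev (fun y => (s y).2) Z) x
      = der (fun y => (t y).1) (ev (fun y => (s y).2) Z) x
        + der (fun y => (u y).1) (ev (fun y => (s y).2) Z) x := by
    simp [der]
  have e5 : evH H (fun y => (s y).1) (fun y => (t y + u y).1) Z x
      = evH H (fun y => (s y).1) (fun y => (t y).1) Z x
        + evH H (fun y => (s y).1) (fun y => (u y).1) Z x := by
    simp only [evH, ← contract_apply, Prod.fst_add, contract_add_right, _root_.add_apply]
  rw [e1 Z, e1 (mlieBracket I (fun y => (s y).1) Z), e1 (fun y => (s y).1), e2, e3, e4, e5,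
    der_add (mdiff_ev ht.snd.diff hZ.diff) (mdiff_ev hu.snd.diff hZ.diff),
    der_add (mdiff_ev ht.snd.diff hs.fst.diff) (mdiff_ev hu.snd.diff hs.fst.diff),
    der_add (mdiff_ev hs.snd.diff ht.fst.diff) (mdiff_ev hs.snd.diff hu.fst.diff)]
  ring

/-- The Leibniz rule for the `H`-twisted Courant bracket, whose gradient is `df`. -/
theorem courantBracket_smul (hf : ContMDiffAt I 𝓘(ℝ, ℝ) ∞ f x) :
    courantBracket H s (fun y => f y • t y) x
      = f x • courantBracket H s t x + mvfderiv I f x (s x).1 • t x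
        - (1 / 2 * pairPlus I x (s x) (t x)) • ((0, dH f x) : GenTangent I x) := by
  have hf' := hf.mdifferentiableAt (by simp : (∞ : WithTop ℕ∞) ≠ 0)
  have hft : SmoothSectionAt I (E × (E →L[ℝ] ℝ)) (V := fun x : M => GenTangent I x)
      (fun y => f y • t y) x := ContMDiffAt.smul_section hf ht
  have hb : mlieBracket I (fun y => (s y).1) (fun y => f y • (t y).1) x = _ :=
    bracket_smul_right hf' ht.fst.diff
  refine gen_ext ?_ fun Z hZ => ?_
  · simp only [courantBracket, Prod.fst_add, Prod.fst_sub, Prod.smul_fst, smul_zero, sub_zero]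
    rw [hb, der]
    exact add_comm _ _
  · have hb' : mlieBracket I (fun y => f y • (t y).1) Z x = _ :=
      bracket_smul_left hf' ht.fst.diff
    simp only [Prod.snd_add, Prod.snd_sub, Prod.smul_snd, _root_.add_apply, sub_apply,
      _root_.smul_apply, smul_eq_mul]
    rw [courantBracket_apply H hs hft hZ, courantBracket_apply H hs ht hZ, courantForm, courantForm]
    have e1 (W : ∀ x : M, TangentSpace I x) :
        ev (fun y => (f y • t y).2) W = fun y => f y * ev (fun y => (t y).2) W y := rfl
    have e2 : ev (fun y => (s y).2) (fun y => (f y • t y).1)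
        = fun y => f y * ev (fun y => (s y).2) (fun y => (t y).1) y := by
      ext y; simp [ev]
    have e3 : ev (fun y => (s y).2) (mlieBracket I (fun y => (f y • t y).1) Z) x
        = - der Z f x * ev (fun y => (s y).2) (fun y => (t y).1) x
          + f x * ev (fun y => (s y).2) (mlieBracket I (fun y => (t y).1) Z) x := by
      simp only [ev, Prod.smul_fst, hb', map_add, map_smul, smul_eq_mul]
    have e4 : der (fun y => (f y • t y).1) (ev (fun y => (s y).2) Z) x
        = f x * der (fun y => (t y).1) (ev (fun y => (s y).2) Z) x := by
      simp [der]
    have e5 : evH H (fun y => (s y).1) (fun y => (f y • t y).1) Z x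
        = f x * evH H (fun y => (s y).1) (fun y => (t y).1) Z x := by
      rw [evH_swap01, evH_swap01 H (X := fun y => (t y).1)]
      have := map_smul (formFirst H x (s x).1 (Z x)) (f x) (t x).1
      simp only [evH, Prod.smul_fst]
      exact (congrArg Neg.neg this).trans (mul_neg _ _).symm
    rw [e1 Z, e1 (mlieBracket I (fun y => (s y).1) Z), e1 (fun y => (s y).1), e2, e3, e4, e5,
      der_mul hf' (mdiff_ev ht.snd.diff hZ.diff),
      der_mul hf' (mdiff_ev ht.snd.diff hs.fst.diff),
      der_mul hf' (mdiff_ev hs.snd.diff ht.fst.diff)]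
    simp only [dH_apply, pairPlus_apply, der, ev]
    ring

/-- Invariance of the pairing for the `H`-twisted Courant bracket. -/
theorem courantBracket_invariance {e : ∀ x : M, GenTangent I x}
    (he : SmoothSectionAt I (E × (E →L[ℝ] ℝ)) (V := fun x : M => GenTangent I x) e x) :
    mvfderiv I (fun y => pairPlus I y (s y) (t y)) x (e x).1
      = pairPlus I x (courantBracket H e s x
          + (1 / 2 : ℝ) • ((0, dH (fun y => pairPlus I y (e y) (s y)) x) : GenTangent I x)) (t x)
        + pairPlus I x (s x) (courantBracket H e t x
          + (1 / 2 : ℝ) • ((0, dH (fun y => pairPlus I y (e y) (t y)) x) : GenTangent I x)) := by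
  have d {a b : ∀ x : M, GenTangent I x} (Z : ∀ x : M, TangentSpace I x)
      (ha : SmoothSectionAt I (E × (E →L[ℝ] ℝ)) (V := fun x : M => GenTangent I x) a x)
      (hb : SmoothSectionAt I (E × (E →L[ℝ] ℝ)) (V := fun x : M => GenTangent I x) b x) :
      der Z (fun y => pairPlus I y (a y) (b y)) x
        = der Z (ev (fun y => (a y).2) (fun y => (b y).1)) x
          + der Z (ev (fun y => (b y).2) (fun y => (a y).1)) x :=
    der_add (mdiff_ev ha.snd.diff hb.fst.diff) (mdiff_ev hb.snd.diff ha.fst.diff)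
  have h0 := d (fun y => (e y).1) hs ht
  have h1 := d (fun y => (t y).1) he hs
  have h2 := d (fun y => (s y).1) he ht
  have h3 := courantBracket_apply H he hs ht.fst
  have h4 := courantBracket_apply H he ht hs.fst
  rw [courantForm] at h3 h4
  rw [evH_swap12] at h4
  have h5 : mlieBracket I (fun y => (s y).1) (fun y => (t y).1) x
    = - mlieBracket I (fun y => (t y).1) (fun y => (s y).1) x := mlieBracket_swap_apply
  simp only [pairPlus_apply, Prod.snd_add, Prod.fst_add, Prod.smul_fst, Prod.smul_snd,
    _root_.add_apply, _root_.smul_apply, smul_eq_mul, smul_zero, add_zero, dH_apply, h3, h4]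
  simp only [der, pairPlus_apply] at h0 h1 h2 ⊢
  rw [h0, h1, h2]
  simp only [ev, h5, map_neg, courantBracket]
  ring

/-- The Jacobi identity up to a gradient for the `H`-twisted Courant bracket, for closed `H`. -/
theorem courantBracket_jacobi (hH : ∀ X Y Z W : ∀ x : M, TangentSpace I x, SmoothSectionAt I E X x →
      SmoothSectionAt I E Y x → SmoothSectionAt I E Z x → SmoothSectionAt I E W x →
      extH H X Y Z W x = 0)
    (hu : SmoothSectionAt I (E × (E →L[ℝ] ℝ)) (V := fun x : M => GenTangent I x) u x) :
    jacobiator (courantBracket H) s t u x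
      = ((0, dH (courantT (pairPlus I) (courantBracket H) s t u) x) : GenTangent I x) := by
  have hst := smooth_courantBracket H hs ht
  have htu := smooth_courantBracket H ht hu
  have hus := smooth_courantBracket H hu hs
  refine gen_ext ?_ fun Z hZ => ?_
  · have h : mlieBracket I (fun y => (u y).1)
        (mlieBracket I (fun y => (s y).1) (fun y => (t y).1)) x = _ :=
      bracket_jacobi hu.fst hs.fst ht.fst
    simp only [jacobiator, Pi.add_apply, Prod.fst_add]
    change mlieBracket I (mlieBracket I (fun y => (s y).1) (fun y => (t y).1)) (fun y => (u y).1) x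
      + mlieBracket I (mlieBracket I (fun y => (t y).1) (fun y => (u y).1)) (fun y => (s y).1) x
      + mlieBracket I (mlieBracket I (fun y => (u y).1) (fun y => (s y).1)) (fun y => (t y).1) x
      = 0
    have h' : mlieBracket I (mlieBracket I (fun y => (t y).1) (fun y => (u y).1))
          (fun y => (s y).1) x
        = mlieBracket I (fun y => (s y).1)
            (mlieBracket I (fun y => (u y).1) (fun y => (t y).1)) x := by
      rw [mlieBracket_swap_apply, mlieBracket_swap (V := fun y => (t y).1) (W := fun y => (u y).1)]
      have := bracket_smul_right (X := fun y => (s y).1)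
        (mdifferentiableAt_const (c := (-1 : ℝ)) (I := I) (x := x) (I' := 𝓘(ℝ, ℝ)))
        (smooth_mlieBracket hu.fst ht.fst).diff
      rw [der_const, zero_smul, zero_add] at this
      rw [show -mlieBracket I (fun y => (u y).1) (fun y => (t y).1) = fun y =>
        (-1 : ℝ) • mlieBracket I (fun y => (u y).1) (fun y => (t y).1) y by
          ext y; simp, this]
      simp
    rw [h', mlieBracket_swap_apply, h]
    abel
  · have key := courantForm_jacobi H hs.fst ht.fst hu.fst hZ hs.snd ht.snd hu.snd
      (hH _ _ _ _ hs.fst ht.fst hu.fst hZ)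
      (fun W hW => eventually_courantBracket_snd H hs.fst hs.snd ht.fst ht.snd hW)
      (fun W hW => eventually_courantBracket_snd H ht.fst ht.snd hu.fst hu.snd hW)
      (fun W hW => eventually_courantBracket_snd H hu.fst hu.snd hs.fst hs.snd hW)
    simp only [jacobiator, Pi.add_apply, Prod.snd_add, _root_.add_apply,
      courantBracket_apply H hst hu hZ, courantBracket_apply H htu hs hZ,
      courantBracket_apply H hus ht hZ]
    refine key.trans ?_
    have d {a b : ∀ x : M, GenTangent I x}
        (ha : SmoothSectionAt I (E × (E →L[ℝ] ℝ)) (V := fun x : M => GenTangent I x) a x)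
        (hb : SmoothSectionAt I (E × (E →L[ℝ] ℝ)) (V := fun x : M => GenTangent I x) b x) :
        MDifferentiableAt I 𝓘(ℝ, ℝ) (fun y => pairPlus I y (a y) (b y)) x ∧
        der Z (fun y => pairPlus I y (a y) (b y)) x
          = der Z (ev (fun y => (a y).2) (fun y => (b y).1)) x
            + der Z (ev (fun y => (b y).2) (fun y => (a y).1)) x :=
      ⟨(smooth_pairPlus ha hb).mdifferentiableAt (by simp),
        der_add (mdiff_ev ha.snd.diff hb.fst.diff) (mdiff_ev hb.snd.diff ha.fst.diff)⟩
    obtain ⟨d1, e1⟩ := d hst hu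
    obtain ⟨d2, e2⟩ := d htu hs
    obtain ⟨d3, e3⟩ := d hus ht
    have c := mdifferentiableAt_const (c := (1 / 6 : ℝ)) (I := I) (x := x) (I' := 𝓘(ℝ, ℝ))
    have e : der Z (courantT (pairPlus I) (courantBracket H) s t u) x = _ :=
      (der_add ((c.mul d1).add (c.mul d2)) (c.mul d3)).trans
      (congrArg₂ (· + ·) ((der_add (c.mul d1) (c.mul d2)).trans
        (congrArg₂ (· + ·) (der_const_mul _ d1) (der_const_mul _ d2))) (der_const_mul _ d3))
    rw [e1, e2, e3] at e
    rw [dH_apply]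
    exact e.symm

end CourantAxioms

/-! ### The Bianchi identity I and closedness of the three-form -/

section Closedness

variable {X Y Z W : ∀ x : M, TangentSpace I x} {x : M} (H : ThreeForm I M)

theorem smooth_contract (hX : SmoothSectionAt I E X x) (hY : SmoothSectionAt I E Y x) :
    SmoothSectionAt I (E →L[ℝ] ℝ) (fun y => contract H y (X y) (Y y)) x :=
  smooth_covector_of_chartFrame fun a => by
    have h : ev (fun y => contract H y (X y) (Y y)) (chartFrame (I := I) x a)
        = evH H X Y (chartFrame x a) := by
      ext y
      exact contract_apply H y _ _ _
    rw [h]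
    exact smooth_evH H hX hY (chartFrame_smooth x a)

theorem evH_eq_ev_contract (X Y Z : ∀ x : M, TangentSpace I x) :
    evH H X Y Z = ev (fun y => contract H y (Y y) (Z y)) X := by
  ext y
  rw [ev, contract_apply, form_rotate, evH]

/-- `dH(X, Y, Z, W)` depends on `X` only through its value at the point. -/
theorem extH_eq_apply (hX : SmoothSectionAt I E X x) (hY : SmoothSectionAt I E Y x)
    (hZ : SmoothSectionAt I E Z x) (hW : SmoothSectionAt I E W x) :
    extH H X Y Z W x
      = ((dH (evH H Y Z W) x - lieCov Y (fun y => contract H y (Z y) (W y)) x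
          + lieCov Z (fun y => contract H y (Y y) (W y)) x
          - lieCov W (fun y => contract H y (Y y) (Z y)) x
          + contract H x (mlieBracket I Y Z x) (W x) - contract H x (mlieBracket I Y W x) (Z x)
          + contract H x (mlieBracket I Z W x) (Y x) : Cotangent I x)) (X x) := by
  simp only [_root_.add_apply, sub_apply, dH_apply,
    lieCov_apply (smooth_contract H hZ hW).diff hX.diff,
    lieCov_apply (smooth_contract H hY hW).diff hX.diff,
    lieCov_apply (smooth_contract H hY hZ).diff hX.diff, extH, evH_bracket_swap H X,
    evH_swap12 H (X := mlieBracket I Y Z) (Y := W) (Z := X),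
    evH_swap12 H (X := mlieBracket I Y W) (Y := Z) (Z := X),
    evH_swap12 H (X := mlieBracket I Z W) (Y := Y) (Z := X)]
  rw [evH_eq_ev_contract H X Z W, evH_eq_ev_contract H X Y W, evH_eq_ev_contract H X Y Z]
  simp only [der, contract_apply, evH]
  rw [form_rotate H x (mlieBracket I Y X x), form_rotate H x (mlieBracket I Z X x),
    form_rotate H x (mlieBracket I W X x)]
  ring

theorem extH_swap01 : extH H Y X Z W x = - extH H X Y Z W x := by
  simp only [extH]
  rw [evH_bracket_swap H Y X, evH_swap01 H (X := X) (Y := Y) (Z := W),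
    evH_swap01 H (X := X) (Y := Y) (Z := Z), der_neg, der_neg,
    evH_swap12 H (X := mlieBracket I Z W) (Y := X) (Z := Y)]
  ring

theorem extH_swap12 : extH H X Z Y W x = - extH H X Y Z W x := by
  simp only [extH]
  rw [evH_bracket_swap H Z Y, evH_swap01 H (X := Y) (Y := Z) (Z := W),
    evH_swap12 H (X := X) (Y := Y) (Z := Z), der_neg, der_neg,
    evH_swap12 H (X := mlieBracket I X W) (Y := Y) (Z := Z)]
  ring

theorem extH_swap23 : extH H X Y W Z x = - extH H X Y Z W x := by
  simp only [extH]
  rw [evH_bracket_swap H W Z, evH_swap12 H (X := Y) (Y := Z) (Z := W),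
    evH_swap12 H (X := X) (Y := Z) (Z := W), der_neg, der_neg,
    evH_swap12 H (X := mlieBracket I X Y) (Y := Z) (Z := W)]
  ring

variable {U : Set M} {e : Fin (Module.finrank ℝ E) → ∀ x : M, TangentSpace I x}
  (he : IsLocalFrameOn I E ∞ e U) (hU : IsOpen U) (hx : x ∈ U) (β : Bivector I M)

include he hU hx

theorem extH_eq_zero_of_frame_left (hX : SmoothSectionAt I E X x) (hY : SmoothSectionAt I E Y x)
    (hZ : SmoothSectionAt I E Z x) (hW : SmoothSectionAt I E W x)
    (h : ∀ a, extH H (e a) Y Z W x = 0) : extH H X Y Z W x = 0 := by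
  rw [extH_eq_apply H hX hY hZ hW, ← sum_coframe_smul he hx (X x), map_sum]
  refine Finset.sum_eq_zero fun a _ => ?_
  rw [map_smul, ← extH_eq_apply H (smooth_frame he hU hx a) hY hZ hW, h, smul_zero]

/-- `dH` vanishes at `x` as soon as its components in one frame do. The slots are freed one after
the other, each being moved to the first place by antisymmetry. -/
theorem extH_eq_zero_of_frame (h : ∀ a b c d, extH H (e a) (e b) (e c) (e d) x = 0)
    (hX : SmoothSectionAt I E X x) (hY : SmoothSectionAt I E Y x)
    (hZ : SmoothSectionAt I E Z x) (hW : SmoothSectionAt I E W x) : extH H X Y Z W x = 0 := by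
  have he' := smooth_frame he hU hx
  have h1 {X : ∀ x : M, TangentSpace I x} (hX : SmoothSectionAt I E X x) (b c d) :
      extH H X (e b) (e c) (e d) x = 0 :=
    extH_eq_zero_of_frame_left H he hU hx hX (he' b) (he' c) (he' d) fun a => h a b c d
  have h2 {X Y : ∀ x : M, TangentSpace I x} (hX : SmoothSectionAt I E X x)
      (hY : SmoothSectionAt I E Y x) (c d) : extH H X Y (e c) (e d) x = 0 :=
    extH_eq_zero_of_frame_left H he hU hx hX hY (he' c) (he' d) fun a => by
      rw [extH_swap01, h1 hY, neg_zero]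
  have h3 {X Y Z : ∀ x : M, TangentSpace I x} (hX : SmoothSectionAt I E X x)
      (hY : SmoothSectionAt I E Y x) (hZ : SmoothSectionAt I E Z x) (d) :
      extH H X Y Z (e d) x = 0 :=
    extH_eq_zero_of_frame_left H he hU hx hX hY hZ (he' d) fun a => by
      rw [extH_swap01, extH_swap12, h2 hY hZ, neg_zero, neg_zero]
  exact extH_eq_zero_of_frame_left H he hU hx hX hY hZ hW fun a => by
    rw [extH_swap01, extH_swap12, extH_swap23, h3 hY hZ hW, neg_zero, neg_zero, neg_zero]

omit hU in
theorem sum_geomF_mul_hComp (a b c d : Fin (Module.finrank ℝ E)) :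
    ∑ m, geomF he a b m x * hComp e H m c d x
      = evH H (mlieBracket I (e a) (e b)) (e c) (e d) x := by
  rw [evH, form_frame_sum he hx]
  rfl

omit hU hx in
theorem hComp_rotate (a b c : Fin (Module.finrank ℝ E)) : hComp e H b c a x = hComp e H a b c x :=
  form_rotate H x _ _ _

omit hU hx in
/-- The `β`-dependent part of `𝓕^m_{ab} 𝓗_{mcd}` is skew under exchange of the pairs `ab`, `cd`. -/
theorem sum_hComp_betaComp_hComp_swap (a b c d : Fin (Module.finrank ℝ E)) :
    ∑ m, (∑ p, hComp e H c d p x * betaComp he β p m x) * hComp e H m a b x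
      = - ∑ m, (∑ p, hComp e H a b p x * betaComp he β p m x) * hComp e H m c d x := by
  simp only [Finset.sum_mul]
  rw [Finset.sum_comm, ← Finset.sum_neg_distrib]
  refine Finset.sum_congr rfl fun m _ => ?_
  rw [← Finset.sum_neg_distrib]
  refine Finset.sum_congr rfl fun p _ => ?_
  rw [betaComp_swap he β m p, ← hComp_rotate (he := he) H m c d, ← hComp_rotate (he := he) H p a b,
    hComp_rotate (he := he) H m c d]
  ring

omit hU in
theorem sum_fluxF_mul_fluxH_add (a b c d : Fin (Module.finrank ℝ E)) :
    (∑ m, fluxF he β H a b m x * fluxH e H m c d x) + ∑ m, fluxF he β H c d m x * fluxH e H m a b x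
      = evH H (mlieBracket I (e a) (e b)) (e c) (e d) x
        + evH H (mlieBracket I (e c) (e d)) (e a) (e b) x := by
  simp only [fluxF, fluxH, sub_mul, Finset.sum_sub_distrib, sum_geomF_mul_hComp H he hx]
  rw [sum_hComp_betaComp_hComp_swap H he β a b c d]
  ring

omit hU hx in
theorem sum_fluxF_mul_fluxH_swap_left (a b c d : Fin (Module.finrank ℝ E)) :
    ∑ m, fluxF he β H b a m x * fluxH e H m c d x
      = - ∑ m, fluxF he β H a b m x * fluxH e H m c d x := by
  rw [← Finset.sum_neg_distrib]
  refine Finset.sum_congr rfl fun m _ => ?_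
  have h (p) : hComp e H b a p x = - hComp e H a b p x := form_swap01 H x _ _ _
  simp only [fluxF, geomF_swap he b a, h, neg_mul, Finset.sum_neg_distrib]
  ring

omit hU hx in
theorem sum_fluxF_mul_fluxH_swap_right (a b c d : Fin (Module.finrank ℝ E)) :
    ∑ m, fluxF he β H a b m x * fluxH e H m d c x
      = - ∑ m, fluxF he β H a b m x * fluxH e H m c d x := by
  rw [← Finset.sum_neg_distrib]
  refine Finset.sum_congr rfl fun m _ => ?_
  have h : fluxH e H m d c x = - fluxH e H m c d x := form_swap12 H x _ _ _
  rw [h]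
  ring

omit hU in
/-- The Bianchi identity I in a frame says that the components of `dH` vanish: after
antisymmetrization, the six terms of `𝓕^m_{ab} 𝓗_{mcd}` pair up as in
`sum_fluxF_mul_fluxH_add`, and four times the identity is the Cartan formula. -/
theorem extH_frame_eq_zero (h : FluxBianchi he β H x) (a b c d : Fin (Module.finrank ℝ E)) :
    extH H (e a) (e b) (e c) (e d) x = 0 := by
  have hI := h.bianchi_I a b c d
  have hs (a b c d) : frameDeriv e a (fluxH e H c b d) x
      = - frameDeriv e a (fluxH e H b c d) x := by
    rw [show fluxH e H c b d = _ from evH_swap01 H (X := e b) (Y := e c) (Z := e d)]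
    exact der_neg
  have hs' (a b c d) : frameDeriv e a (fluxH e H b d c) x
      = - frameDeriv e a (fluxH e H b c d) x := by
    rw [show fluxH e H b d c = _ from evH_swap12 H (X := e b) (Y := e c) (Z := e d)]
    exact der_neg
  rw [asym_four_of_alternating_last (fun a b c d => frameDeriv e a (fluxH e H b c d) x) hs hs',
    asym_four_of_alternating_pairs
      (fun a b c d => ∑ m, fluxF he β H a b m x * fluxH e H m c d x)
      (sum_fluxF_mul_fluxH_swap_left H he β) (sum_fluxF_mul_fluxH_swap_right H he β)] at hI
  have h1 := sum_fluxF_mul_fluxH_add H he hx β a b c d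
  have h2 := sum_fluxF_mul_fluxH_add H he hx β a c b d
  have h3 := sum_fluxF_mul_fluxH_add H he hx β a d b c
  have hd (a b c d) : der (e a) (evH H (e b) (e c) (e d)) x
    = frameDeriv e a (fluxH e H b c d) x := rfl
  rw [extH, hd, hd, hd, hd]
  linear_combination - 4 * hI + h1 - h2 + h3

end Closedness

/-! ### The Courant algebroid -/

section CourantAlgebroid

variable (β : Bivector I M) (H : ThreeForm I M)

/-- The Roytenberg bracket defines a Courant algebroid as soon as `H` is closed. -/
theorem isCourantAlgebroid_roytenbergBracket
    (hH : ∀ (X Y Z W : ∀ x : M, TangentSpace I x) (x : M), SmoothSectionAt I E X x →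
      SmoothSectionAt I E Y x → SmoothSectionAt I E Z x → SmoothSectionAt I E W x →
      extH H X Y Z W x = 0) :
    IsCourantAlgebroid I (E × (E →L[ℝ] ℝ)) (V := fun x : M => GenTangent I x)
      (roytenbergBracket β H) (pairPlus I) (genAnchor β) := by
  have conj {s t : ∀ x : M, GenTangent I x}
      (hs : SmoothSection I (E × (E →L[ℝ] ℝ)) (V := fun x : M => GenTangent I x) s)
      (ht : SmoothSection I (E × (E →L[ℝ] ℝ)) (V := fun x : M => GenTangent I x) t) (x : M) :
      expMap β x (roytenbergBracket β H s t x) = courantBracket H (expF β s) (expF β t) x :=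
    congrFun (expF_roytenbergBracket β H hs ht) x
  have hexp {s : ∀ x : M, GenTangent I x}
      (hs : SmoothSection I (E × (E →L[ℝ] ℝ)) (V := fun x : M => GenTangent I x) s) (x : M) :=
    smooth_expF β (hs x)
  have leib (f : M → ℝ) (s t : ∀ x : M, GenTangent I x) (hf : ContMDiff I 𝓘(ℝ, ℝ) ∞ f)
      (hs : SmoothSection I (E × (E →L[ℝ] ℝ)) (V := fun x : M => GenTangent I x) s)
      (ht : SmoothSection I (E × (E →L[ℝ] ℝ)) (V := fun x : M => GenTangent I x) t) (x : M) :
      roytenbergBracket β H s (fun y => f y • t y) x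
        = f x • roytenbergBracket β H s t x + mvfderiv I f x (genAnchor β x (s x)) • t x
          - (1 / 2 * pairPlus I x (s x) (t x)) • gradient I (pairPlus I) (genAnchor β) f x := by
    have hft : SmoothSection I (E × (E →L[ℝ] ℝ)) (V := fun x : M => GenTangent I x)
        (fun y => f y • t y) := fun y => ContMDiffAt.smul_section (hf y) (ht y)
    apply expMap_injective β x
    have h : expF β (fun y => f y • t y) = fun y => f y • expF β t y := by
      ext1 y
      exact map_smul (expMap β y) (f y) (t y)
    rw [conj hs hft, h, courantBracket_smul H (hexp hs x) (hexp ht x) (hf x), map_sub, map_add,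
      map_smul, map_smul, map_smul, expMap_gradient, conj hs ht, genAnchor_eq]
    simp only [expF, pairPlus_expMap]
  refine
    { pair_smooth := fun s t x hs ht => smooth_pairPlus hs ht
      pair_symm := fun x u v => add_comm _ _
      pair_nondegenerate := pairPlus_nondegenerate
      anchor_smooth := fun s x hs => ?_
      bracket_smooth := fun s t hs ht => smooth_roytenbergBracket β H hs ht
      bracket_skew := fun s t hs ht => ?_
      bracket_add := fun s t u hs ht hu => ?_
      bracket_smul := fun c s t hs ht => ?_
      anchor_bracket := fun s t hs ht x => ?_
      leibniz := leib
      anchor_gradient := fun f _ x => ?_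
      pair_gradient := fun f g _ _ x => ?_
      invariance := fun e s t he hs ht x => ?_
      jacobi := fun s t u hs ht hu x => ?_ }
  · simp only [genAnchor_eq]
    exact (smooth_expF β hs).fst
  · ext1 x
    apply expMap_injective β x
    rw [Pi.neg_apply, map_neg, conj hs ht, conj ht hs]
    exact courantBracket_skew H (hexp hs x) (hexp ht x)
  · have htu : SmoothSection I (E × (E →L[ℝ] ℝ)) (V := fun x : M => GenTangent I x) (t + u) :=
      fun y => ContMDiffAt.add_section (ht y) (hu y)
    ext1 x
    apply expMap_injective β x
    have h : expF β (t + u) = fun y => expF β t y + expF β u y := by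
      ext1 y
      exact map_add (expMap β y) (t y) (u y)
    rw [Pi.add_apply, map_add, conj hs htu, h, conj hs ht, conj hs hu]
    exact courantBracket_add H (hexp hs x) (hexp ht x) (hexp hu x)
  · ext1 x
    -- homogeneity is the Leibniz rule for a constant function
    have h := leib (fun _ => c) s t contMDiff_const hs ht x
    have h0 : gradient I (pairPlus I) (genAnchor β) (fun _ : M => c) x = 0 := by
      have hd : dH (I := I) (fun _ : M => c) x = 0 :=
        ContinuousLinearMap.ext fun v => by simp [dH_apply, mvfderiv_const]
      rw [gradient_eq, hd, map_zero, neg_zero]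
      rfl
    rw [h0, smul_zero, sub_zero, mvfderiv_const] at h
    simp only [_root_.zero_apply, zero_smul, add_zero] at h
    exact h
  · rw [genAnchor_eq, conj hs ht]
    simp only [genAnchor_eq]
    rfl
  · rw [genAnchor_eq, expMap_gradient]
  · rw [← pairPlus_expMap β, expMap_gradient, expMap_gradient, pairPlus_apply]
    simp
  · have h (a b : ∀ x : M, GenTangent I x) : (fun y => pairPlus I y (a y) (b y))
        = fun y => pairPlus I y (expF β a y) (expF β b y) := by
      ext y
      exact (pairPlus_expMap β y _ _).symm
    rw [genAnchor_eq, ← pairPlus_expMap β x _ (t x), ← pairPlus_expMap β x (s x),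
      map_add (expMap β x), map_add (expMap β x), map_smul (expMap β x), map_smul (expMap β x),
      expMap_gradient, expMap_gradient, conj he hs, conj he ht, h s t, h e s,
      h e t]
    exact courantBracket_invariance H (hexp hs x) (hexp ht x) (hexp he x)
  · have hc {s t : ∀ x : M, GenTangent I x} (hs) (ht) :=
      expF_roytenbergBracket (s := s) (t := t) β H hs ht
    have hb {s t : ∀ x : M, GenTangent I x} (hs) (ht) :=
      smooth_roytenbergBracket (s := s) (t := t) β H hs ht
    have hT : courantT (pairPlus I) (roytenbergBracket β H) s t u
        = courantT (pairPlus I) (courantBracket H) (expF β s) (expF β t) (expF β u) := by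
      ext y
      simp only [courantT, ← conj hs ht, ← conj ht hu, ← conj hu hs]
      simp only [expF, pairPlus_expMap]
    apply expMap_injective β x
    rw [expMap_gradient, hT, ← courantBracket_jacobi H (hexp hs x) (hexp ht x)
      (fun X Y Z W => hH X Y Z W x) (hexp hu x)]
    simp only [jacobiator, Pi.add_apply, map_add, conj (hb hs ht) hu, conj (hb ht hu) hs,
      conj (hb hu hs) ht, hc hs ht, hc ht hu, hc hu hs]

end CourantAlgebroid

end FluxCourant
end

theorem mainTheorem1 {E : Type*} [NormedAddCommGroup E] [NormedSpace ℝ E] [FiniteDimensional ℝ E]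
    {B : Type*} [TopologicalSpace B] (I : ModelWithCorners ℝ E B) [I.Boundaryless]
    {M : Type*} [TopologicalSpace M] [ChartedSpace B M] [IsManifold I ∞ M]
    (β : FluxCourant.Bivector I M) (H : FluxCourant.ThreeForm I M)
    (bianchi : ∀ p : M, ∃ (U : Set M) (e : Fin (Module.finrank ℝ E) → ∀ x : M, TangentSpace I x)
      (he : IsLocalFrameOn I E ∞ e U), IsOpen U ∧ p ∈ U ∧
        ∀ x ∈ U, FluxCourant.FluxBianchi he β H x) :
    FluxCourant.IsCourantAlgebroid I (E × (E →L[ℝ] ℝ)) (V := fun x : M => FluxCourant.GenTangent I x)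
      (FluxCourant.roytenbergBracket β H) (FluxCourant.pairPlus I) (FluxCourant.genAnchor β) ∧
    ∀ (U : Set M) (e : Fin (Module.finrank ℝ E) → ∀ x : M, TangentSpace I x)
      (he : IsLocalFrameOn I E ∞ e U), IsOpen U → ∀ x ∈ U, ∀ a b : Fin (Module.finrank ℝ E),
      FluxCourant.roytenbergBracket β H (FluxCourant.ofVec (e a)) (FluxCourant.ofVec (e b)) x
        = ∑ c, FluxCourant.fluxF he β H a b c x • FluxCourant.ofVec (e c) x
          + ∑ c, FluxCourant.fluxH e H a b c x • FluxCourant.ofForm (FluxCourant.coframe he c) x ∧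
      FluxCourant.roytenbergBracket β H (FluxCourant.ofVec (e a))
          (FluxCourant.ofForm (FluxCourant.coframe he b)) x
        = ∑ c, FluxCourant.fluxQ he β H a b c x • FluxCourant.ofVec (e c) x
          - ∑ c, FluxCourant.fluxF he β H a c b x
              • FluxCourant.ofForm (FluxCourant.coframe he c) x ∧
      FluxCourant.roytenbergBracket β H (FluxCourant.ofForm (FluxCourant.coframe he a))
          (FluxCourant.ofForm (FluxCourant.coframe he b)) x
        = ∑ c, FluxCourant.fluxQ he β H c a b x • FluxCourant.ofForm (FluxCourant.coframe he c) x
          + ∑ c, FluxCourant.fluxR he β H a b c x • FluxCourant.ofVec (e c) x := by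
  refine ⟨FluxCourant.isCourantAlgebroid_roytenbergBracket β H fun X Y Z W x hX hY hZ hW => ?_,
    fun U e he hU x hx a b => ⟨FluxCourant.bracket_frame_frame he hU hx β H a b,
      FluxCourant.bracket_frame_coframe he hU hx β H a b,
      FluxCourant.bracket_coframe_coframe he hU hx β H a b⟩⟩
  obtain ⟨U, e, he, hU, hx, h⟩ := bianchi x
  exact FluxCourant.extH_eq_zero_of_frame H he hU hx
    (FluxCourant.extH_frame_eq_zero H he hx β (h x hx)) hX hY hZ hW
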